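/- **Setting.** A network is a connected, locally finite (finite or infinite) simple graph $G=(V,E)$ with a capacity $b_v\in\mathbb N$ on each vertex, a capacity $c_e\in\mathbb N$ on each edge, and possibly further marks, in complete separable metric spaces, on the vertices and on the directed edges. $\mathcal G_*$ (resp. $\mathcal G_{**}$) is the space of isomorphism classes of networks with one distinguished vertex, the root (resp. an ordered pair of distinguished vertices), with the local topology and its Borel $\sigma$-algebra. A Borel probability measure $\rho$ on $\mathcal G_*$ is unimodular if $\int\sum_{v\in V}f(G,r,v)\,d\rho([G,r])=\int\sum_{v\in V}f(G,v,r)\,d\rho([G,r])$ for every Borel $f:\mathcal G_{**}\to[0,\infty]$. For a directed edge $e=\overrightarrow{vu}$ let $c_e$ be the capacity of the edge $vu$, and let $\partial e=\{\overrightarrow{wv}: w\sim v,\ w\ne u\}$. For a collection $\mathbf x$ and a set $S$ of indices, $|\mathbf x_S|=\sum_{i\in S}x_i$. Let $\overrightarrow{\partial v}$ and $\overleftarrow{\partial v}$ be the sets of directed edges into and out of $v$. A message on $e$ is a probability distribution on $\{0,\dots,c_e\}$; for a family $\mathbf m$ of messages, $\alpha(m_e)=\min\{x:m_e(x)>0\}$,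 and $\mathbf m_S(\mathbf y)=\prod_{e\in S}m_e(y_e)$ for $\mathbf y\in\mathbb N^S$. For $\lambda>0$ and $e=\overrightarrow{vu}$, $$\mathcal R^{(\lambda)}_e[\mathbf m](x)=\frac{\lambda^x\mathbf 1(x\le c_e)\sum_{|\mathbf y|\le b_v-x}\mathbf m_{\partial e}(\mathbf y)}{\sum_{t\le c_e}\lambda^t\sum_{|\mathbf y|\le b_v-t}\mathbf m_{\partial e}(\mathbf y)}\quad\text{if }\textstyle\sum_{d\in\partial e}\alpha(m_d)\le b_v,\qquad \mathcal R^{(\lambda)}_e[\mathbf m]=\delta_0\ \text{ otherwise};$$ $$\mathcal D_v[\mathbf m]=\frac{\sum_{|\mathbf x|\le b_v}|\mathbf x|\,\mathbf m_{\overrightarrow{\partial v}}(\mathbf x)}{\sum_{|\mathbf x|\le b_v}\mathbf m_{\overrightarrow{\partial v}}(\mathbf x)}\quad\text{if }\textstyle\sum_{d\in\overrightarrow{\partial v}}\alpha(m_d)\le b_v,\qquad \mathcal D_v[\mathbf m]=b_v\ \text{ otherwise}.$$ Let $\mathbf m^{(\lambda)}$ be the solution of $\mathbf m=\mathcal R_G^{(\lambda)}[\mathbf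 m]$, $\mathbf m^{(\infty)}=\lim_{\lambda\to\infty}\mathbf m^{(\lambda)}$ (pointwise), and $\alpha^{(\infty)}_e=\alpha(m^{(\infty)}_e)$. For $\boldsymbol\alpha\in\mathbb N^{\overrightarrow E}$ and $e=\overrightarrow{vu}$ let $(\mathcal S_G(\boldsymbol\alpha))_e=\min\{c_e,(b_v-|\boldsymbol\alpha_{\partial e}|)^+\}$, and $$F_v(\boldsymbol\alpha)=\min\big(b_v,|\boldsymbol\alpha_{\overrightarrow{\partial v}}|\big)+\big(b_v-|\boldsymbol\alpha_{\overleftarrow{\partial v}}|\big)^+\,\mathbf 1\Big(b_v<\sum_{e\ni v}c_e\Big).$$ **Proposition.** Let $\rho$ be unimodular with $\int b_r\,d\rho([G,r])<\infty$. Then, $\rho$-almost surely, $\mathbf m=\mathcal R_G^{(\lambda)}[\mathbf m]$ has exactly one solution $\mathbf m^{(\lambda)}$ for every $\lambda>0$, the limit $\mathbf m^{(\infty)}$ exists, and $\boldsymbol\alpha^{(\infty)}=\mathcal S_G\circ\mathcal S_G(\boldsymbol\alpha^{(\infty)})$. The functions $\mathcal D_r[\mathbf m^{(\lambda)}]$,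 $\mathcal D_r[\mathbf m^{(\infty)}]$ and $F_r(\boldsymbol\alpha^{(\infty)})$ are $\rho$-measurable, $\lambda\mapsto\int\mathcal D_r[\mathbf m^{(\lambda)}]\,d\rho([G,r])$ is non-decreasing on $(0,\infty)$, and $$\lim_{\lambda\to\infty}\int\mathcal D_r[\mathbf m^{(\lambda)}]\,d\rho=\int\mathcal D_r[\mathbf m^{(\infty)}]\,d\rho=\int F_r(\boldsymbol\alpha^{(\infty)})\,d\rho=\inf_{\rho'}\int F_r(\boldsymbol\alpha)\,d\rho',$$ where the infimum is over all unimodular laws $\rho'$ of networks carrying additional marks $\boldsymbol\alpha\in\mathbb N^{\overrightarrow E}$ such that the network without the marks $\boldsymbol\alpha$ has law $\rho$ and $\boldsymbol\alpha=\mathcal S_G\circ\mathcal S_G(\boldsymbol\alpha)$ holds $\rho'$-almost surely. -/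

import Mathlib

open MeasureTheory Filter Topology Set
open scoped ENNReal

noncomputable section

/-! ## Networks and the spaces of their isomorphism classes -/

/-- A connected locally finite graph with a vertex-constraint `b v` at each vertex, an
edge-constraint `c e` at each (undirected) edge, and further marks on the vertices (in `X`) and on
the directed edges (in `Y`).  Connected locally finite graphs are countable, so vertex sets in
`Type` give all isomorphism classes. -/
structure Network (X : Type*) (Y : Type*) where
  V : Type
  graph : SimpleGraph V
  connected : graph.Connected
  locallyFinite : ∀ v, (graph.neighborSet v).Finite
  b : V → ℕ
  c : graph.edgeSet → ℕ
  vmark : V → X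
  emark : graph.Dart → Y

/-- A network together with a family of distinguished vertices indexed by `ι`. -/
abbrev PointedNetwork (ι : Type) (X : Type*) (Y : Type*) :=
  Σ N : Network X Y, ι → N.V

namespace PointedNetwork

variable {ι : Type} {X Y : Type*}

/-- The vertices at graph distance at most `k` from a distinguished vertex. -/
def ball (P : PointedNetwork ι X Y) (k : ℕ) : Set P.1.V :=
  {v | ∃ i, P.1.graph.dist (P.2 i) v ≤ k}

theorem root_mem_ball (P : PointedNetwork ι X Y) (k : ℕ) (i : ι) : P.2 i ∈ P.ball k :=
  ⟨i, by simp⟩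

/-- Isomorphism of networks that respects all capacities, all marks and the distinguished
vertices. -/
def Isomorphic (P Q : PointedNetwork ι X Y) : Prop :=
  ∃ φ : P.1.graph ≃g Q.1.graph,
    (∀ i, φ (P.2 i) = Q.2 i) ∧
    (∀ v, Q.1.b (φ v) = P.1.b v) ∧
    (∀ e, Q.1.c (φ.mapEdgeSet e) = P.1.c e) ∧
    (∀ v, Q.1.vmark (φ v) = P.1.vmark v) ∧
    (∀ d, Q.1.emark (φ.toHom.mapDart d) = P.1.emark d)

theorem isomorphic_equivalence : Equivalence (Isomorphic (ι := ι) (X := X) (Y := Y)) where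
  refl P := ⟨SimpleGraph.Iso.refl, fun _ => rfl, fun _ => rfl,
    fun e => congrArg P.1.c (by ext1; obtain ⟨e, he⟩ := e; induction e using Sym2.ind; rfl), fun _ => rfl, fun _ => rfl⟩
  symm := by
    rintro P Q ⟨φ, h1, h2, h3, h4, h5⟩
    refine ⟨φ.symm, fun i => ?_, fun v => ?_, fun e => ?_, fun v => ?_, fun d => ?_⟩
    · rw [← h1 i]; simp
    · rw [← h2]; simp
    · rw [← h3]
      exact congrArg Q.1.c (φ.mapEdgeSet.apply_symm_apply e)
    · rw [← h4]; simp
    · rw [← h5]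
      refine congrArg Q.1.emark ?_
      ext <;> simp [SimpleGraph.Hom.mapDart]
  trans := by
    rintro P Q S ⟨φ, h1, h2, h3, h4, h5⟩ ⟨ψ, k1, k2, k3, k4, k5⟩
    refine ⟨φ.trans ψ, fun i => ?_, fun v => ?_, fun e => ?_, fun v => ?_, fun d => ?_⟩
    · rw [← k1, ← h1]; rfl
    · rw [← h2, ← k2]; rfl
    · rw [← h3, ← k3]
      refine congrArg S.1.c ?_
      ext1
      obtain ⟨e, he⟩ := e
      induction e using Sym2.ind
      rfl
    · rw [← h4, ← k4]; rfl
    · rw [← h5, ← k5]; rfl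

instance setoid (ι : Type) (X Y : Type*) : Setoid (PointedNetwork ι X Y) :=
  ⟨Isomorphic, isomorphic_equivalence⟩

/-- There is an isomorphism between the balls of radius `k` around the distinguished vertices
that respects the distinguished vertices and the capacities and moves every mark by less than
`ε`. -/
def Near [PseudoMetricSpace X] [PseudoMetricSpace Y] (k : ℕ) (ε : ℝ)
    (P Q : PointedNetwork ι X Y) : Prop :=
  ∃ φ : P.1.graph.induce (P.ball k) ≃g Q.1.graph.induce (Q.ball k),
    (∀ i, φ ⟨P.2 i, P.root_mem_ball k i⟩ = ⟨Q.2 i, Q.root_mem_ball k i⟩) ∧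
    (∀ v : P.ball k, Q.1.b (φ v) = P.1.b v) ∧
    (∀ v : P.ball k, dist (P.1.vmark v) (Q.1.vmark (φ v)) < ε) ∧
    (∀ (u v : P.ball k) (h : P.1.graph.Adj u v) (h' : Q.1.graph.Adj (φ u) (φ v)),
      Q.1.c ⟨s(↑(φ u), ↑(φ v)), h'⟩ = P.1.c ⟨s(↑u, ↑v), h⟩ ∧
      dist (P.1.emark ⟨(↑u, ↑v), h⟩) (Q.1.emark ⟨(↑(φ u), ↑(φ v)), h'⟩) < ε)

end PointedNetwork

/-- Isomorphism classes of networks with distinguished vertices. -/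
def NetworkSpace (ι : Type) (X : Type*) (Y : Type*) :=
  Quotient (PointedNetwork.setoid ι X Y)

/-- The space `𝒢_*` of isomorphism classes of rooted networks. -/
abbrev RootedSpace (X : Type*) (Y : Type*) := NetworkSpace (Fin 1) X Y

/-- The space `𝒢_**` of isomorphism classes of networks with an ordered pair of distinguished
vertices. -/
abbrev BirootedSpace (X : Type*) (Y : Type*) := NetworkSpace (Fin 2) X Y

namespace NetworkSpace

variable {ι : Type} {X Y : Type*}

/-- The isomorphism class of a network with distinguished vertices. -/
def mk (N : Network X Y) (x : ι → N.V) : NetworkSpace ι X Y :=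
  Quotient.mk (PointedNetwork.setoid ι X Y) ⟨N, x⟩

/-- A representative network of an isomorphism class. -/
def net (q : NetworkSpace ι X Y) : Network X Y := (Quotient.out q).1

/-- The distinguished vertices in the representative. -/
def pts (q : NetworkSpace ι X Y) : ι → q.net.V := (Quotient.out q).2

/-- The root of the representative. -/
def root (q : RootedSpace X Y) : q.net.V := q.pts 0

/-- The local topology: two classes are close if large balls around the distinguished vertices
are isomorphic with corresponding marks close to each other. -/
instance [PseudoMetricSpace X] [PseudoMetricSpace Y] : TopologicalSpace (NetworkSpace ι X Y) :=
  TopologicalSpace.generateFrom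
    {S | ∃ (P : PointedNetwork ι X Y) (k : ℕ) (ε : ℝ), 0 < ε ∧
      S = Quotient.mk (PointedNetwork.setoid ι X Y) '' {Q | P.Near k ε Q}}

instance [PseudoMetricSpace X] [PseudoMetricSpace Y] : MeasurableSpace (NetworkSpace ι X Y) :=
  borel _

end NetworkSpace

/-- Unimodular probability measures: those that obey the Mass-Transport Principle. -/
structure IsUnimodular {X Y : Type*} [PseudoMetricSpace X] [PseudoMetricSpace Y]
    (ρ : Measure (RootedSpace X Y)) : Prop where
  isProbabilityMeasure : IsProbabilityMeasure ρ
  massTransport : ∀ f : BirootedSpace X Y → ℝ≥0∞, Measurable f →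
    ∫⁻ q, ∑' v : q.net.V, f (NetworkSpace.mk q.net ![q.root, v]) ∂ρ
      = ∫⁻ q, ∑' v : q.net.V, f (NetworkSpace.mk q.net ![v, q.root]) ∂ρ

/-! ## Belief propagation on a network -/

/-- Infimum of the support of a distribution on `ℕ`. -/
def suppInf (p : ℕ → ℝ) : ℕ := sInf {x | 0 < p x}

open Classical in
/-- `∑_{y ∈ ℕ^S, |y| = n} ∏_{i ∈ S} m_i(y_i)`, the value at `n` of the convolution of the
`m_i`, `i ∈ S`. -/
def convAt {κ : Type*} (S : Finset κ) (m : κ → ℕ → ℝ) (n : ℕ) : ℝ :=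
  ∑ y ∈ S.piAntidiag n, ∏ i ∈ S, m i (y i)

namespace Network

variable {X Y : Type*} (N : Network X Y)

/-- The capacity of the edge underlying a directed edge. -/
def cap (d : N.graph.Dart) : ℕ := N.c ⟨d.edge, d.edge_mem⟩

theorem finite_darts (v : N.V) : {d : N.graph.Dart | d.snd = v}.Finite := by
  refine Set.Finite.of_finite_image (f := fun d => d.fst)
    ((N.locallyFinite v).subset ?_) ?_
  · rintro _ ⟨d, rfl, rfl⟩
    exact d.adj.symm
  · intro d hd d' hd' h
    ext
    · exact h
    · exact hd.trans (Eq.symm hd')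

/-- The edges directed towards `v`. -/
def inDarts (v : N.V) : Finset N.graph.Dart := (N.finite_darts v).toFinset

open Classical in
/-- For a directed edge `e` from `v` to `u`, the directed edges towards `v` other than the one
from `u`. -/
def preDarts (e : N.graph.Dart) : Finset N.graph.Dart :=
  (N.inDarts e.fst).filter fun d => d ≠ e.symm

/-- A message on every directed edge: a probability distribution on `{0, …, c_e}`. -/
def IsMessage (m : N.graph.Dart → ℕ → ℝ) : Prop :=
  ∀ d, (∀ x, 0 ≤ m d x) ∧ (∀ x, N.cap d < x → m d x = 0) ∧
    ∑ x ∈ Finset.range (N.cap d + 1), m d x = 1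

/-- The numerator of the update: `λ^x 1(x ≤ c_e) ∑_{|y| ≤ b_v - x} ∏ m(y)`. -/
def bpWeight (lam : ℝ) (m : N.graph.Dart → ℕ → ℝ) (e : N.graph.Dart) (x : ℕ) : ℝ :=
  if x ≤ N.cap e then
    lam ^ x * ∑ n ∈ Finset.range (N.b e.fst + 1 - x), convAt (N.preDarts e) m n
  else 0

/-- The belief propagation operator `ℛ_G^{(λ)}`. -/
def bpUpdate (lam : ℝ) (m : N.graph.Dart → ℕ → ℝ) (e : N.graph.Dart) (x : ℕ) : ℝ :=
  if ∑ d ∈ N.preDarts e, suppInf (m d) ≤ N.b e.fst then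
    N.bpWeight lam m e x / ∑ t ∈ Finset.range (N.cap e + 1), N.bpWeight lam m e t
  else if x = 0 then 1 else 0

/-- The fixed point equation `m = ℛ_G^{(λ)}[m]`. -/
def IsBPFixedPoint (lam : ℝ) (m : N.graph.Dart → ℕ → ℝ) : Prop :=
  N.IsMessage m ∧ N.bpUpdate lam m = m

/-- `m^{(λ)}`: the solution of the fixed point equation (used where it exists and is unique). -/
def bpMessage (lam : ℝ) : N.graph.Dart → ℕ → ℝ :=
  Classical.epsilon fun m => N.IsBPFixedPoint lam m

/-- `m^{(∞)}`: the limit of `m^{(λ)}` as `λ → ∞`. -/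
def bpMessageInf (d : N.graph.Dart) (x : ℕ) : ℝ :=
  limUnder atTop fun lam : ℝ => N.bpMessage lam d x

/-- `α^{(∞)}`: the infima of the supports of the messages `m^{(∞)}`. -/
def alphaInf (d : N.graph.Dart) : ℕ := suppInf (N.bpMessageInf d)

/-- The estimated occupancy `𝒟_v[m]` at the vertex `v`. -/
def occupancy (m : N.graph.Dart → ℕ → ℝ) (v : N.V) : ℝ :=
  if ∑ d ∈ N.inDarts v, suppInf (m d) ≤ N.b v then
    (∑ n ∈ Finset.range (N.b v + 1), (n : ℝ) * convAt (N.inDarts v) m n) /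
      ∑ n ∈ Finset.range (N.b v + 1), convAt (N.inDarts v) m n
  else N.b v

/-- The operator `𝒮_G`: `𝒮_e(x) = [b_v - |x_{∂e}|]_0^{c_e}` (truncated subtraction). -/
def capUpdate (a : N.graph.Dart → ℕ) (e : N.graph.Dart) : ℕ :=
  min (N.cap e) (N.b e.fst - ∑ d ∈ N.preDarts e, a d)

/-- `F_v(α) = min(b_v, |α_in|) + (b_v - |α_out|)^+ 1(b_v < ∑_{e ∋ v} c_e)`
(truncated subtraction). -/
def F (a : N.graph.Dart → ℕ) (v : N.V) : ℕ :=
  min (N.b v) (∑ d ∈ N.inDarts v, a d) +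
    if N.b v < ∑ d ∈ N.inDarts v, N.cap d then N.b v - ∑ d ∈ N.inDarts v, a d.symm else 0

/-- Forget an additional `ℕ`-valued mark on the directed edges. -/
def forget (N : Network X (Y × ℕ)) : Network X Y :=
  { V := N.V, graph := N.graph, connected := N.connected, locallyFinite := N.locallyFinite,
    b := N.b, c := N.c, vmark := N.vmark, emark := fun d => (N.emark d).1 }

/-- The additional `ℕ`-valued mark on the directed edges. -/
def extraMark (N : Network X (Y × ℕ)) (d : N.graph.Dart) : ℕ := (N.emark d).2

end Network

/-- Forgetting the additional mark, on isomorphism classes. -/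
def RootedSpace.forget {X Y : Type*} (q : RootedSpace X (Y × ℕ)) : RootedSpace X Y :=
  NetworkSpace.mk q.net.forget q.pts

/-- `ρ'` is a unimodular law of a network distributed as `ρ` with additional marks `α` on the
directed edges, such that almost surely `α = 𝒮_G(𝒮_G(α))`. -/
structure IsFixedPointMarking {X Y : Type*} [PseudoMetricSpace X] [PseudoMetricSpace Y]
    (ρ : Measure (RootedSpace X Y)) (ρ' : Measure (RootedSpace X (Y × ℕ))) : Prop where
  unimodular : IsUnimodular ρ'
  map_forget : ρ'.map RootedSpace.forget = ρ
  fixed : ∀ᵐ q ∂ρ', q.net.capUpdate (q.net.capUpdate q.net.extraMark) = q.net.extraMark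

end

/-!
Messages are replaced by weights normalised to be `1` at `0`, on which belief propagation acts by
`Network.wUpdate`: convolve the incoming weights, take partial sums, reverse the result and truncate
it. Convolution is monotone for the likelihood-ratio order `LRLE` on log-concave sequences (`PF2`)
and reversal inverts this order, so `wUpdate` is order-reversing. The iterates from the point masses
at `0` therefore interlace. Their even and odd limits `wLow ≤ wHigh` are exchanged by `wUpdate`, and
every fixed point lies between them (`Network.lrle_of_fixed`), so the fixed point is unique as soon
as `wLow = wHigh`.

*Uniqueness.* The occupancy of a vertex is the sum of the mean occupancies of its edges
(`Network.wOcc_eq_sum_edgeMean`), and the mean occupancy of an edge depends on the messages in its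
two directions symmetrically. Hence the Mass-Transport Principle
(`IsUnimodular.lintegral_sum_inDarts`) gives equal expected occupancies at the root for `wLow` and
`wHigh`. These occupancies are ordered and integrable, so they agree almost surely, which forces the
messages leaving the root to agree (`Network.wLow_eq_wHigh_of_wOcc_eq`). What holds almost surely at
the root holds at every vertex, and continuity in the activity reduces to rational activities; this
is `IsUnimodular.ae_regular`.

*Large activity.* As the activity `λ` grows, the weights `W x` increase and the scaled weights
`W x / λ ^ x` decrease in the likelihood-ratio order (`Network.wIter_lam_mono`), so both the messages
and the scaled weights converge. The smallest values `aInf` charged by the limits of the messages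
and the largest values `gInf` charged by the limits of the scaled weights are images of one another
under the capacity operator (`Network.Regular.capUpdate_gInf`).

*The value.* Given a fixed point `a` of the iterated capacity operator, let every vertex that is
unsaturated, in the sense that its incoming marks sum to less than its capacity, hand its occupancy
over to its neighbours, edge by edge. This changes neither the expected occupancy nor, for the
corresponding redistribution of marks, the expectation of `F`. After the redistribution the
inequality between the two holds at each vertex (`Network.sum_unsat_le`), which rests on the
dichotomy `Network.fixed_dichotomy` for fixed points. For `a = aInf` the inequality becomes an
equality in the limit (`Network.Regular.tendsto_sum_unsat`), so the limiting expected occupancy is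
the expectation of `F` at `aInf` and is at most the expectation of `F` at any other fixed point.

*Measurability.* Functions of a network with a distinguished directed edge are measured by the
σ-algebra generated by the sets that depend on a ball only, to which the iterates of `wUpdate` are
adapted. A marking that is a measurable function of the network gives a measurable embedding of the
space of networks in the space of marked networks (`measurableEmbedding_mark`), since it is obtained
from markings that depend on a ball only by repeated pointwise limits and these spaces are second
countable. This turns `aInf` into a competitor in the infimum
(`IsUnimodular.isFixedPointMarking_mark`), so that the infimum is attained.
-/


noncomputable section

/-! ### Sequences in the likelihood-ratio order -/

/-- The likelihood-ratio order on non-negative sequences: `g / f` is non-decreasing, in the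
cross-multiplied form. -/
def LRLE (f g : ℕ → ℝ) : Prop := ∀ ⦃x y⦄, x ≤ y → f y * g x ≤ f x * g y

/-- Non-negative log-concave sequences without internal zeros (Pólya frequency sequences of
order two). -/
structure PF2 (f : ℕ → ℝ) : Prop where
  nonneg : ∀ x, 0 ≤ f x
  le : ∀ ⦃x y⦄ d, x ≤ y → f x * f (y + d) ≤ f (x + d) * f y

/-- Convolution of two sequences. -/
def seqConv (f g : ℕ → ℝ) (n : ℕ) : ℝ := ∑ p ∈ Finset.HasAntidiagonal.antidiagonal n, f p.1 * g p.2

/-- The basic composition inequality for a totally positive pair of `2 × n` arrays. -/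
theorem sum_mul_sum_le_of_ratio {ι : Type*} [LinearOrder ι] (s : Finset ι) (p p' K K' : ι → ℝ)
    (hp : ∀ i ∈ s, ∀ j ∈ s, i ≤ j → p j * p' i ≤ p i * p' j)
    (hK : ∀ i ∈ s, ∀ j ∈ s, i ≤ j → K' i * K j ≤ K i * K' j) :
    (∑ i ∈ s, p i * K' i) * (∑ i ∈ s, p' i * K i)
      ≤ (∑ i ∈ s, p i * K i) * (∑ i ∈ s, p' i * K' i) := by
  have h : 0 ≤ ∑ i ∈ s, ∑ j ∈ s, (p i * p' j - p j * p' i) * (K i * K' j - K' i * K j) := by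
    refine Finset.sum_nonneg fun i hi => Finset.sum_nonneg fun j hj => ?_
    rcases le_total i j with hij | hij
    · exact mul_nonneg (sub_nonneg.2 (hp i hi j hj hij)) (sub_nonneg.2 (hK i hi j hj hij))
    · refine mul_nonneg_of_nonpos_of_nonpos ?_ ?_
      · linarith [hp j hj i hi hij]
      · linarith [hK j hj i hi hij]
  have e : ∑ i ∈ s, ∑ j ∈ s, (p i * p' j - p j * p' i) * (K i * K' j - K' i * K j)
      = 2 * ((∑ i ∈ s, p i * K i) * (∑ i ∈ s, p' i * K' i)
        - (∑ i ∈ s, p i * K' i) * (∑ i ∈ s, p' i * K i)) := by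
    have h1 : ∀ i j, (p i * p' j - p j * p' i) * (K i * K' j - K' i * K j)
        = (p i * K i) * (p' j * K' j) - (p i * K' i) * (p' j * K j)
          - (p' i * K i) * (p j * K' j) + (p' i * K' i) * (p j * K j) := fun i j => by ring
    simp only [h1, Finset.sum_add_distrib, Finset.sum_sub_distrib, ← Finset.sum_mul_sum]
    ring
  linarith

/-- Extension of a sequence by zero to the integers. -/
def extZ (f : ℕ → ℝ) (i : ℤ) : ℝ := if 0 ≤ i then f i.toNat else 0

@[simp] theorem extZ_natCast (f : ℕ → ℝ) (n : ℕ) : extZ f n = f n := by simp [extZ]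

theorem extZ_of_neg (f : ℕ → ℝ) {i : ℤ} (h : i < 0) : extZ f i = 0 := by
  simp [extZ, not_le.2 h]

theorem extZ_nonneg {f : ℕ → ℝ} (hf : ∀ x, 0 ≤ f x) (i : ℤ) : 0 ≤ extZ f i := by
  unfold extZ; split_ifs <;> simp [hf]

theorem PF2.extZ_le {f : ℕ → ℝ} (hf : PF2 f) {a b d : ℤ} (hab : a ≤ b) (hd : 0 ≤ d) :
    extZ f a * extZ f (b + d) ≤ extZ f (a + d) * extZ f b := by
  rcases lt_or_ge a 0 with ha | ha
  · rw [extZ_of_neg f ha, zero_mul]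
    exact mul_nonneg (extZ_nonneg hf.nonneg _) (extZ_nonneg hf.nonneg _)
  · lift a to ℕ using ha
    lift b to ℕ using (by omega)
    lift d to ℕ using hd
    have := hf.le d (show a ≤ b by omega)
    rw [← Nat.cast_add, ← Nat.cast_add, extZ_natCast, extZ_natCast, extZ_natCast, extZ_natCast]
    exact this

theorem LRLE.extZ_le {f g : ℕ → ℝ} (h : LRLE f g) (hf : ∀ x, 0 ≤ f x) (hg : ∀ x, 0 ≤ g x)
    {a b : ℤ} (hab : a ≤ b) : extZ f b * extZ g a ≤ extZ f a * extZ g b := by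
  rcases lt_or_ge a 0 with ha | ha
  · rw [extZ_of_neg g ha, mul_zero]
    exact mul_nonneg (extZ_nonneg hf _) (extZ_nonneg hg _)
  · lift a to ℕ using ha
    lift b to ℕ using (by omega)
    simpa using h (show a ≤ b by omega)

/-- Written with sequences extended by zero to `ℤ`, the convolution at `n + d` is a sum over a range
that does not depend on `n`, so that `sum_mul_sum_le_of_ratio` applies to two values of `n`. -/
theorem seqConv_eq_sum_int (f g : ℕ → ℝ) (d n M : ℕ) (h : n ≤ M) :
    seqConv f g (n + d)
      = ∑ i ∈ Finset.Icc (-d : ℤ) M, extZ f (i + d) * extZ g (n - i) := by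
  unfold seqConv
  refine Finset.sum_of_injOn (fun p => (p.1 : ℤ) - d) ?_ ?_ ?_ ?_
  · rintro ⟨a, b⟩ h1 ⟨a', b'⟩ h2 h3
    simp only [Finset.mem_coe, Finset.HasAntidiagonal.mem_antidiagonal] at h1 h2 h3
    ext <;> simp <;> omega
  · rintro ⟨a, b⟩ h1
    simp only [Finset.mem_coe, Finset.HasAntidiagonal.mem_antidiagonal, Finset.mem_Icc] at h1 ⊢
    omega
  · intro i hi h2
    rw [Finset.mem_Icc] at hi
    rcases lt_or_ge ((n : ℤ) - i) 0 with h3 | h3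
    · rw [extZ_of_neg g h3, mul_zero]
    · exfalso
      refine h2 ⟨((i + d).toNat, (n - i).toNat), ?_, ?_⟩
      · simp only [Finset.mem_coe, Finset.HasAntidiagonal.mem_antidiagonal]; omega
      · simp; omega
  · rintro ⟨a, b⟩ h1
    simp only [Finset.HasAntidiagonal.mem_antidiagonal] at h1
    have h2 : (n : ℤ) - (a - d) = (b : ℕ) := by omega
    simp only [sub_add_cancel, h2, extZ_natCast]

theorem seqConv_nonneg {f g : ℕ → ℝ} (hf : ∀ x, 0 ≤ f x) (hg : ∀ x, 0 ≤ g x) (n : ℕ) :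
    0 ≤ seqConv f g n := Finset.sum_nonneg fun _ _ => mul_nonneg (hf _) (hg _)

theorem seqConv_comm (f g : ℕ → ℝ) : seqConv f g = seqConv g f := by
  ext n
  unfold seqConv
  rw [← Finset.Nat.sum_antidiagonal_swap]
  simp [mul_comm]

@[simp] theorem seqConv_zero (f g : ℕ → ℝ) : seqConv f g 0 = f 0 * g 0 := by simp [seqConv]

/-- Log-concave sequences are closed under convolution. -/
theorem PF2.seqConv {f g : ℕ → ℝ} (hf : PF2 f) (hg : PF2 g) : PF2 (seqConv f g) := by
  refine ⟨seqConv_nonneg hf.nonneg hg.nonneg, fun x y d hxy => ?_⟩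
  have e1 := seqConv_eq_sum_int f g d x y hxy
  have e2 := seqConv_eq_sum_int f g d y y le_rfl
  have e3 : _root_.seqConv f g x
      = ∑ i ∈ Finset.Icc (-d : ℤ) y, extZ f i * extZ g (x - i) := by
    have := seqConv_eq_sum_int f g 0 x y hxy
    simp only [Nat.cast_zero, add_zero, neg_zero] at this
    rw [this]
    refine Finset.sum_subset (Finset.Icc_subset_Icc (by omega) le_rfl) fun i hi h2 => ?_
    rw [extZ_of_neg f, zero_mul]
    simp only [Finset.mem_Icc] at hi h2; omega
  have e4 : _root_.seqConv f g y
      = ∑ i ∈ Finset.Icc (-d : ℤ) y, extZ f i * extZ g (y - i) := by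
    have := seqConv_eq_sum_int f g 0 y y le_rfl
    simp only [Nat.cast_zero, add_zero, neg_zero] at this
    rw [this]
    refine Finset.sum_subset (Finset.Icc_subset_Icc (by omega) le_rfl) fun i hi h2 => ?_
    rw [extZ_of_neg f, zero_mul]
    simp only [Finset.mem_Icc] at hi h2; omega
  rw [e1, e2, e3, e4, mul_comm]
  refine sum_mul_sum_le_of_ratio _ _ _ _ _ (fun i _ j _ hij => ?_) (fun i _ j _ hij => ?_)
  · have := hf.extZ_le (d := (d : ℤ)) hij (by positivity)
    linarith
  · have := hg.extZ_le (a := x - j) (b := y - j) (d := j - i) (by omega) (by omega)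
    rw [show (y : ℤ) - j + (j - i) = y - i by ring, show (x : ℤ) - j + (j - i) = x - i by ring]
      at this
    linarith

/-- Convolution with a log-concave sequence preserves the likelihood-ratio order. -/
theorem LRLE.seqConv_right {p p' q : ℕ → ℝ} (h : LRLE p p') (hp : ∀ x, 0 ≤ p x)
    (hp' : ∀ x, 0 ≤ p' x) (hq : PF2 q) : LRLE (seqConv p q) (seqConv p' q) := by
  intro x y hxy
  have e := fun r n (hn : n ≤ y) => seqConv_eq_sum_int r q 0 n y hn
  simp only [Nat.cast_zero, add_zero, neg_zero] at e
  rw [e p y le_rfl, e p' x hxy, e p x hxy, e p' y le_rfl]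
  refine sum_mul_sum_le_of_ratio _ _ _ _ _ (fun i _ j _ hij => h.extZ_le hp hp' hij)
    (fun i _ j _ hij => ?_)
  have := hq.extZ_le (a := x - j) (b := y - j) (d := j - i) (by omega) (by omega)
  rw [show (y : ℤ) - j + (j - i) = y - i by ring, show (x : ℤ) - j + (j - i) = x - i by ring]
    at this
  linarith

theorem LRLE.refl (f : ℕ → ℝ) : LRLE f f := fun x y _ => by rw [mul_comm]

/-- The relation is transitive only with control of the zeros of the middle sequence: every sequence
is comparable with the zero sequence. -/
theorem LRLE.trans_of_right {f g h : ℕ → ℝ} (hf : ∀ x, 0 ≤ f x) (hg : ∀ x, 0 ≤ g x)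
    (hh : ∀ x, 0 ≤ h x) (fg : LRLE f g) (gh : LRLE g h) (h0 : ∀ x, g x = 0 → h x = 0) :
    LRLE f h := by
  intro x y hxy
  rcases (hg x).eq_or_lt with h1 | h1
  · rw [h0 x h1.symm, mul_zero]; exact mul_nonneg (hf _) (hh _)
  rcases (hg y).eq_or_lt with h2 | h2
  · have h3 := fg hxy
    rw [← h2, mul_zero] at h3
    have h4 : f y = 0 := by
      have := hf y
      by_contra h5
      have : 0 < f y * g x := mul_pos (lt_of_le_of_ne this (Ne.symm h5)) h1
      linarith
    rw [h4, zero_mul]; exact mul_nonneg (hf _) (hh _)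
  · have h3 := mul_le_mul (fg hxy) (gh hxy) (mul_nonneg (hg _) (hh _)) (mul_nonneg (hf _) (hg _))
    have h4 : 0 < g x * g y := mul_pos h1 h2
    nlinarith [h3, h4]

/-- Transitivity when the zeros of the middle sequence are zeros of the smaller one. -/
theorem LRLE.trans_of_left {f g h : ℕ → ℝ} (hf : ∀ x, 0 ≤ f x) (hg : ∀ x, 0 ≤ g x)
    (hh : ∀ x, 0 ≤ h x) (fg : LRLE f g) (gh : LRLE g h) (h0 : ∀ x, g x = 0 → f x = 0) :
    LRLE f h := by
  intro x y hxy
  rcases (hg y).eq_or_lt with h1 | h1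
  · rw [h0 y h1.symm, zero_mul]; exact mul_nonneg (hf _) (hh _)
  rcases (hg x).eq_or_lt with h2 | h2
  · have h3 := gh hxy
    rw [← h2, zero_mul] at h3
    have h4 : h x = 0 := by
      have := hh x
      by_contra h5
      have : 0 < g y * h x := mul_pos h1 (lt_of_le_of_ne this (Ne.symm h5))
      linarith
    rw [h4, mul_zero]; exact mul_nonneg (hf _) (hh _)
  · have h3 := mul_le_mul (fg hxy) (gh hxy) (mul_nonneg (hg _) (hh _)) (mul_nonneg (hf _) (hg _))
    have h4 : 0 < g x * g y := mul_pos h2 h1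
    nlinarith [h3, h4]

theorem LRLE.eq_zero_of_eq_zero {f g : ℕ → ℝ} (h : LRLE f g) (hf : ∀ x, 0 ≤ f x) (hg : 0 < g 0)
    {x : ℕ} (hx : g x = 0) : f x = 0 := by
  have := h (Nat.zero_le x)
  rw [hx, mul_zero] at this
  nlinarith [hf x, mul_nonneg (hf x) hg.le]

theorem PF2.truncate {f : ℕ → ℝ} (hf : PF2 f) (t : ℕ) : PF2 (fun x => if x ≤ t then f x else 0) := by
  refine ⟨fun x => by split_ifs <;> simp [hf.nonneg], fun x y d hxy => ?_⟩
  have h0 := hf.nonneg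
  by_cases h : y + d ≤ t
  · simp only [h, show x ≤ t by omega, show x + d ≤ t by omega, show y ≤ t by omega, if_true]
    exact hf.le d hxy
  · simp only [h, if_false, mul_zero]
    split_ifs <;> first | exact mul_nonneg (h0 _) (h0 _) | simp

theorem PF2.truncate_below {f : ℕ → ℝ} (hf : PF2 f) (t : ℕ) :
    PF2 (fun x => if t ≤ x then f x else 0) := by
  refine ⟨fun x => by split_ifs <;> simp [hf.nonneg], fun x y d hxy => ?_⟩
  have h0 := hf.nonneg
  by_cases h : t ≤ x
  · simp only [h, show t ≤ y + d by omega, show t ≤ x + d by omega, show t ≤ y by omega, if_true]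
    exact hf.le d hxy
  · simp only [h, if_false, zero_mul]
    split_ifs <;> first | exact mul_nonneg (h0 _) (h0 _) | simp

theorem seqConv_congr_le {f f' g g' : ℕ → ℝ} {n : ℕ} (hf : ∀ x ≤ n, f x = f' x)
    (hg : ∀ x ≤ n, g x = g' x) : seqConv f g n = seqConv f' g' n := by
  refine Finset.sum_congr rfl fun p hp => ?_
  rw [Finset.HasAntidiagonal.mem_antidiagonal] at hp
  rw [hf _ (by omega), hg _ (by omega)]

theorem seqConv_sum_right {κ : Type*} (s : Finset κ) (w : κ → ℝ) (p : ℕ → ℝ) (f : κ → ℕ → ℝ) (n : ℕ) :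
    seqConv p (fun x => ∑ t ∈ s, w t * f t x) n = ∑ t ∈ s, w t * seqConv p (f t) n := by
  simp only [seqConv, Finset.mul_sum]
  rw [Finset.sum_comm]
  exact Finset.sum_congr rfl fun _ _ => Finset.sum_congr rfl fun _ _ => by ring

/-- Convolution is monotone for the likelihood-ratio order when the larger sequences are
log-concave: the smaller second factor is a mixture of truncations `q' 1(· ≤ t)` of the larger
one, and these truncations are log-concave. -/
theorem LRLE.seqConv_of_pf2_right {p p' q q' : ℕ → ℝ} (hp : LRLE p p') (hq : LRLE q q')
    (p0 : ∀ x, 0 ≤ p x) (q0 : ∀ x, 0 ≤ q x) (hp' : PF2 p') (hq' : PF2 q')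
    (hp'0 : 0 < p' 0) (hq'0 : 0 < q' 0) : LRLE (seqConv p q) (seqConv p' q') := by
  have key : ∀ t, LRLE (seqConv p fun x => if x ≤ t then q' x else 0) (seqConv p' q') := by
    intro t
    have ht := hq'.truncate t
    have h1 := hp.seqConv_right p0 hp'.nonneg ht
    -- first enlarge `p` with the truncated factor fixed, then remove the truncation
    refine LRLE.trans_of_left (seqConv_nonneg p0 ht.nonneg) (seqConv_nonneg hp'.nonneg ht.nonneg)
      (seqConv_nonneg hp'.nonneg hq'.nonneg) h1 ?_ ?_
    · rw [seqConv_comm p', seqConv_comm p']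
      refine LRLE.seqConv_right ?_ ht.nonneg hq'.nonneg hp'
      intro x y hxy
      dsimp only
      split_ifs with h2 h3 h3
      · rw [mul_comm]
      · omega
      · rw [zero_mul]; exact mul_nonneg (hq'.nonneg _) (hq'.nonneg _)
      · simp
    · intro x hx
      exact h1.eq_zero_of_eq_zero (seqConv_nonneg p0 ht.nonneg) (by simp [hp'0, hq'0]) hx
  intro x y hxy
  -- the mixture weights are the decrements of `q / q'`, cut off beyond `y`
  set h : ℕ → ℝ := fun t => if t ≤ y then q t / q' t else 0 with hh
  have hanti : ∀ t, h (t + 1) ≤ h t := by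
    intro t
    simp only [hh]
    split_ifs with h1 h2 h2
    · rcases (hq'.nonneg (t + 1)).eq_or_lt with h3 | h3
      · rw [← h3, div_zero]; exact div_nonneg (q0 _) (hq'.nonneg _)
      · have h4 : 0 < q' t := by
          have h5 := hq'.le 1 (Nat.zero_le t)
          rcases (hq'.nonneg t).eq_or_lt with h6 | h6
          · rw [← h6, mul_zero] at h5
            have := mul_pos hq'0 h3
            linarith
          · exact h6
        rw [div_le_div_iff₀ h3 h4]
        exact hq (Nat.le_succ t)
    · omega
    · exact div_nonneg (q0 _) (hq'.nonneg _)
    · exact le_rfl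
  have hqe : ∀ z ≤ y, q z = ∑ t ∈ Finset.range (y + 1),
      (h t - h (t + 1)) * (if z ≤ t then q' z else 0) := by
    intro z hz
    have e1 : ∀ t, (h t - h (t + 1)) * (if z ≤ t then q' z else 0)
        = (if z ≤ t then (h t - h (t + 1)) else 0) * q' z := fun t => by split_ifs <;> simp
    simp only [e1, ← Finset.sum_mul]
    rw [← Finset.sum_filter]
    have e2 : (Finset.range (y + 1)).filter (fun t => z ≤ t) = Finset.Ico z (y + 1) := by
      ext t; simp; omega
    rw [e2, Finset.sum_Ico_eq_sum_range]
    have e3 : ∀ k, ∑ i ∈ Finset.range k, (h (z + i) - h (z + i + 1)) = h z - h (z + k) := by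
      intro k
      induction k with
      | zero => simp
      | succ k ih => rw [Finset.sum_range_succ, ih]; ring_nf
    rw [e3, show z + (y + 1 - z) = y + 1 by omega]
    simp only [hh, hz, if_true, show ¬ (y + 1 ≤ y) by omega, if_false, sub_zero]
    rcases eq_or_ne (q' z) 0 with h1 | h1
    · rw [h1, mul_zero]; exact hq.eq_zero_of_eq_zero q0 hq'0 h1
    · rw [div_mul_cancel₀ _ h1]
  have hc : ∀ n ≤ y, seqConv p q n = ∑ t ∈ Finset.range (y + 1),
      (h t - h (t + 1)) * seqConv p (fun x => if x ≤ t then q' x else 0) n := by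
    intro n hn
    rw [← seqConv_sum_right]
    exact seqConv_congr_le (fun _ _ => rfl) fun z hz => hqe z (hz.trans hn)
  rw [hc y le_rfl, hc x hxy, Finset.sum_mul, Finset.sum_mul]
  refine Finset.sum_le_sum fun t _ => ?_
  rw [mul_assoc, mul_assoc]
  exact mul_le_mul_of_nonneg_left (key t hxy) (sub_nonneg.2 (hanti t))

/-- Convolution is monotone for the likelihood-ratio order when the smaller sequences are
log-concave: the larger second factor is a mixture of truncations `q 1(· ≥ t)` of the smaller
one. -/
theorem LRLE.seqConv_of_pf2_left {p p' q q' : ℕ → ℝ} (hp : LRLE p p') (hq : LRLE q q')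
    (hpf : PF2 p) (hqf : PF2 q) (p0 : ∀ x, 0 ≤ p' x) (q0 : ∀ x, 0 ≤ q' x)
    (hps : ∀ x, p x = 0 → p' x = 0) (hqs : ∀ x, q x = 0 → q' x = 0) :
    LRLE (seqConv p q) (seqConv p' q') := by
  have key : ∀ t, LRLE (seqConv p q) (seqConv p' fun x => if t ≤ x then q x else 0) := by
    intro t
    have ht := hqf.truncate_below t
    -- first truncate the factor `q`, then enlarge `p` with the truncated factor fixed
    refine LRLE.trans_of_right (seqConv_nonneg hpf.nonneg hqf.nonneg)
      (seqConv_nonneg hpf.nonneg ht.nonneg) (seqConv_nonneg p0 ht.nonneg) ?_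
      (hp.seqConv_right hpf.nonneg p0 ht) ?_
    · rw [seqConv_comm p, seqConv_comm p]
      refine LRLE.seqConv_right ?_ hqf.nonneg ht.nonneg hpf
      intro x y hxy
      dsimp only
      split_ifs with h2 h3 h3
      · rw [mul_comm]
      · omega
      · rw [mul_zero]; exact mul_nonneg (hqf.nonneg _) (hqf.nonneg _)
      · simp
    · intro x hx
      unfold seqConv at hx ⊢
      rw [Finset.sum_eq_zero_iff_of_nonneg
        (fun _ _ => mul_nonneg (hpf.nonneg _) (ht.nonneg _))] at hx
      refine Finset.sum_eq_zero fun i hi => ?_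
      rcases mul_eq_zero.1 (hx i hi) with h1 | h1
      · rw [hps _ h1, zero_mul]
      · exact mul_eq_zero_of_right _ h1
  intro x y hxy
  -- the mixture weights are the increments of `q' / q` on the support of `q`
  set h : ℕ → ℝ := fun t => q' t / q t with hh
  set w : ℕ → ℝ := fun t => if t = 0 then h 0 else if q t = 0 then 0 else h t - h (t - 1) with hw
  have hw0 : ∀ t, 0 ≤ w t := by
    intro t
    simp only [hw]
    split_ifs with h1 h2
    · exact div_nonneg (q0 _) (hqf.nonneg _)
    · exact le_rfl
    · obtain ⟨t, rfl⟩ := Nat.exists_eq_succ_of_ne_zero h1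
      simp only [Nat.succ_eq_add_one, Nat.add_sub_cancel, hh]
      have h3 : 0 < q (t + 1) := lt_of_le_of_ne (hqf.nonneg _) (Ne.symm h2)
      rw [sub_nonneg]
      rcases (hqf.nonneg t).eq_or_lt with h4 | h4
      · rw [← h4, div_zero]; exact div_nonneg (q0 _) (hqf.nonneg _)
      · rw [div_le_div_iff₀ h4 h3]
        linarith [hq (Nat.le_succ t)]
  have hsum : ∀ z, q z ≠ 0 → ∑ t ∈ Finset.range (z + 1), w t = h z := by
    intro z
    induction z with
    | zero => intro _; simp [hw]
    | succ z ih =>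
      intro hz
      rw [Finset.sum_range_succ]
      have e : w (z + 1) = h (z + 1) - h z := by simp [hw, hz]
      rcases eq_or_ne (q z) 0 with h1 | h1
      · -- zeros of `q` below its support
        have h2 : ∀ t ≤ z, q t = 0 := by
          intro t ht
          by_contra h3
          have h5 := hqf.le 1 ht
          have h6 : 0 < q (z + 1) := lt_of_le_of_ne (hqf.nonneg _) (Ne.symm hz)
          have h7 : 0 < q t := lt_of_le_of_ne (hqf.nonneg _) (Ne.symm h3)
          rw [h1, mul_zero] at h5
          nlinarith [mul_pos h7 h6]
        have h3 : ∑ t ∈ Finset.range (z + 1), w t = 0 := by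
          refine Finset.sum_eq_zero fun t ht => ?_
          rw [Finset.mem_range] at ht
          simp only [hw]
          split_ifs with h4 h5
          · subst h4; simp [hh, h2 0 (Nat.zero_le _)]
          · rfl
          · exact absurd (h2 t (by omega)) h5
        rw [h3, e]; simp [hh, h1]
      · rw [ih h1, e]; ring
  have hqe : ∀ z ≤ y, q' z = ∑ t ∈ Finset.range (y + 1), w t * (if t ≤ z then q z else 0) := by
    intro z hz
    have e1 : ∀ t, w t * (if t ≤ z then q z else 0) = (if t ≤ z then w t else 0) * q z :=
      fun t => by split_ifs <;> simp
    simp only [e1, ← Finset.sum_mul]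
    rw [← Finset.sum_filter]
    have e2 : (Finset.range (y + 1)).filter (fun t => t ≤ z) = Finset.range (z + 1) := by
      ext t; simp; omega
    rw [e2]
    rcases eq_or_ne (q z) 0 with h1 | h1
    · rw [h1, mul_zero, hqs z h1]
    · rw [hsum z h1]; simp only [hh]; rw [div_mul_cancel₀ _ h1]
  have hc : ∀ n ≤ y, seqConv p' q' n = ∑ t ∈ Finset.range (y + 1),
      w t * seqConv p' (fun x => if t ≤ x then q x else 0) n := by
    intro n hn
    rw [← seqConv_sum_right]
    exact seqConv_congr_le (fun _ _ => rfl) fun z hz => hqe z (hz.trans hn)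
  rw [hc y le_rfl, hc x hxy, Finset.mul_sum, Finset.mul_sum]
  refine Finset.sum_le_sum fun t _ => ?_
  have := mul_le_mul_of_nonneg_left (key t hxy) (hw0 t)
  linarith

end

noncomputable section

/-! ### Convolutions of finite families -/

/-- The support of a log-concave sequence that is positive at `0` is an initial segment. -/
theorem PF2.pos_of_le {f : ℕ → ℝ} (hf : PF2 f) {x y : ℕ} (h0 : 0 < f 0) (hy : 0 < f y)
    (hxy : x ≤ y) : 0 < f x := by
  have h := hf.le (y - x) (Nat.zero_le x)
  rw [show x + (y - x) = y by omega] at h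
  rcases (hf.nonneg x).eq_or_lt with h1 | h1
  · rw [← h1, mul_zero] at h
    linarith [mul_pos h0 hy]
  · exact h1

theorem PF2.delta : PF2 (fun n => if n = 0 then (1 : ℝ) else 0) := by
  refine ⟨fun x => by split_ifs <;> simp, fun x y d hxy => ?_⟩
  by_cases h : y + d = 0
  · simp [show x = 0 by omega, show y = 0 by omega, show d = 0 by omega]
  · simp only [h, if_false, mul_zero]
    split_ifs <;> simp

theorem PF2.geom {r : ℝ} (hr : 0 ≤ r) : PF2 (fun n => r ^ n) :=
  ⟨fun _ => pow_nonneg hr _, fun x y d _ => by rw [← pow_add, ← pow_add]; apply le_of_eq; ring_nf⟩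

theorem LRLE.geom {r s : ℝ} (hr : 0 ≤ r) (hrs : r ≤ s) : LRLE (fun n => r ^ n) (fun n => s ^ n) := by
  intro x y hxy
  obtain ⟨d, rfl⟩ := Nat.exists_eq_add_of_le hxy
  have h1 : r ^ d ≤ s ^ d := pow_le_pow_left₀ hr hrs d
  have h2 : 0 ≤ r ^ x * s ^ x := mul_nonneg (pow_nonneg hr _) (pow_nonneg (hr.trans hrs) _)
  dsimp only
  rw [pow_add, pow_add]
  nlinarith [mul_le_mul_of_nonneg_left h1 h2]

theorem mk_seqConv (f g : ℕ → ℝ) :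
    PowerSeries.mk (seqConv f g) = PowerSeries.mk f * PowerSeries.mk g := by
  ext n
  simp [PowerSeries.coeff_mul, seqConv]

variable {κ : Type*}

/-- Convolutions of families are coefficients of products of power series, which gives their
algebraic rules. -/
theorem convAt_eq_coeff (S : Finset κ) (m : κ → ℕ → ℝ) (n : ℕ) :
    convAt S m n = PowerSeries.coeff n (∏ i ∈ S, PowerSeries.mk (m i)) := by
  classical
  rw [PowerSeries.coeff_prod]
  unfold convAt
  simp only [PowerSeries.coeff_mk]
  symm
  refine Finset.sum_bij (fun (l : κ →₀ ℕ) _ => (l : κ → ℕ)) ?_ ?_ ?_ ?_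
  · intro l hl
    rw [Finset.mem_finsuppAntidiag] at hl
    rw [Finset.mem_piAntidiag]
    exact ⟨hl.1, fun i hi => hl.2 (Finsupp.mem_support_iff.2 hi)⟩
  · intro l _ l' _ h
    exact DFunLike.coe_injective h
  · intro y hy
    rw [Finset.mem_piAntidiag] at hy
    refine ⟨Finsupp.onFinset S y hy.2, ?_, rfl⟩
    rw [Finset.mem_finsuppAntidiag]
    exact ⟨hy.1, Finsupp.support_onFinset_subset⟩
  · intro l _; convert rfl

theorem mk_convAt (S : Finset κ) (m : κ → ℕ → ℝ) :
    PowerSeries.mk (convAt S m) = ∏ i ∈ S, PowerSeries.mk (m i) := by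
  ext n; simp [convAt_eq_coeff]

theorem convAt_empty (m : κ → ℕ → ℝ) : convAt ∅ m = fun n => if n = 0 then (1 : ℝ) else 0 := by
  ext n; simp [convAt_eq_coeff, PowerSeries.coeff_one]

open Classical in
theorem convAt_insert {S : Finset κ} {a : κ} (ha : a ∉ S) (m : κ → ℕ → ℝ) :
    convAt (insert a S) m = seqConv (m a) (convAt S m) := by
  ext n
  rw [convAt_eq_coeff, Finset.prod_insert ha, ← mk_convAt, ← mk_seqConv, PowerSeries.coeff_mk]

open Classical in
theorem convAt_erase {S : Finset κ} {a : κ} (ha : a ∈ S) (m : κ → ℕ → ℝ) :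
    convAt S m = seqConv (m a) (convAt (S.erase a) m) := by
  rw [← convAt_insert (Finset.notMem_erase a S), Finset.insert_erase ha]

theorem convAt_bij {κ' : Type*} (S : Finset κ) (S' : Finset κ') (m : κ → ℕ → ℝ) (m' : κ' → ℕ → ℝ)
    (i : ∀ a ∈ S, κ') (hi : ∀ a ha, i a ha ∈ S')
    (i_inj : ∀ a₁ h₁ a₂ h₂, i a₁ h₁ = i a₂ h₂ → a₁ = a₂)
    (i_surj : ∀ b ∈ S', ∃ a ha, i a ha = b) (h : ∀ a ha, m a = m' (i a ha)) :
    convAt S m = convAt S' m' := by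
  ext n
  rw [convAt_eq_coeff, convAt_eq_coeff, Finset.prod_bij i hi i_inj i_surj]
  intro a ha; rw [h a ha]

theorem convAt_congr {S : Finset κ} {m m' : κ → ℕ → ℝ} (h : ∀ i ∈ S, m i = m' i) :
    convAt S m = convAt S m' := by
  ext n
  rw [convAt_eq_coeff, convAt_eq_coeff, Finset.prod_congr rfl fun i hi => by rw [h i hi]]

theorem convAt_nonneg {S : Finset κ} {m : κ → ℕ → ℝ} (h : ∀ i ∈ S, ∀ x, 0 ≤ m i x) (n : ℕ) :
    0 ≤ convAt S m n :=
  Finset.sum_nonneg fun _ _ => Finset.prod_nonneg fun i hi => h i hi _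

theorem convAt_zero (S : Finset κ) (m : κ → ℕ → ℝ) : convAt S m 0 = ∏ i ∈ S, m i 0 := by
  rw [convAt_eq_coeff, PowerSeries.coeff_zero_eq_constantCoeff_apply, map_prod]
  simp [← PowerSeries.coeff_zero_eq_constantCoeff_apply]

theorem convAt_zero_pos {S : Finset κ} {m : κ → ℕ → ℝ} (h : ∀ i ∈ S, 0 < m i 0) :
    0 < convAt S m 0 := by
  rw [convAt_zero]; exact Finset.prod_pos h

theorem PF2.convAt {S : Finset κ} {m : κ → ℕ → ℝ} (h : ∀ i ∈ S, PF2 (m i)) :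
    PF2 (convAt S m) := by
  classical
  induction S using Finset.induction_on with
  | empty => rw [convAt_empty]; exact PF2.delta
  | insert a S ha ih =>
    rw [convAt_insert ha]
    exact (h a (by simp)).seqConv (ih fun i hi => h i (by simp [hi]))

/-- Convolution of a family is monotone if the larger sequences are log-concave. -/
theorem LRLE.convAt_of_pf2_right {S : Finset κ} {m m' : κ → ℕ → ℝ} (h : ∀ i ∈ S, LRLE (m i) (m' i))
    (h0 : ∀ i ∈ S, ∀ x, 0 ≤ m i x) (h' : ∀ i ∈ S, PF2 (m' i)) (hpos : ∀ i ∈ S, 0 < m' i 0) :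
    LRLE (convAt S m) (convAt S m') := by
  classical
  induction S using Finset.induction_on with
  | empty => rw [convAt_empty, convAt_empty]; exact LRLE.refl _
  | insert a S ha ih =>
    rw [convAt_insert ha, convAt_insert ha]
    simp only [Finset.mem_insert, forall_eq_or_imp] at h h0 h' hpos
    exact h.1.seqConv_of_pf2_right (ih h.2 h0.2 h'.2 hpos.2) h0.1 (convAt_nonneg h0.2) h'.1
      (PF2.convAt h'.2) hpos.1 (convAt_zero_pos hpos.2)

theorem convAt_eq_zero_iff {S : Finset κ} {m : κ → ℕ → ℝ} (h : ∀ i ∈ S, ∀ x, 0 ≤ m i x) {n : ℕ} :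
    convAt S m n = 0 ↔
      ∀ y : κ → ℕ, S.sum y = n → (∀ i, y i ≠ 0 → i ∈ S) → ∃ i ∈ S, m i (y i) = 0 := by
  classical
  unfold convAt
  rw [Finset.sum_eq_zero_iff_of_nonneg fun y _ => Finset.prod_nonneg fun i hi => h i hi _]
  simp only [Finset.mem_piAntidiag, Finset.prod_eq_zero_iff, and_imp]

/-- Convolution of a family is monotone if the smaller sequences are log-concave and the supports
of the larger ones are contained in theirs. -/
theorem LRLE.convAt_of_pf2_left {S : Finset κ} {m m' : κ → ℕ → ℝ} (h : ∀ i ∈ S, LRLE (m i) (m' i))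
    (h0 : ∀ i ∈ S, PF2 (m i)) (h' : ∀ i ∈ S, ∀ x, 0 ≤ m' i x)
    (hs : ∀ i ∈ S, ∀ x, m i x = 0 → m' i x = 0) :
    LRLE (convAt S m) (convAt S m') := by
  classical
  induction S using Finset.induction_on with
  | empty => rw [convAt_empty, convAt_empty]; exact LRLE.refl _
  | insert a S ha ih =>
    rw [convAt_insert ha, convAt_insert ha]
    simp only [Finset.mem_insert, forall_eq_or_imp] at h h0 h' hs
    refine h.1.seqConv_of_pf2_left (ih h.2 h0.2 h'.2 hs.2) h0.1 (PF2.convAt h0.2) h'.1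
      (convAt_nonneg h'.2) hs.1 fun x hx => ?_
    rw [convAt_eq_zero_iff fun i hi => (h0.2 i hi).nonneg] at hx
    rw [convAt_eq_zero_iff h'.2]
    intro y hy hy'
    obtain ⟨i, hi, hi'⟩ := hx y hy hy'
    exact ⟨i, hi, hs.2 i hi _ hi'⟩

theorem convAt_mul_pow (S : Finset κ) (m : κ → ℕ → ℝ) (r : ℝ) (n : ℕ) :
    convAt S (fun i x => m i x * r ^ x) n = convAt S m n * r ^ n := by
  classical
  unfold convAt
  rw [Finset.sum_mul]
  refine Finset.sum_congr (by congr!) fun y hy => ?_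
  rw [Finset.mem_piAntidiag] at hy
  rw [Finset.prod_mul_distrib, Finset.prod_pow_eq_pow_sum, hy.1]

theorem convAt_const_mul (S : Finset κ) (m : κ → ℕ → ℝ) (c : κ → ℝ) (n : ℕ) :
    convAt S (fun i x => c i * m i x) n = (∏ i ∈ S, c i) * convAt S m n := by
  classical
  unfold convAt
  rw [Finset.mul_sum]
  exact Finset.sum_congr rfl fun _ _ => Finset.prod_mul_distrib

theorem convAt_mono {S : Finset κ} {m m' : κ → ℕ → ℝ} (h0 : ∀ i ∈ S, ∀ x, 0 ≤ m i x)
    (h : ∀ i ∈ S, ∀ x, m i x ≤ m' i x) (n : ℕ) : convAt S m n ≤ convAt S m' n :=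
  Finset.sum_le_sum fun _ _ => Finset.prod_le_prod (fun i hi => h0 i hi _) fun i hi => h i hi _

/-- If two pointwise ordered families of sequences starting at `1` have the same convolution at
`n`, then they agree at `n`. -/
theorem eq_of_convAt_eq {S : Finset κ} {m m' : κ → ℕ → ℝ} (h0 : ∀ i ∈ S, ∀ x, 0 ≤ m i x)
    (h : ∀ i ∈ S, ∀ x, m i x ≤ m' i x) (h1 : ∀ i ∈ S, m i 0 = 1) (h1' : ∀ i ∈ S, m' i 0 = 1) {n : ℕ}
    (he : convAt S m n = convAt S m' n) {i : κ} (hi : i ∈ S) : m i n = m' i n := by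
  classical
  refine le_antisymm (h i hi n) ?_
  rw [convAt_erase hi, convAt_erase hi] at he
  unfold seqConv at he
  have hs : S.erase i ⊆ S := Finset.erase_subset _ _
  have hle : ∀ p ∈ Finset.HasAntidiagonal.antidiagonal n, m i p.1 * convAt (S.erase i) m p.2
      ≤ m' i p.1 * convAt (S.erase i) m' p.2 := fun p _ =>
    mul_le_mul (h i hi _) (convAt_mono (fun j hj => h0 j (hs hj)) (fun j hj => h j (hs hj)) _)
      (convAt_nonneg (fun j hj => h0 j (hs hj)) _) ((h0 i hi _).trans (h i hi _))
  have h2 := (Finset.sum_eq_sum_iff_of_le hle).1 he (n, 0)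
    (by simp [Finset.HasAntidiagonal.mem_antidiagonal])
  simp only [convAt_zero] at h2
  rw [Finset.prod_eq_one fun j hj => h1 j (hs hj), Finset.prod_eq_one fun j hj => h1' j (hs hj)] at h2
  linarith

open Classical in
/-- The size-biased convolution, split according to the factors. -/
theorem mul_convAt (S : Finset κ) (m : κ → ℕ → ℝ) (n : ℕ) :
    (n : ℝ) * convAt S m n
      = ∑ i ∈ S, seqConv (fun x => x * m i x) (convAt (S.erase i) m) n := by
  have h1 : ∀ i ∈ S, seqConv (fun x => x * m i x) (convAt (S.erase i) m)
      = convAt S (Function.update m i fun x => x * m i x) := by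
    intro i hi
    rw [convAt_erase hi, Function.update_self]
    congr 1
    exact convAt_congr fun j hj => by rw [Function.update_of_ne (Finset.ne_of_mem_erase hj)]
  rw [Finset.sum_congr rfl fun i hi => by rw [h1 i hi]]
  unfold convAt
  rw [Finset.sum_comm, Finset.mul_sum]
  refine Finset.sum_congr rfl fun y hy => ?_
  rw [Finset.mem_piAntidiag] at hy
  have h2 : ∀ i ∈ S, ∏ j ∈ S, Function.update m i (fun x => x * m i x) j (y j)
      = y i * ∏ j ∈ S, m j (y j) := by
    intro i hi
    rw [← Finset.mul_prod_erase _ _ hi, ← Finset.mul_prod_erase _ (fun j => m j (y j)) hi,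
      Function.update_self, mul_assoc]
    congr 2
    exact Finset.prod_congr rfl fun j hj => by
      rw [Function.update_of_ne (Finset.ne_of_mem_erase hj)]
  rw [Finset.sum_congr rfl h2, ← Finset.sum_mul, ← hy.1, Nat.cast_sum]

theorem tendsto_convAt {τ : Type*} {l : Filter τ} {S : Finset κ} {m : τ → κ → ℕ → ℝ}
    {m' : κ → ℕ → ℝ} (h : ∀ i ∈ S, ∀ x, Tendsto (fun t => m t i x) l (𝓝 (m' i x))) (n : ℕ) :
    Tendsto (fun t => convAt S (m t) n) l (𝓝 (convAt S m' n)) := by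
  unfold convAt
  exact tendsto_finsetSum _ fun y _ => tendsto_finsetProd _ fun i hi => h i hi _

theorem tendsto_seqConv {τ : Type*} {l : Filter τ} {f g : τ → ℕ → ℝ} {f' g' : ℕ → ℝ}
    (hf : ∀ x, Tendsto (fun t => f t x) l (𝓝 (f' x)))
    (hg : ∀ x, Tendsto (fun t => g t x) l (𝓝 (g' x))) (n : ℕ) :
    Tendsto (fun t => seqConv (f t) (g t) n) l (𝓝 (seqConv f' g' n)) := by
  unfold seqConv
  exact tendsto_finsetSum _ fun p _ => (hf _).mul (hg _)

/-- If each `m i` charges `a i`, then the convolution charges `∑ a i`; the next two lemmas complement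
this below and above the supports. -/
theorem convAt_pos {S : Finset κ} {m : κ → ℕ → ℝ} (h : ∀ i ∈ S, ∀ x, 0 ≤ m i x) {a : κ → ℕ}
    (ha : ∀ i ∈ S, 0 < m i (a i)) : 0 < convAt S m (∑ i ∈ S, a i) := by
  classical
  refine lt_of_le_of_ne (convAt_nonneg h _) fun h1 => ?_
  obtain ⟨i, hi, hi'⟩ := (convAt_eq_zero_iff h).1 h1.symm (fun i => if i ∈ S then a i else 0)
    (Finset.sum_congr rfl fun i hi => by simp [hi]) (fun i hi => by
      by_contra h2; simp [h2] at hi)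
  simp only [hi, if_true] at hi'
  exact absurd hi' (ha i hi).ne'

theorem convAt_eq_zero_of_lt {S : Finset κ} {m : κ → ℕ → ℝ} (h : ∀ i ∈ S, ∀ x, 0 ≤ m i x)
    {a : κ → ℕ} (ha : ∀ i ∈ S, ∀ x < a i, m i x = 0) {n : ℕ} (hn : n < ∑ i ∈ S, a i) :
    convAt S m n = 0 := by
  rw [convAt_eq_zero_iff h]
  intro y hy _
  rw [← hy] at hn
  obtain ⟨i, hi, hi'⟩ := Finset.exists_lt_of_sum_lt hn
  exact ⟨i, hi, ha i hi _ hi'⟩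

theorem convAt_eq_zero_of_gt {S : Finset κ} {m : κ → ℕ → ℝ} (h : ∀ i ∈ S, ∀ x, 0 ≤ m i x)
    {a : κ → ℕ} (ha : ∀ i ∈ S, ∀ x, a i < x → m i x = 0) {n : ℕ} (hn : ∑ i ∈ S, a i < n) :
    convAt S m n = 0 := by
  rw [convAt_eq_zero_iff h]
  intro y hy _
  rw [← hy] at hn
  obtain ⟨i, hi, hi'⟩ := Finset.exists_lt_of_sum_lt hn
  exact ⟨i, hi, ha i hi _ hi'⟩

/-- The mean of a non-decreasing function with respect to the weights `f` is non-decreasing in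
the likelihood-ratio order. -/
theorem LRLE.sum_mul_sum_le {f g : ℕ → ℝ} (h : LRLE f g) {φ : ℕ → ℝ} (hφ : Monotone φ) (M : ℕ) :
    (∑ x ∈ Finset.range M, f x * φ x) * (∑ x ∈ Finset.range M, g x)
      ≤ (∑ x ∈ Finset.range M, f x) * (∑ x ∈ Finset.range M, g x * φ x) := by
  have := sum_mul_sum_le_of_ratio (Finset.range M) f g (fun _ => 1) φ
    (fun i _ j _ hij => h hij) (fun i _ j _ hij => by simpa using hφ hij)
  simpa using this

/-- If two sequences ordered for the likelihood-ratio order have the same mean on `[0, M)`, then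
they are proportional there. -/
theorem LRLE.eq_of_mean_eq {f g : ℕ → ℝ} (h : LRLE f g) {M : ℕ}
    (he : (∑ x ∈ Finset.range M, f x * x) * (∑ x ∈ Finset.range M, g x)
      = (∑ x ∈ Finset.range M, f x) * (∑ x ∈ Finset.range M, g x * x)) {x : ℕ} (hx : x < M) :
    f x * g 0 = f 0 * g x := by
  -- twice the difference of the two sides of `he` is the double sum of these non-negative terms, so
  -- each of them vanishes
  have hnn : ∀ i ∈ Finset.range M, ∀ j ∈ Finset.range M,
      0 ≤ (f i * g j - f j * g i) * ((j : ℝ) - i) := by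
    intro i _ j _
    rcases le_total i j with hij | hij
    · exact mul_nonneg (sub_nonneg.2 (h hij)) (sub_nonneg.2 (by exact_mod_cast hij))
    · exact mul_nonneg_of_nonpos_of_nonpos (by linarith [h hij])
        (sub_nonpos.2 (by exact_mod_cast hij))
  have e : ∑ i ∈ Finset.range M, ∑ j ∈ Finset.range M, (f i * g j - f j * g i) * ((j : ℝ) - i)
      = 0 := by
    have h1 : ∀ i j : ℕ, (f i * g j - f j * g i) * ((j : ℝ) - i)
        = f i * (g j * j) - (f i * i) * g j - g i * (f j * j) + (g i * i) * f j :=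
      fun i j => by ring
    simp only [h1, Finset.sum_add_distrib, Finset.sum_sub_distrib, ← Finset.sum_mul_sum]
    linarith
  rw [Finset.sum_eq_zero_iff_of_nonneg fun i hi => Finset.sum_nonneg (hnn i hi)] at e
  have h0 : 0 ∈ Finset.range M := by rw [Finset.mem_range]; omega
  have h2 := e 0 h0
  rw [Finset.sum_eq_zero_iff_of_nonneg (hnn 0 h0)] at h2
  have h3 := h2 x (Finset.mem_range.2 hx)
  rcases Nat.eq_zero_or_pos x with rfl | hx0
  · ring
  · rcases mul_eq_zero.1 h3 with h4 | h4
    · linarith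
    · have : (0 : ℝ) < x := by exact_mod_cast hx0
      simp at h4; omega

end

noncomputable section

/-! ### The update in terms of normalised weights -/

/-- The sequence `x ↦ G (b - x)` on `{0, …, b}`, extended by zero. -/
def revSeq (b : ℕ) (G : ℕ → ℝ) (x : ℕ) : ℝ := if x ≤ b then G (b - x) else 0

theorem revSeq_nonneg {b : ℕ} {G : ℕ → ℝ} (h : ∀ x, 0 ≤ G x) (x : ℕ) : 0 ≤ revSeq b G x := by
  unfold revSeq; split_ifs <;> simp [h]

theorem PF2.revSeq {G : ℕ → ℝ} (h : PF2 G) (b : ℕ) : PF2 (revSeq b G) := by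
  refine ⟨revSeq_nonneg h.nonneg, fun x y d hxy => ?_⟩
  by_cases hy : y + d ≤ b
  · have := h.le (x := b - (y + d)) (y := b - (x + d)) d (by omega)
    rw [show b - (y + d) + d = b - y by omega, show b - (x + d) + d = b - x by omega] at this
    simp only [_root_.revSeq, hy, show x ≤ b by omega, show x + d ≤ b by omega,
      show y ≤ b by omega, if_true]
    linarith
  · rw [show _root_.revSeq b G (y + d) = 0 by simp [_root_.revSeq, hy], mul_zero]
    exact mul_nonneg (revSeq_nonneg h.nonneg _) (revSeq_nonneg h.nonneg _)

/-- Reversal of the index reverses the likelihood-ratio order. -/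
theorem LRLE.revSeq {G G' : ℕ → ℝ} (h : LRLE G G') (h0 : ∀ x, 0 ≤ G x) (h0' : ∀ x, 0 ≤ G' x)
    (b : ℕ) : LRLE (revSeq b G') (revSeq b G) := by
  intro x y hxy
  by_cases hy : y ≤ b
  · have := h (x := b - y) (y := b - x) (by omega)
    simp only [_root_.revSeq, hy, show x ≤ b by omega, if_true]
    linarith
  · rw [show _root_.revSeq b G' y = 0 by simp [_root_.revSeq, hy], zero_mul]
    exact mul_nonneg (revSeq_nonneg h0' _) (revSeq_nonneg h0 _)

theorem PF2.mul {f g : ℕ → ℝ} (hf : PF2 f) (hg : PF2 g) : PF2 (fun x => f x * g x) := by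
  refine ⟨fun x => mul_nonneg (hf.nonneg _) (hg.nonneg _), fun x y d hxy => ?_⟩
  have := mul_le_mul (hf.le d hxy) (hg.le d hxy) (mul_nonneg (hg.nonneg _) (hg.nonneg _))
    (mul_nonneg (hf.nonneg _) (hf.nonneg _))
  linarith

theorem PF2.const_mul {f : ℕ → ℝ} (hf : PF2 f) {c : ℝ} (hc : 0 ≤ c) : PF2 (fun x => c * f x) := by
  refine ⟨fun x => mul_nonneg hc (hf.nonneg _), fun x y d hxy => ?_⟩
  have := mul_le_mul_of_nonneg_left (hf.le d hxy) (mul_nonneg hc hc)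
  linarith

theorem LRLE.mul {f g h k : ℕ → ℝ} (hfg : LRLE f g) (hhk : LRLE h k) (f0 : ∀ x, 0 ≤ f x)
    (g0 : ∀ x, 0 ≤ g x) (h0 : ∀ x, 0 ≤ h x) (k0 : ∀ x, 0 ≤ k x) :
    LRLE (fun x => f x * h x) (fun x => g x * k x) := by
  intro x y hxy
  have := mul_le_mul (hfg hxy) (hhk hxy) (mul_nonneg (h0 _) (k0 _)) (mul_nonneg (f0 _) (g0 _))
  dsimp only
  linarith

theorem LRLE.const_mul {f g : ℕ → ℝ} (h : LRLE f g) {c c' : ℝ} (hc : 0 ≤ c) (hc' : 0 ≤ c') :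
    LRLE (fun x => c * f x) (fun x => c' * g x) := by
  intro x y hxy
  have := mul_le_mul_of_nonneg_left (h hxy) (mul_nonneg hc hc')
  dsimp only
  linarith

theorem LRLE.truncate {f g : ℕ → ℝ} (h : LRLE f g) (c : ℕ) :
    LRLE (fun x => if x ≤ c then f x else 0) (fun x => if x ≤ c then g x else 0) := by
  intro x y hxy
  by_cases hy : y ≤ c
  · simp only [hy, hxy.trans hy, if_true]; exact h hxy
  · simp only [hy, if_false, zero_mul, mul_zero]; exact le_rfl

/-- For sequences with the value `1` at `0` the likelihood-ratio order implies the pointwise one. -/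
theorem LRLE.le_of_zero {f g : ℕ → ℝ} (h : LRLE f g) (hf : f 0 = 1) (hg : g 0 = 1) (x : ℕ) :
    f x ≤ g x := by
  have := h (Nat.zero_le x)
  rwa [hf, hg, one_mul, mul_one] at this

theorem LRLE.of_tendsto {τ : Type*} {l : Filter τ} [l.NeBot] {f g : τ → ℕ → ℝ} {f' g' : ℕ → ℝ}
    (h : ∀ᶠ t in l, LRLE (f t) (g t)) (hf : ∀ x, Tendsto (fun t => f t x) l (𝓝 (f' x)))
    (hg : ∀ x, Tendsto (fun t => g t x) l (𝓝 (g' x))) : LRLE f' g' := fun x y hxy =>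
  le_of_tendsto_of_tendsto ((hf y).mul (hg x)) ((hf x).mul (hg y)) (h.mono fun _ ht => ht hxy)

theorem PF2.of_tendsto {τ : Type*} {l : Filter τ} [l.NeBot] {f : τ → ℕ → ℝ} {f' : ℕ → ℝ}
    (h : ∀ᶠ t in l, PF2 (f t)) (hf : ∀ x, Tendsto (fun t => f t x) l (𝓝 (f' x))) : PF2 f' :=
  ⟨fun x => ge_of_tendsto (hf x) (h.mono fun _ ht => ht.nonneg x), fun x y d hxy =>
    le_of_tendsto_of_tendsto ((hf x).mul (hf (y + d))) ((hf (x + d)).mul (hf y))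
      (h.mono fun _ ht => ht.le d hxy)⟩

/-- Convolution with the constant sequence `1` gives partial sums. -/
theorem seqConv_one (f : ℕ → ℝ) (n : ℕ) :
    seqConv f (fun _ => 1) n = ∑ i ∈ Finset.range (n + 1), f i := by
  have h := Finset.Nat.sum_antidiagonal_eq_sum_range_succ_mk (fun p : ℕ × ℕ => f p.1) n
  simpa [seqConv] using h

theorem seqConv_eq_sum_range (f g : ℕ → ℝ) (n : ℕ) :
    seqConv f g n = ∑ i ∈ Finset.range (n + 1), f i * g (n - i) :=
  Finset.Nat.sum_antidiagonal_eq_sum_range_succ_mk (fun p : ℕ × ℕ => f p.1 * g p.2) n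

theorem seqConv_assoc (f g h : ℕ → ℝ) : seqConv (seqConv f g) h = seqConv f (seqConv g h) := by
  have : PowerSeries.mk (seqConv (seqConv f g) h) = PowerSeries.mk (seqConv f (seqConv g h)) := by
    simp only [mk_seqConv, mul_assoc]
  ext n
  simpa using congrArg (PowerSeries.coeff n) this

theorem seqConv_mul_pow (f g : ℕ → ℝ) (r : ℝ) (n : ℕ) :
    seqConv (fun x => f x * r ^ x) (fun x => g x * r ^ x) n = seqConv f g n * r ^ n := by
  unfold seqConv
  rw [Finset.sum_mul]
  refine Finset.sum_congr rfl fun p hp => ?_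
  rw [← Finset.HasAntidiagonal.mem_antidiagonal.1 hp, pow_add]; ring

theorem convAt_congr_le {κ : Type*} {S : Finset κ} {m m' : κ → ℕ → ℝ} {n : ℕ}
    (h : ∀ i ∈ S, ∀ x ≤ n, m i x = m' i x) : convAt S m n = convAt S m' n := by
  classical
  refine Finset.sum_congr rfl fun y hy => Finset.prod_congr rfl fun i hi => h i hi _ ?_
  rw [Finset.mem_piAntidiag] at hy
  rw [← hy.1]
  exact Finset.single_le_sum (fun _ _ => Nat.zero_le _) hi

namespace Network

variable {X Y : Type*} (N : Network X Y)

theorem mem_inDarts {v : N.V} {d : N.graph.Dart} : d ∈ N.inDarts v ↔ d.snd = v := by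
  simp [inDarts]

theorem mem_preDarts {e d : N.graph.Dart} : d ∈ N.preDarts e ↔ d.snd = e.fst ∧ d ≠ e.symm := by
  simp [preDarts, mem_inDarts]

open Classical in
theorem preDarts_symm {v : N.V} {d : N.graph.Dart} (hd : d ∈ N.inDarts v) :
    N.preDarts d.symm = (N.inDarts v).erase d := by
  ext e
  rw [mem_preDarts, Finset.mem_erase, mem_inDarts, SimpleGraph.Dart.symm_symm, and_comm]
  rw [mem_inDarts] at hd
  subst hd; rfl

theorem cap_symm (d : N.graph.Dart) : N.cap d.symm = N.cap d := by
  unfold cap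
  congr 2
  exact d.edge_symm

/-- Message weights, normalised to take the value `1` at `0`. -/
structure IsWeight (W : N.graph.Dart → ℕ → ℝ) : Prop where
  zero : ∀ d, W d 0 = 1
  nonneg : ∀ d x, 0 ≤ W d x
  cap : ∀ d x, N.cap d < x → W d x = 0

/-- The distribution function of the sum of the incoming weights. -/
def cum (W : N.graph.Dart → ℕ → ℝ) (e : N.graph.Dart) : ℕ → ℝ :=
  seqConv (convAt (N.preDarts e) W) fun _ => 1

/-- The belief propagation operator on normalised weights. -/
def wUpdate (lam : ℝ) (W : N.graph.Dart → ℕ → ℝ) (e : N.graph.Dart) (x : ℕ) : ℝ :=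
  N.bpWeight lam W e x / N.bpWeight lam W e 0

variable {N}

/-- The unnormalised update reverses the distribution function of the incoming sum, which is why it
reverses the likelihood-ratio order. -/
theorem bpWeight_eq (lam : ℝ) (W : N.graph.Dart → ℕ → ℝ) (e : N.graph.Dart) (x : ℕ) :
    N.bpWeight lam W e x
      = lam ^ x * (if x ≤ N.cap e then revSeq (N.b e.fst) (N.cum W e) x else 0) := by
  unfold bpWeight revSeq cum
  by_cases h : x ≤ N.cap e
  · simp only [h, if_true]
    split_ifs with h2
    · rw [seqConv_one, Nat.sub_add_comm h2]
    · rw [show N.b e.fst + 1 - x = 0 by omega]; simp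
  · simp [h]

theorem bpWeight_zero (lam : ℝ) (W : N.graph.Dart → ℕ → ℝ) (e : N.graph.Dart) :
    N.bpWeight lam W e 0 = N.cum W e (N.b e.fst) := by
  rw [bpWeight_eq]; simp [revSeq]

theorem cum_nonneg {W : N.graph.Dart → ℕ → ℝ} (h : ∀ d x, 0 ≤ W d x) (e : N.graph.Dart) (k : ℕ) :
    0 ≤ N.cum W e k :=
  seqConv_nonneg (convAt_nonneg fun i _ => h i) (fun _ => zero_le_one) k

theorem one_le_cum {W : N.graph.Dart → ℕ → ℝ} (h : N.IsWeight W) (e : N.graph.Dart) (k : ℕ) :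
    1 ≤ N.cum W e k := by
  unfold cum
  rw [seqConv_one]
  have h1 : convAt (N.preDarts e) W 0 = 1 := by
    rw [convAt_zero]; exact Finset.prod_eq_one fun d _ => h.zero d
  rw [← h1]
  exact Finset.single_le_sum (f := fun i => convAt (N.preDarts e) W i)
    (fun i _ => convAt_nonneg (fun i _ => h.nonneg i) i) (by simp)

theorem cum_mono {W : N.graph.Dart → ℕ → ℝ} (h : ∀ d x, 0 ≤ W d x) (e : N.graph.Dart) :
    Monotone (N.cum W e) := by
  intro j k hjk
  unfold cum
  rw [seqConv_one, seqConv_one]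
  exact Finset.sum_le_sum_of_subset_of_nonneg (Finset.range_mono (by omega))
    fun i _ _ => convAt_nonneg (fun i _ => h i) i

theorem wUpdate_eq (lam : ℝ) (W : N.graph.Dart → ℕ → ℝ) (e : N.graph.Dart) :
    N.wUpdate lam W e = fun x => (N.cum W e (N.b e.fst))⁻¹ *
      (lam ^ x * (if x ≤ N.cap e then revSeq (N.b e.fst) (N.cum W e) x else 0)) := by
  ext x
  rw [wUpdate, bpWeight_zero, bpWeight_eq, div_eq_inv_mul]

theorem IsWeight.wUpdate {lam : ℝ} (hl : 0 < lam) {W : N.graph.Dart → ℕ → ℝ} (h : N.IsWeight W) :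
    N.IsWeight (N.wUpdate lam W) := by
  refine ⟨fun e => ?_, fun e x => ?_, fun e x hx => ?_⟩
  · rw [Network.wUpdate, div_self]
    rw [bpWeight_zero]
    linarith [one_le_cum h e (N.b e.fst)]
  · rw [wUpdate_eq]
    refine mul_nonneg (inv_nonneg.2 (cum_nonneg h.nonneg _ _)) (mul_nonneg (by positivity) ?_)
    split_ifs
    · exact revSeq_nonneg (cum_nonneg h.nonneg e) x
    · exact le_rfl
  · rw [wUpdate_eq]; simp [not_le.2 hx]

theorem wUpdate_pos {lam : ℝ} (hl : 0 < lam) {W : N.graph.Dart → ℕ → ℝ} (h : N.IsWeight W)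
    {e : N.graph.Dart} {x : ℕ} (hc : x ≤ N.cap e) (hb : x ≤ N.b e.fst) :
    0 < N.wUpdate lam W e x := by
  rw [wUpdate_eq]
  have h1 := one_le_cum h e (N.b e.fst)
  have h2 := one_le_cum h e (N.b e.fst - x)
  simp only [hc, revSeq, hb, if_true]
  positivity

theorem wUpdate_eq_zero {lam : ℝ} {W : N.graph.Dart → ℕ → ℝ}
    {e : N.graph.Dart} {x : ℕ} (h : N.b e.fst < x) : N.wUpdate lam W e x = 0 := by
  rw [wUpdate_eq]; simp [revSeq, not_le.2 h]

/-- The support of an updated weight depends on the network only. -/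
theorem wUpdate_eq_zero_imp {lam : ℝ} (hl : 0 < lam) {W W' : N.graph.Dart → ℕ → ℝ}
    (h : N.IsWeight W) (h' : N.IsWeight W') {e : N.graph.Dart} {x : ℕ}
    (h0 : N.wUpdate lam W e x = 0) : N.wUpdate lam W' e x = 0 := by
  rcases lt_or_ge (N.cap e) x with h1 | h1
  · exact (h'.wUpdate hl).cap e x h1
  rcases lt_or_ge (N.b e.fst) x with h2 | h2
  · exact wUpdate_eq_zero h2
  · exact absurd h0 (wUpdate_pos hl h h1 h2).ne'

theorem pf2_one : PF2 (fun _ : ℕ => (1 : ℝ)) := by simpa using PF2.geom (r := 1) zero_le_one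

theorem pf2_cum {W : N.graph.Dart → ℕ → ℝ} (h : ∀ d, PF2 (W d)) (e : N.graph.Dart) :
    PF2 (N.cum W e) :=
  (PF2.convAt fun d _ => h d).seqConv pf2_one

theorem pf2_wUpdate {lam : ℝ} (hl : 0 < lam) {W : N.graph.Dart → ℕ → ℝ} (h : ∀ d, PF2 (W d))
    (e : N.graph.Dart) : PF2 (N.wUpdate lam W e) := by
  rw [wUpdate_eq]
  exact ((PF2.geom hl.le).mul (((pf2_cum h e).revSeq _).truncate _)).const_mul
    (inv_nonneg.2 ((pf2_cum h e).nonneg _))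

theorem lrle_wUpdate_of_lrle_cum {lam : ℝ} (hl : 0 < lam) {W W' : N.graph.Dart → ℕ → ℝ}
    {e : N.graph.Dart} (h0 : ∀ d x, 0 ≤ W d x) (h0' : ∀ d x, 0 ≤ W' d x)
    (h : LRLE (N.cum W e) (N.cum W' e)) : LRLE (N.wUpdate lam W' e) (N.wUpdate lam W e) := by
  rw [wUpdate_eq, wUpdate_eq]
  have hp : ∀ {W : N.graph.Dart → ℕ → ℝ}, (∀ d x, 0 ≤ W d x) → ∀ x,
      0 ≤ if x ≤ N.cap e then revSeq (N.b e.fst) (N.cum W e) x else 0 := by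
    intro W h0 x
    split_ifs
    · exact revSeq_nonneg (cum_nonneg h0 e) x
    · exact le_rfl
  exact ((LRLE.refl _).mul ((h.revSeq (cum_nonneg h0 e) (cum_nonneg h0' e) _).truncate _)
    (fun x => by positivity) (fun x => by positivity) (hp h0') (hp h0)).const_mul
    (inv_nonneg.2 (cum_nonneg h0' e _)) (inv_nonneg.2 (cum_nonneg h0 e _))

/-- The update reverses the likelihood-ratio order if the larger family is log-concave. -/
theorem wUpdate_antitone_right {lam : ℝ} (hl : 0 < lam) {W W' : N.graph.Dart → ℕ → ℝ}
    (hW : N.IsWeight W) (hW' : N.IsWeight W') (hp : ∀ d, PF2 (W' d))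
    (h : ∀ d, LRLE (W d) (W' d)) (e : N.graph.Dart) :
    LRLE (N.wUpdate lam W' e) (N.wUpdate lam W e) := by
  refine lrle_wUpdate_of_lrle_cum hl hW.nonneg hW'.nonneg ?_
  refine LRLE.seqConv_right ?_ (convAt_nonneg fun d _ => hW.nonneg d)
    (convAt_nonneg fun d _ => hW'.nonneg d) pf2_one
  exact LRLE.convAt_of_pf2_right (fun d _ => h d) (fun d _ => hW.nonneg d) (fun d _ => hp d)
    fun d _ => by rw [hW'.zero]; exact one_pos

/-- The update reverses the likelihood-ratio order if the smaller family is log-concave. -/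
theorem wUpdate_antitone_left {lam : ℝ} (hl : 0 < lam) {W W' : N.graph.Dart → ℕ → ℝ}
    (hW : N.IsWeight W) (hW' : N.IsWeight W') (hp : ∀ d, PF2 (W d))
    (h : ∀ d, LRLE (W d) (W' d)) (hs : ∀ d x, W d x = 0 → W' d x = 0) (e : N.graph.Dart) :
    LRLE (N.wUpdate lam W' e) (N.wUpdate lam W e) := by
  refine lrle_wUpdate_of_lrle_cum hl hW.nonneg hW'.nonneg ?_
  refine LRLE.seqConv_right ?_ (convAt_nonneg fun d _ => hW.nonneg d)
    (convAt_nonneg fun d _ => hW'.nonneg d) pf2_one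
  exact LRLE.convAt_of_pf2_left (fun d _ => h d) (fun d _ => hp d) (fun d _ => hW'.nonneg d)
    fun d _ => hs d

/-! ### Iteration of the update from the empty configuration -/

variable (N) in
/-- The iterates of the update started from the weights of the point masses at `0`. -/
def wIter (lam : ℝ) : ℕ → N.graph.Dart → ℕ → ℝ
  | 0 => fun _ x => if x = 0 then 1 else 0
  | k + 1 => N.wUpdate lam (wIter lam k)

theorem isWeight_wIter {lam : ℝ} (hl : 0 < lam) (k : ℕ) : N.IsWeight (N.wIter lam k) := by
  induction k with
  | zero =>
    refine ⟨fun d => by simp [wIter], fun d x => ?_, fun d x hx => ?_⟩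
    · simp only [wIter]; split_ifs <;> simp
    · simp [wIter, show x ≠ 0 by omega]
  | succ k ih => exact ih.wUpdate hl

theorem pf2_wIter {lam : ℝ} (hl : 0 < lam) (k : ℕ) (d : N.graph.Dart) : PF2 (N.wIter lam k d) := by
  induction k generalizing d with
  | zero => exact PF2.delta
  | succ k ih => exact pf2_wUpdate hl ih d

theorem lrle_delta {f : ℕ → ℝ} (hf : ∀ x, 0 ≤ f x) : LRLE (fun x => if x = 0 then (1 : ℝ) else 0) f := by
  intro x y hxy
  rcases Nat.eq_zero_or_pos y with rfl | hy
  · simp [show x = 0 by omega]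
  · simp only [hy.ne', if_false, zero_mul]
    split_ifs <;> simp [hf]

/-- The first iterate is the largest element of the image of the update. -/
theorem wUpdate_lrle_wIter_one {lam : ℝ} (hl : 0 < lam) {W : N.graph.Dart → ℕ → ℝ}
    (hW : N.IsWeight W) (e : N.graph.Dart) :
    LRLE (N.wUpdate lam W e) (N.wIter lam 1 e) := by
  refine lrle_wUpdate_of_lrle_cum hl (isWeight_wIter hl 0).nonneg hW.nonneg ?_
  have h1 : ∀ k, N.cum (N.wIter lam 0) e k = 1 := by
    intro k
    unfold cum
    rw [seqConv_one, Finset.sum_eq_single 0]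
    · rw [convAt_zero]; exact Finset.prod_eq_one fun d _ => by simp [wIter]
    · intro n _ hn
      refine convAt_eq_zero_of_gt (a := fun _ => 0) (fun i _ => (isWeight_wIter hl 0).nonneg i)
        (fun i _ x hx => ?_) (by simpa using Nat.pos_of_ne_zero hn)
      simp [wIter, hx.ne']
    · simp
  intro x y hxy
  rw [h1, h1, one_mul, one_mul]
  exact cum_mono hW.nonneg e hxy

/-- The iterates interlace: the even ones increase, the odd ones decrease and lie above. -/
theorem lrle_wIter {lam : ℝ} (hl : 0 < lam) (k : ℕ) :
    (∀ d : N.graph.Dart, LRLE (N.wIter lam (2 * k) d) (N.wIter lam (2 * k + 1) d)) ∧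
    (∀ d : N.graph.Dart, LRLE (N.wIter lam (2 * k) d) (N.wIter lam (2 * k + 2) d)) ∧
    (∀ d : N.graph.Dart, LRLE (N.wIter lam (2 * k + 2) d) (N.wIter lam (2 * k + 1) d)) := by
  have anti : ∀ {i j : ℕ}, (∀ d : N.graph.Dart, LRLE (N.wIter lam i d) (N.wIter lam j d)) →
      ∀ d : N.graph.Dart, LRLE (N.wIter lam (j + 1) d) (N.wIter lam (i + 1) d) := fun h =>
    wUpdate_antitone_right hl (isWeight_wIter hl _) (isWeight_wIter hl _) (pf2_wIter hl _) h
  induction k with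
  | zero =>
    have h : ∀ j (d : N.graph.Dart), LRLE (N.wIter lam 0 d) (N.wIter lam j d) := fun j d =>
      lrle_delta ((isWeight_wIter hl j).nonneg d)
    exact ⟨h 1, h 2, anti (h 1)⟩
  | succ k ih =>
    have h1 := anti ih.2.2
    exact ⟨h1, anti (anti ih.2.1), anti h1⟩

theorem wIter_even_mono {lam : ℝ} (hl : 0 < lam) (d : N.graph.Dart) (x : ℕ) :
    Monotone fun k => N.wIter lam (2 * k) d x :=
  monotone_nat_of_le_succ fun k => ((lrle_wIter hl k).2.1 d).le_of_zero
    ((isWeight_wIter hl _).zero d) ((isWeight_wIter hl _).zero d) x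

theorem wIter_odd_anti {lam : ℝ} (hl : 0 < lam) (d : N.graph.Dart) (x : ℕ) :
    Antitone fun k => N.wIter lam (2 * k + 1) d x := by
  refine antitone_nat_of_succ_le fun k => ?_
  have h : LRLE (N.wIter lam (2 * k + 3) d) (N.wIter lam (2 * k + 1) d) :=
    wUpdate_antitone_right hl (isWeight_wIter hl _) (isWeight_wIter hl _) (pf2_wIter hl _)
      (lrle_wIter hl k).2.1 d
  exact h.le_of_zero ((isWeight_wIter hl _).zero d) ((isWeight_wIter hl _).zero d) x

theorem wIter_even_le_one {lam : ℝ} (hl : 0 < lam) (d : N.graph.Dart) (x k : ℕ) :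
    N.wIter lam (2 * k) d x ≤ N.wIter lam 1 d x := by
  have h1 : N.wIter lam (2 * k) d x ≤ N.wIter lam (2 * k + 1) d x :=
    ((lrle_wIter hl k).1 d).le_of_zero ((isWeight_wIter hl _).zero d)
      ((isWeight_wIter hl _).zero d) x
  have h2 : N.wIter lam (2 * k + 1) d x ≤ N.wIter lam (2 * 0 + 1) d x :=
    wIter_odd_anti hl d x (Nat.zero_le k)
  exact h1.trans h2

variable (N) in
/-- The limit of the even iterates, the lower end of the fixed points. -/
def wLow (lam : ℝ) (d : N.graph.Dart) (x : ℕ) : ℝ := ⨆ k, N.wIter lam (2 * k) d x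

variable (N) in
/-- The limit of the odd iterates, the upper end of the fixed points. -/
def wHigh (lam : ℝ) (d : N.graph.Dart) (x : ℕ) : ℝ := ⨅ k, N.wIter lam (2 * k + 1) d x

theorem tendsto_wLow {lam : ℝ} (hl : 0 < lam) (d : N.graph.Dart) (x : ℕ) :
    Tendsto (fun k => N.wIter lam (2 * k) d x) atTop (𝓝 (N.wLow lam d x)) :=
  tendsto_atTop_ciSup (wIter_even_mono hl d x)
    ⟨N.wIter lam 1 d x, by rintro _ ⟨k, rfl⟩; exact wIter_even_le_one hl d x k⟩

theorem tendsto_wHigh {lam : ℝ} (hl : 0 < lam) (d : N.graph.Dart) (x : ℕ) :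
    Tendsto (fun k => N.wIter lam (2 * k + 1) d x) atTop (𝓝 (N.wHigh lam d x)) :=
  tendsto_atTop_ciInf (wIter_odd_anti hl d x)
    ⟨0, by rintro _ ⟨k, rfl⟩; exact (isWeight_wIter hl _).nonneg d x⟩

theorem IsWeight.of_tendsto {τ : Type*} {l : Filter τ} [l.NeBot] {W : τ → N.graph.Dart → ℕ → ℝ}
    {W' : N.graph.Dart → ℕ → ℝ} (h : ∀ t, N.IsWeight (W t))
    (hW : ∀ d x, Tendsto (fun t => W t d x) l (𝓝 (W' d x))) : N.IsWeight W' := by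
  refine ⟨fun d => ?_, fun d x => ge_of_tendsto' (hW d x) fun t => (h t).nonneg d x,
    fun d x hx => ?_⟩
  · refine tendsto_nhds_unique (hW d 0) ?_
    simp only [(h _).zero]; exact tendsto_const_nhds
  · refine tendsto_nhds_unique (hW d x) ?_
    simp only [(h _).cap d x hx]; exact tendsto_const_nhds

theorem isWeight_wLow {lam : ℝ} (hl : 0 < lam) : N.IsWeight (N.wLow lam) :=
  IsWeight.of_tendsto (fun _ => isWeight_wIter hl _) (tendsto_wLow hl)

theorem isWeight_wHigh {lam : ℝ} (hl : 0 < lam) : N.IsWeight (N.wHigh lam) :=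
  IsWeight.of_tendsto (fun _ => isWeight_wIter hl _) (tendsto_wHigh hl)

theorem pf2_wLow {lam : ℝ} (hl : 0 < lam) (d : N.graph.Dart) : PF2 (N.wLow lam d) :=
  PF2.of_tendsto (Eventually.of_forall fun _ => pf2_wIter hl _ d) (tendsto_wLow hl d)

theorem lrle_wLow_wHigh {lam : ℝ} (hl : 0 < lam) (d : N.graph.Dart) :
    LRLE (N.wLow lam d) (N.wHigh lam d) :=
  LRLE.of_tendsto (Eventually.of_forall fun k => (lrle_wIter hl k).1 d) (tendsto_wLow hl d)
    (tendsto_wHigh hl d)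

theorem tendsto_cum {τ : Type*} {l : Filter τ} {W : τ → N.graph.Dart → ℕ → ℝ}
    {W' : N.graph.Dart → ℕ → ℝ} (hW : ∀ d x, Tendsto (fun t => W t d x) l (𝓝 (W' d x)))
    (e : N.graph.Dart) (k : ℕ) : Tendsto (fun t => N.cum (W t) e k) l (𝓝 (N.cum W' e k)) :=
  tendsto_seqConv (fun n => tendsto_convAt (fun d _ => hW d) n) (fun _ => tendsto_const_nhds) k

theorem tendsto_wUpdate {lam : ℝ} {τ : Type*} {l : Filter τ} [l.NeBot]
    {W : τ → N.graph.Dart → ℕ → ℝ} {W' : N.graph.Dart → ℕ → ℝ} (h : ∀ t, N.IsWeight (W t))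
    (hW : ∀ d x, Tendsto (fun t => W t d x) l (𝓝 (W' d x))) (e : N.graph.Dart) (x : ℕ) :
    Tendsto (fun t => N.wUpdate lam (W t) e x) l (𝓝 (N.wUpdate lam W' e x)) := by
  have h' := IsWeight.of_tendsto h hW
  simp only [wUpdate_eq]
  refine ((tendsto_cum hW e _).inv₀ ?_).mul (tendsto_const_nhds.mul ?_)
  · linarith [one_le_cum h' e (N.b e.fst)]
  · unfold revSeq
    split_ifs
    · exact tendsto_cum hW e _
    · exact tendsto_const_nhds
    · exact tendsto_const_nhds

/-- By continuity the update exchanges the two extremal limits; each is fixed by the second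
iterate of the update. -/
theorem wUpdate_wLow {lam : ℝ} (hl : 0 < lam) : N.wUpdate lam (N.wLow lam) = N.wHigh lam := by
  ext e x
  exact tendsto_nhds_unique (tendsto_wUpdate (fun k => isWeight_wIter hl (2 * k))
    (tendsto_wLow hl) e x) (tendsto_wHigh hl e x)

theorem wUpdate_wHigh {lam : ℝ} (hl : 0 < lam) : N.wUpdate lam (N.wHigh lam) = N.wLow lam := by
  ext e x
  refine tendsto_nhds_unique (tendsto_wUpdate (fun k => isWeight_wIter hl (2 * k + 1))
    (tendsto_wHigh hl) e x) ?_
  exact (tendsto_wLow hl e x).comp (tendsto_add_atTop_nat 1)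

/-- Every fixed point of the update, log-concave or not, lies between the limits of the even
and of the odd iterates. -/
theorem lrle_of_fixed {lam : ℝ} (hl : 0 < lam) {W : N.graph.Dart → ℕ → ℝ} (hW : N.IsWeight W)
    (hfix : N.wUpdate lam W = W) (k : ℕ) :
    (∀ d, LRLE (N.wIter lam (2 * k + 2) d) (W d)) ∧
      ∀ d, LRLE (W d) (N.wIter lam (2 * k + 1) d) := by
  have even : ∀ k, (∀ d, LRLE (W d) (N.wIter lam (2 * k + 1) d)) →
      ∀ d, LRLE (N.wIter lam (2 * k + 2) d) (W d) := fun k h d => by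
    have := wUpdate_antitone_right hl hW (isWeight_wIter hl _) (pf2_wIter hl _) h d
    rwa [hfix] at this
  induction k with
  | zero =>
    have h1 : ∀ d, LRLE (W d) (N.wIter lam 1 d) := fun d => by
      have := wUpdate_lrle_wIter_one hl hW d
      rwa [hfix] at this
    exact ⟨even 0 h1, h1⟩
  | succ k ih =>
    -- `W` need not be log-concave; from below, the log-concave iterate is the smaller family and
    -- the supports of updated weights coincide
    have h1 : ∀ d, LRLE (W d) (N.wIter lam (2 * (k + 1) + 1) d) := fun d => by
      have := wUpdate_antitone_left hl (isWeight_wIter hl _) hW (pf2_wIter hl _) ih.1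
        (fun d x hx => by
          have := wUpdate_eq_zero_imp hl (isWeight_wIter hl (2 * k + 1)) hW hx
          rwa [hfix] at this) d
      rwa [hfix] at this
    exact ⟨even _ h1, h1⟩

/-- If the extremal limits agree, the update has only one fixed point. -/
theorem eq_wLow_of_fixed {lam : ℝ} (hl : 0 < lam) (heq : N.wLow lam = N.wHigh lam)
    {W : N.graph.Dart → ℕ → ℝ} (hW : N.IsWeight W) (hfix : N.wUpdate lam W = W) :
    W = N.wLow lam := by
  ext d x
  refine le_antisymm ?_ ?_
  · rw [heq]
    exact ge_of_tendsto' (tendsto_wHigh hl d x) fun k => ((lrle_of_fixed hl hW hfix k).2 d).le_of_zero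
      (hW.zero d) ((isWeight_wIter hl _).zero d) x
  · refine le_of_tendsto' ((tendsto_wLow hl d x).comp (tendsto_add_atTop_nat 1)) fun k => ?_
    exact ((lrle_of_fixed hl hW hfix k).1 d).le_of_zero ((isWeight_wIter hl _).zero d) (hW.zero d) x

end Network
end

noncomputable section

namespace Network

variable {X Y : Type*} {N : Network X Y}

/-! ### Monotonicity in the activity -/

/-- The weights `W x / lam ^ x`. -/
def scaled (lam : ℝ) (W : N.graph.Dart → ℕ → ℝ) (d : N.graph.Dart) (x : ℕ) : ℝ :=
  W d x * lam⁻¹ ^ x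

/-- The distribution function of the sum of the incoming weights, divided by `lam ^ k`; it is the
convolution of the scaled weights with a geometric sequence. -/
def geomCum (lam : ℝ) (W : N.graph.Dart → ℕ → ℝ) (e : N.graph.Dart) : ℕ → ℝ :=
  seqConv (convAt (N.preDarts e) (scaled lam W)) fun n => lam⁻¹ ^ n

theorem geomCum_eq (lam : ℝ) (W : N.graph.Dart → ℕ → ℝ) (e : N.graph.Dart) (k : ℕ) :
    geomCum lam W e k = N.cum W e k * lam⁻¹ ^ k := by
  unfold geomCum cum
  rw [← seqConv_mul_pow]
  congr 1
  · ext n; exact convAt_mul_pow _ _ _ _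
  · ext n; simp

/-- After scaling, the activity enters the update only through the incoming weights. -/
theorem scaled_wUpdate {lam : ℝ} (hl : 0 < lam) (W : N.graph.Dart → ℕ → ℝ) (e : N.graph.Dart) :
    scaled lam (N.wUpdate lam W) e = fun x => (N.cum W e (N.b e.fst))⁻¹ *
      (if x ≤ N.cap e then revSeq (N.b e.fst) (N.cum W e) x else 0) := by
  ext x
  rw [scaled, wUpdate_eq]
  have : lam ^ x * lam⁻¹ ^ x = 1 := by rw [← mul_pow, mul_inv_cancel₀ hl.ne', one_pow]
  dsimp only
  linear_combination (N.cum W e (N.b e.fst))⁻¹ *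
      (if x ≤ N.cap e then revSeq (N.b e.fst) (N.cum W e) x else 0) * this

/-- The update without scaling, expressed through the scaled incoming weights. -/
theorem wUpdate_eq_geom {lam : ℝ} (hl : 0 < lam) (W : N.graph.Dart → ℕ → ℝ) (e : N.graph.Dart) :
    N.wUpdate lam W e = fun x => ((N.cum W e (N.b e.fst))⁻¹ * lam ^ N.b e.fst) *
      (if x ≤ N.cap e then revSeq (N.b e.fst) (geomCum lam W e) x else 0) := by
  ext x
  rw [wUpdate_eq]
  dsimp only
  by_cases hc : x ≤ N.cap e
  swap
  · simp [hc]
  by_cases hb : x ≤ N.b e.fst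
  · simp only [hc, hb, revSeq, if_true, geomCum_eq]
    have h1 : lam ^ N.b e.fst * lam⁻¹ ^ (N.b e.fst - x) = lam ^ x := by
      have : lam ^ N.b e.fst = lam ^ x * lam ^ (N.b e.fst - x) := by
        rw [← pow_add]; congr 1; omega
      rw [this, mul_assoc, ← mul_pow, mul_inv_cancel₀ hl.ne', one_pow, mul_one]
    rw [← h1]; ring
  · simp [revSeq, hb]

theorem scaled_nonneg {lam : ℝ} (hl : 0 < lam) {W : N.graph.Dart → ℕ → ℝ} (h : N.IsWeight W)
    (d : N.graph.Dart) (x : ℕ) : 0 ≤ scaled lam W d x :=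
  mul_nonneg (h.nonneg d x) (by positivity)

theorem scaled_zero {lam : ℝ} {W : N.graph.Dart → ℕ → ℝ} (h : N.IsWeight W)
    (d : N.graph.Dart) : scaled lam W d 0 = 1 := by
  simp [scaled, h.zero]

theorem pf2_scaled {lam : ℝ} (hl : 0 < lam) {W : N.graph.Dart → ℕ → ℝ} (h : ∀ d, PF2 (W d))
    (d : N.graph.Dart) : PF2 (scaled lam W d) :=
  (h d).mul (PF2.geom (inv_nonneg.2 hl.le))

theorem pf2_geomCum {lam : ℝ} (hl : 0 < lam) {W : N.graph.Dart → ℕ → ℝ} (h : ∀ d, PF2 (W d))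
    (e : N.graph.Dart) : PF2 (geomCum lam W e) :=
  (PF2.convAt fun d _ => pf2_scaled hl h d).seqConv (PF2.geom (inv_nonneg.2 hl.le))

/-- As the activity grows, the iterates grow and the scaled iterates decrease in the
likelihood-ratio order.  The two assertions feed each other through the two expressions
`scaled_wUpdate` and `wUpdate_eq_geom` of the update. -/
theorem wIter_lam_mono {lam mu : ℝ} (hl : 0 < lam) (hlm : lam ≤ mu) (k : ℕ) :
    (∀ d : N.graph.Dart, LRLE (N.wIter lam k d) (N.wIter mu k d)) ∧
      ∀ d : N.graph.Dart, LRLE (scaled mu (N.wIter mu k) d) (scaled lam (N.wIter lam k) d) := by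
  have hm : 0 < mu := hl.trans_le hlm
  induction k with
  | zero =>
    refine ⟨fun d => LRLE.refl _, fun d => ?_⟩
    have : ∀ r : ℝ, scaled r (N.wIter r 0) d = fun x => if x = 0 then (1 : ℝ) else 0 := by
      intro r; ext x
      simp only [scaled, wIter]
      split_ifs with h <;> simp [h]
    rw [this, this]; exact LRLE.refl _
  | succ k ih =>
    have wl := isWeight_wIter (N := N) hl k
    have wm := isWeight_wIter (N := N) hm k
    have pl := pf2_wIter (N := N) hl k
    have pm := pf2_wIter (N := N) hm k
    have rev : ∀ {c c' : ℝ} {G G' : ℕ → ℝ} (e : N.graph.Dart), 0 ≤ c → 0 ≤ c' → (∀ x, 0 ≤ G x) →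
        (∀ x, 0 ≤ G' x) → LRLE G G' →
        LRLE (fun x => c' * if x ≤ N.cap e then revSeq (N.b e.fst) G' x else 0)
          (fun x => c * if x ≤ N.cap e then revSeq (N.b e.fst) G x else 0) :=
      fun e hc hc' hG hG' h => ((h.revSeq hG hG' _).truncate _).const_mul hc' hc
    refine ⟨fun e => ?_, fun e => ?_⟩
    · rw [wIter, wIter, wUpdate_eq_geom hl, wUpdate_eq_geom hm]
      refine rev e ?_ ?_ (pf2_geomCum hm pm e).nonneg (pf2_geomCum hl pl e).nonneg ?_
      · exact mul_nonneg (inv_nonneg.2 (cum_nonneg wm.nonneg e _)) (by positivity)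
      · exact mul_nonneg (inv_nonneg.2 (cum_nonneg wl.nonneg e _)) (by positivity)
      · have pos : ∀ {r : ℝ} (W : N.graph.Dart → ℕ → ℝ), N.IsWeight W →
            0 < convAt (N.preDarts e) (scaled r W) 0 := fun W hW =>
          convAt_zero_pos fun d _ => by rw [scaled_zero hW]; exact one_pos
        refine LRLE.seqConv_of_pf2_right ?_ (LRLE.geom (by positivity) (by gcongr))
          (convAt_nonneg fun d _ => scaled_nonneg hm wm d) (fun x => by positivity)
          (PF2.convAt fun d _ => pf2_scaled hl pl d) (PF2.geom (by positivity)) (pos _ wl)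
          (by simp)
        exact LRLE.convAt_of_pf2_right (fun d _ => ih.2 d) (fun d _ => scaled_nonneg hm wm d)
          (fun d _ => pf2_scaled hl pl d) fun d _ => by rw [scaled_zero wl]; exact one_pos
    · rw [wIter, wIter, scaled_wUpdate hl, scaled_wUpdate hm]
      refine rev e (inv_nonneg.2 (cum_nonneg wl.nonneg e _)) (inv_nonneg.2 (cum_nonneg wm.nonneg e _))
        (cum_nonneg wl.nonneg e) (cum_nonneg wm.nonneg e) ?_
      refine LRLE.seqConv_right ?_ (convAt_nonneg fun d _ => wl.nonneg d)
        (convAt_nonneg fun d _ => wm.nonneg d) pf2_one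
      exact LRLE.convAt_of_pf2_right (fun d _ => ih.1 d) (fun d _ => wl.nonneg d)
        (fun d _ => pm d) fun d _ => by rw [wm.zero]; exact one_pos

theorem wLow_lam_mono {lam mu : ℝ} (hl : 0 < lam) (hlm : lam ≤ mu) (d : N.graph.Dart) :
    LRLE (N.wLow lam d) (N.wLow mu d) ∧ LRLE (scaled mu (N.wLow mu) d) (scaled lam (N.wLow lam) d) := by
  have hm : 0 < mu := hl.trans_le hlm
  refine ⟨LRLE.of_tendsto (Eventually.of_forall fun k => (wIter_lam_mono hl hlm (2 * k)).1 d)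
    (tendsto_wLow hl d) (tendsto_wLow hm d), LRLE.of_tendsto
    (Eventually.of_forall fun k => (wIter_lam_mono hl hlm (2 * k)).2 d)
    (fun x => (tendsto_wLow hm d x).mul_const _) (fun x => (tendsto_wLow hl d x).mul_const _)⟩

theorem wHigh_lam_mono {lam mu : ℝ} (hl : 0 < lam) (hlm : lam ≤ mu) (d : N.graph.Dart) :
    LRLE (N.wHigh lam d) (N.wHigh mu d) :=
  LRLE.of_tendsto (Eventually.of_forall fun k => (wIter_lam_mono hl hlm (2 * k + 1)).1 d)
    (tendsto_wHigh hl d) (tendsto_wHigh (hl.trans_le hlm) d)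

variable (N) in
/-- Networks on which the two extremal limits of the iteration agree, for every activity. -/
def Regular : Prop := ∀ lam : ℝ, 0 < lam → N.wLow lam = N.wHigh lam

/-- Agreement for rational activities is enough, since both limits depend continuously on the
activity. -/
theorem regular_of_rat (h : ∀ q : ℚ, 0 < q → N.wLow (q : ℝ) = N.wHigh (q : ℝ)) : N.Regular := by
  intro lam hl
  ext d x
  refine le_antisymm ((lrle_wLow_wHigh hl d).le_of_zero ((isWeight_wLow hl).zero d)
    ((isWeight_wHigh hl).zero d) x) ?_
  have key : ∀ mu : ℝ, lam < mu → ∃ q : ℚ, lam < q ∧ (q : ℝ) < mu := fun mu hmu => exists_rat_btwn hmu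
  -- between `lam` and `mu` lies a rational `q`; the weights increase from `lam` to `q`, and the
  -- scaled weights decrease
  have bound : ∀ mu : ℝ, lam < mu → N.wHigh lam d x ≤ (mu * lam⁻¹) ^ x * N.wLow lam d x := by
    intro mu hmu
    obtain ⟨q, hq, hq'⟩ := key mu hmu
    have q0 : (0 : ℝ) < q := hl.trans hq
    have h1 := (wHigh_lam_mono hl hq.le d).le_of_zero ((isWeight_wHigh hl).zero d)
      ((isWeight_wHigh q0).zero d) x
    rw [← h q (by exact_mod_cast q0)] at h1
    have h2 := ((wLow_lam_mono hl hq.le d).2).le_of_zero (scaled_zero (isWeight_wLow q0) d)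
      (scaled_zero (isWeight_wLow hl) d) x
    unfold scaled at h2
    have h3 : N.wLow (q : ℝ) d x ≤ (q * lam⁻¹ : ℝ) ^ x * N.wLow lam d x := by
      have e : (q : ℝ) ^ x * (q : ℝ)⁻¹ ^ x = 1 := by
        rw [← mul_pow, mul_inv_cancel₀ q0.ne', one_pow]
      have := mul_le_mul_of_nonneg_left h2 (pow_nonneg q0.le x)
      calc N.wLow (q : ℝ) d x = q ^ x * (N.wLow q d x * (q : ℝ)⁻¹ ^ x) := by
            linear_combination (- N.wLow (q : ℝ) d x) * e
        _ ≤ _ := this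
        _ = _ := by rw [mul_pow]; ring
    refine h1.trans (h3.trans (mul_le_mul_of_nonneg_right ?_ ((isWeight_wLow hl).nonneg d x)))
    gcongr
  have lim : Tendsto (fun mu : ℝ => (mu * lam⁻¹) ^ x * N.wLow lam d x) (𝓝[>] lam)
      (𝓝 ((lam * lam⁻¹) ^ x * N.wLow lam d x)) := by
    refine tendsto_nhdsWithin_of_tendsto_nhds ?_
    exact (Continuous.tendsto (by fun_prop) lam)
  rw [mul_inv_cancel₀ hl.ne', one_pow, one_mul] at lim
  exact ge_of_tendsto lim (eventually_nhdsWithin_of_forall fun mu hmu => bound mu hmu)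

/-! ### Messages and weights -/

variable (N) in
/-- The messages given by normalising weights to total mass one. -/
def normalize (W : N.graph.Dart → ℕ → ℝ) (d : N.graph.Dart) (x : ℕ) : ℝ :=
  (∑ t ∈ Finset.range (N.cap d + 1), W d t)⁻¹ * W d x

theorem IsWeight.one_le_sum {W : N.graph.Dart → ℕ → ℝ} (h : N.IsWeight W) (d : N.graph.Dart) :
    1 ≤ ∑ t ∈ Finset.range (N.cap d + 1), W d t := by
  rw [← h.zero d]
  exact Finset.single_le_sum (f := fun t => W d t) (fun t _ => h.nonneg d t) (by simp)

theorem suppInf_eq_zero {f : ℕ → ℝ} (h : 0 < f 0) : suppInf f = 0 :=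
  Nat.sInf_eq_zero.2 (Or.inl h)

theorem bpWeight_const_mul (lam : ℝ) (W : N.graph.Dart → ℕ → ℝ) (c : N.graph.Dart → ℝ)
    (e : N.graph.Dart) (x : ℕ) : N.bpWeight lam (fun d x => c d * W d x) e x
      = (∏ d ∈ N.preDarts e, c d) * N.bpWeight lam W e x := by
  unfold bpWeight
  split_ifs
  · simp only [convAt_const_mul, ← Finset.mul_sum]; ring
  · simp

/-- Belief propagation on normalised weights is `wUpdate`.  As `0` is charged, the infima of the
supports vanish and the first case in the definition of the update applies. -/
theorem bpUpdate_normalize {lam : ℝ} {W : N.graph.Dart → ℕ → ℝ} (h : N.IsWeight W) :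
    N.bpUpdate lam (N.normalize W) = N.normalize (N.wUpdate lam W) := by
  ext e x
  have hs : ∀ d, 0 < ∑ t ∈ Finset.range (N.cap d + 1), W d t := fun d =>
    one_pos.trans_le (h.one_le_sum d)
  have h0 : ∀ d, suppInf (N.normalize W d) = 0 := fun d => suppInf_eq_zero (by
    rw [normalize, h.zero, mul_one]; exact inv_pos.2 (hs d))
  unfold bpUpdate
  rw [if_pos (by simp [h0])]
  have e1 : ∀ x, N.bpWeight lam (N.normalize W) e x
      = (∏ d ∈ N.preDarts e, (∑ t ∈ Finset.range (N.cap d + 1), W d t)⁻¹) * N.bpWeight lam W e x :=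
    bpWeight_const_mul lam W _ e
  have hc : (∏ d ∈ N.preDarts e, (∑ t ∈ Finset.range (N.cap d + 1), W d t)⁻¹) ≠ 0 :=
    Finset.prod_ne_zero_iff.2 fun d _ => inv_ne_zero (hs d).ne'
  have hb : N.bpWeight lam W e 0 ≠ 0 := by
    rw [bpWeight_zero]; linarith [one_le_cum h e (N.b e.fst)]
  simp only [e1, ← Finset.mul_sum, normalize, wUpdate, ← Finset.sum_div]
  rw [mul_div_mul_left _ _ hc, inv_div, div_mul_div_comm, mul_comm _ (N.bpWeight lam W e 0),
    mul_div_mul_left _ _ hb]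

theorem IsWeight.isMessage_normalize {W : N.graph.Dart → ℕ → ℝ} (h : N.IsWeight W) :
    N.IsMessage (N.normalize W) := by
  intro d
  have := h.one_le_sum d
  refine ⟨fun x => mul_nonneg (inv_nonneg.2 (by linarith)) (h.nonneg d x), fun x hx => ?_, ?_⟩
  · rw [normalize, h.cap d x hx, mul_zero]
  · simp only [normalize, ← Finset.mul_sum]
    exact inv_mul_cancel₀ (by linarith)

/-- A message that is fixed by the update gives positive mass to `0`. -/
theorem IsBPFixedPoint.zero_pos {lam : ℝ} {m : N.graph.Dart → ℕ → ℝ} (hl : 0 < lam)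
    (h : N.IsBPFixedPoint lam m) (e : N.graph.Dart) : 0 < m e 0 := by
  obtain ⟨hm, hfix⟩ := h
  have key : N.bpUpdate lam m e 0 = m e 0 := by rw [hfix]
  have hsupp : ∀ d, 0 < m d (suppInf (m d)) := by
    intro d
    refine Nat.sInf_mem (s := {x | 0 < m d x}) ?_
    by_contra hne
    rw [Set.not_nonempty_iff_eq_empty] at hne
    have h1 := (hm d).2.2
    rw [Finset.sum_eq_zero] at h1
    · exact zero_ne_one h1
    · intro x _
      refine le_antisymm ?_ ((hm d).1 x)
      by_contra h2
      have : x ∈ ({x | 0 < m d x} : Set ℕ) := not_le.1 h2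
      rw [hne] at this
      exact this
  have hw : ∀ x, 0 ≤ N.bpWeight lam m e x := by
    intro x
    unfold bpWeight
    split_ifs
    · exact mul_nonneg (by positivity)
        (Finset.sum_nonneg fun n _ => convAt_nonneg (fun d _ => (hm d).1) n)
    · exact le_rfl
  rw [← key]
  unfold bpUpdate
  split_ifs with hle h0
  · have h1 : 0 < N.bpWeight lam m e 0 := by
      simp only [bpWeight, Nat.zero_le, if_true, pow_zero, one_mul, Nat.sub_zero]
      refine Finset.sum_pos' (fun n _ => convAt_nonneg (fun d _ => (hm d).1) n)
        ⟨∑ d ∈ N.preDarts e, suppInf (m d), by simp; omega, ?_⟩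
      exact convAt_pos (fun d _ => (hm d).1) fun d _ => hsupp d
    refine div_pos h1 (Finset.sum_pos' (fun t _ => hw t) ⟨0, by simp, h1⟩)
  · exact one_pos
  · exact absurd rfl h0

theorem isBPFixedPoint_normalize {lam : ℝ} {W : N.graph.Dart → ℕ → ℝ}
    (h : N.IsWeight W) (hfix : N.wUpdate lam W = W) : N.IsBPFixedPoint lam (N.normalize W) :=
  ⟨h.isMessage_normalize, by rw [bpUpdate_normalize h, hfix]⟩

/-- Fixed messages correspond to fixed weights, obtained by dividing by the mass of `0`. -/
theorem IsBPFixedPoint.exists_weight {lam : ℝ} (hl : 0 < lam) {m : N.graph.Dart → ℕ → ℝ}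
    (h : N.IsBPFixedPoint lam m) :
    ∃ W, N.IsWeight W ∧ N.wUpdate lam W = W ∧ m = N.normalize W := by
  have h0 := h.zero_pos hl
  have hW : N.IsWeight fun d x => (m d 0)⁻¹ * m d x := by
    refine ⟨fun d => inv_mul_cancel₀ (h0 d).ne', fun d x =>
      mul_nonneg (inv_nonneg.2 (h0 d).le) ((h.1 d).1 x), fun d x hx => ?_⟩
    rw [(h.1 d).2.1 x hx, mul_zero]
  have e : m = N.normalize fun d x => (m d 0)⁻¹ * m d x := by
    ext d x
    rw [normalize, ← Finset.mul_sum, (h.1 d).2.2, mul_one, inv_inv, ← mul_assoc,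
      mul_inv_cancel₀ (h0 d).ne', one_mul]
  refine ⟨_, hW, ?_, e⟩
  ext d x
  have h1 := h.2
  rw [e, bpUpdate_normalize hW] at h1
  set W := fun d x => (m d 0)⁻¹ * m d x
  have hW' := hW.wUpdate hl
  have s := (hW.one_le_sum d)
  have s' := (hW'.one_le_sum d)
  have e0 := congrFun (congrFun h1 d) 0
  have ex := congrFun (congrFun h1 d) x
  simp only [normalize, hW.zero, hW'.zero, mul_one] at e0 ex
  rw [e0] at ex
  exact mul_left_cancel₀ (inv_ne_zero (by linarith)) ex

theorem Regular.wUpdate_eq {lam : ℝ} (hl : 0 < lam) (h : N.Regular) :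
    N.wUpdate lam (N.wLow lam) = N.wLow lam := by
  rw [wUpdate_wLow hl, h lam hl]

theorem Regular.existsUnique {lam : ℝ} (hl : 0 < lam) (h : N.Regular) :
    ∃! m, N.IsBPFixedPoint lam m := by
  refine ⟨N.normalize (N.wLow lam),
    isBPFixedPoint_normalize (isWeight_wLow hl) (h.wUpdate_eq hl), fun m hm => ?_⟩
  obtain ⟨W, hW, hfix, rfl⟩ := hm.exists_weight hl
  rw [eq_wLow_of_fixed hl (h lam hl) hW hfix]

theorem Regular.bpMessage_eq {lam : ℝ} (hl : 0 < lam) (h : N.Regular) :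
    N.bpMessage lam = N.normalize (N.wLow lam) :=
  (h.existsUnique hl).unique (Classical.epsilon_spec (h.existsUnique hl).exists)
    (isBPFixedPoint_normalize (isWeight_wLow hl) (h.wUpdate_eq hl))

/-! ### Occupancies as sums over edges -/

variable (N) in
/-- The occupancy of a vertex in terms of weights. -/
def wOcc (W : N.graph.Dart → ℕ → ℝ) (v : N.V) : ℝ :=
  (∑ n ∈ Finset.range (N.b v + 1), convAt (N.inDarts v) W n * n) /
    ∑ n ∈ Finset.range (N.b v + 1), convAt (N.inDarts v) W n

theorem occupancy_normalize {W : N.graph.Dart → ℕ → ℝ} (h : N.IsWeight W) (v : N.V) :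
    N.occupancy (N.normalize W) v = N.wOcc W v := by
  have hs : ∀ d, 0 < ∑ t ∈ Finset.range (N.cap d + 1), W d t := fun d =>
    one_pos.trans_le (h.one_le_sum d)
  have h0 : ∀ d, suppInf (N.normalize W d) = 0 := fun d => suppInf_eq_zero (by
    rw [normalize, h.zero, mul_one]; exact inv_pos.2 (hs d))
  unfold occupancy
  rw [if_pos (by simp [h0])]
  have e1 : ∀ n, convAt (N.inDarts v) (N.normalize W) n
      = (∏ d ∈ N.inDarts v, (∑ t ∈ Finset.range (N.cap d + 1), W d t)⁻¹)
        * convAt (N.inDarts v) W n := convAt_const_mul _ _ _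
  have hc : (∏ d ∈ N.inDarts v, (∑ t ∈ Finset.range (N.cap d + 1), W d t)⁻¹) ≠ 0 :=
    Finset.prod_ne_zero_iff.2 fun d _ => inv_ne_zero (hs d).ne'
  simp only [e1, ← Finset.mul_sum, mul_left_comm _ (∏ d ∈ N.inDarts v, _)]
  rw [mul_div_mul_left _ _ hc]
  simp only [wOcc, mul_comm]

variable (N) in
/-- The mean occupancy of an edge when the two messages on it have weights `W` and `W'`. -/
def edgeMean (lam : ℝ) (W W' : N.graph.Dart → ℕ → ℝ) (d : N.graph.Dart) : ℝ :=
  (∑ x ∈ Finset.range (N.cap d + 1), W d x * W' d.symm x * lam⁻¹ ^ x * x) /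
    ∑ x ∈ Finset.range (N.cap d + 1), W d x * W' d.symm x * lam⁻¹ ^ x

theorem edgeMean_symm (lam : ℝ) (W W' : N.graph.Dart → ℕ → ℝ) (d : N.graph.Dart) :
    N.edgeMean lam W W' d.symm = N.edgeMean lam W' W d := by
  unfold edgeMean
  rw [cap_symm, SimpleGraph.Dart.symm_symm]
  simp only [mul_comm (W d.symm _)]

theorem sum_seqConv_range (f g : ℕ → ℝ) (b : ℕ) :
    ∑ n ∈ Finset.range (b + 1), seqConv f g n
      = ∑ x ∈ Finset.range (b + 1), f x * seqConv g (fun _ => 1) (b - x) := by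
  rw [← seqConv_one, seqConv_assoc, seqConv_eq_sum_range]

/-- In the product of the two messages on an edge, one factor carries the constraint at `v` given the
other edges, so sums over the edge are sums over the configurations around `v`. -/
theorem sum_edge_eq {lam : ℝ} (hl : 0 < lam) {W : N.graph.Dart → ℕ → ℝ} (h : N.IsWeight W)
    {v : N.V} {d : N.graph.Dart} (hd : d ∈ N.inDarts v) (φ : ℕ → ℝ) :
    ∑ x ∈ Finset.range (N.cap d + 1), W d x * N.wUpdate lam W d.symm x * lam⁻¹ ^ x * φ x
      = (N.cum W d.symm (N.b v))⁻¹ * ∑ x ∈ Finset.range (N.b v + 1),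
          (φ x * W d x) * N.cum W d.symm (N.b v - x) := by
  have hv : d.symm.fst = v := (mem_inDarts N).1 hd
  have e1 : ∀ x, W d x * N.wUpdate lam W d.symm x * lam⁻¹ ^ x * φ x
      = (N.cum W d.symm (N.b v))⁻¹ * ((φ x * W d x) *
        (if x ≤ N.cap d then revSeq (N.b v) (N.cum W d.symm) x else 0)) := by
    intro x
    have := congrFun (scaled_wUpdate hl W d.symm) x
    rw [scaled, hv, cap_symm] at this
    linear_combination W d x * φ x * this
  rw [Finset.sum_congr rfl fun x _ => e1 x, ← Finset.mul_sum]
  congr 1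
  have e2 : ∀ x, x ∈ Finset.range (N.b v + 1) → φ x * W d x * N.cum W d.symm (N.b v - x)
      = φ x * W d x * (if x ≤ N.cap d then revSeq (N.b v) (N.cum W d.symm) x else 0) := by
    intro x hx
    rw [Finset.mem_range] at hx
    by_cases hc : x ≤ N.cap d
    · simp [hc, revSeq, show x ≤ N.b v by omega]
    · simp [hc, h.cap d x (by omega)]
  rw [Finset.sum_congr rfl e2]
  rcases le_total (N.cap d) (N.b v) with hcb | hcb
  · refine Finset.sum_subset (Finset.range_mono (by omega)) fun x _ hx => ?_
    rw [Finset.mem_range] at hx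
    simp [show ¬ x ≤ N.cap d by omega]
  · refine (Finset.sum_subset (Finset.range_mono (by omega)) fun x _ hx => ?_).symm
    rw [Finset.mem_range] at hx
    simp [revSeq, show ¬ x ≤ N.b v by omega]

/-- The occupancy of a vertex is the sum of the mean occupancies of its edges. -/
theorem wOcc_eq_sum_edgeMean {lam : ℝ} (hl : 0 < lam) {W : N.graph.Dart → ℕ → ℝ}
    (h : N.IsWeight W) (v : N.V) :
    N.wOcc W v = ∑ d ∈ N.inDarts v, N.edgeMean lam W (N.wUpdate lam W) d := by
  classical
  unfold wOcc
  simp only [mul_comm _ (_ : ℝ), fun n : ℕ => (mul_convAt (N.inDarts v) W n)]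
  rw [Finset.sum_comm, Finset.sum_div]
  refine Finset.sum_congr rfl fun d hd => ?_
  have hpre := preDarts_symm N hd
  have hcum : N.cum W d.symm = seqConv (convAt ((N.inDarts v).erase d) W) fun _ => 1 := by
    rw [cum, hpre]
  have hc := one_le_cum h d.symm (N.b v)
  have hden : ∑ n ∈ Finset.range (N.b v + 1), convAt (N.inDarts v) W n
      = ∑ x ∈ Finset.range (N.b v + 1), (1 * W d x) * N.cum W d.symm (N.b v - x) := by
    rw [convAt_erase hd, sum_seqConv_range, hcum]
    simp only [one_mul]
    congr!
  have e1 := sum_edge_eq hl h hd fun _ => 1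
  simp only [mul_one] at e1
  rw [edgeMean, e1, sum_edge_eq hl h hd fun x => x, mul_div_mul_left _ _ (by positivity), hden,
    sum_seqConv_range, hcum]
  simp only [mul_comm (W d _) (Nat.cast _)]
  congr!

theorem sum_convAt_pos {W : N.graph.Dart → ℕ → ℝ} (h : N.IsWeight W) (v : N.V) (b : ℕ) :
    1 ≤ ∑ n ∈ Finset.range (b + 1), convAt (N.inDarts v) W n := by
  have h1 : convAt (N.inDarts v) W 0 = 1 := by
    rw [convAt_zero]; exact Finset.prod_eq_one fun d _ => h.zero d
  rw [← h1]
  exact Finset.single_le_sum (f := fun n => convAt (N.inDarts v) W n)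
    (fun i _ => convAt_nonneg (fun i _ => h.nonneg i) i) (by simp)

theorem wOcc_nonneg {W : N.graph.Dart → ℕ → ℝ} (h : N.IsWeight W) (v : N.V) : 0 ≤ N.wOcc W v :=
  div_nonneg (Finset.sum_nonneg fun n _ => mul_nonneg (convAt_nonneg (fun d _ => h.nonneg d) n)
    (Nat.cast_nonneg n)) (zero_le_one.trans (sum_convAt_pos h v _))

theorem wOcc_le {W : N.graph.Dart → ℕ → ℝ} (h : N.IsWeight W) (v : N.V) : N.wOcc W v ≤ N.b v := by
  have h1 := sum_convAt_pos h v (N.b v)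
  rw [wOcc, div_le_iff₀ (by linarith), Finset.mul_sum]
  refine Finset.sum_le_sum fun n hn => ?_
  rw [mul_comm]
  refine mul_le_mul_of_nonneg_right ?_ (convAt_nonneg (fun d _ => h.nonneg d) n)
  rw [Finset.mem_range] at hn
  exact_mod_cast (show n ≤ N.b v by omega)

/-- The occupancy is non-decreasing in the likelihood-ratio order. -/
theorem wOcc_mono {W W' : N.graph.Dart → ℕ → ℝ} (h : N.IsWeight W) (h' : N.IsWeight W')
    (hp : ∀ d, PF2 (W' d)) (hle : ∀ d, LRLE (W d) (W' d)) (v : N.V) : N.wOcc W v ≤ N.wOcc W' v := by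
  have h1 := sum_convAt_pos h v (N.b v)
  have h2 := sum_convAt_pos h' v (N.b v)
  rw [wOcc, wOcc, div_le_div_iff₀ (by linarith) (by linarith)]
  have := (LRLE.convAt_of_pf2_right (S := N.inDarts v) (fun d _ => hle d) (fun d _ => h.nonneg d)
    (fun d _ => hp d) fun d _ => by rw [h'.zero]; exact one_pos).sum_mul_sum_le
    (φ := fun n => (n : ℝ)) Nat.mono_cast (N.b v + 1)
  linarith

theorem edgeMean_den_pos {lam : ℝ} (hl : 0 < lam) {W W' : N.graph.Dart → ℕ → ℝ} (h : N.IsWeight W)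
    (h' : N.IsWeight W') (d : N.graph.Dart) :
    1 ≤ ∑ x ∈ Finset.range (N.cap d + 1), W d x * W' d.symm x * lam⁻¹ ^ x := by
  have h1 : W d 0 * W' d.symm 0 * lam⁻¹ ^ 0 = 1 := by simp [h.zero, h'.zero]
  rw [← h1]
  exact Finset.single_le_sum (f := fun x => W d x * W' d.symm x * lam⁻¹ ^ x) (fun x _ =>
    mul_nonneg (mul_nonneg (h.nonneg d x) (h'.nonneg _ x)) (by positivity)) (by simp)

theorem edgeMean_nonneg {lam : ℝ} (hl : 0 < lam) {W W' : N.graph.Dart → ℕ → ℝ} (h : N.IsWeight W)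
    (h' : N.IsWeight W') (d : N.graph.Dart) : 0 ≤ N.edgeMean lam W W' d := by
  have := edgeMean_den_pos hl h h' d
  exact div_nonneg (Finset.sum_nonneg fun x _ => mul_nonneg (mul_nonneg (mul_nonneg (h.nonneg d x)
    (h'.nonneg _ x)) (by positivity)) (Nat.cast_nonneg x)) (by linarith)

theorem edgeMean_le {lam : ℝ} (hl : 0 < lam) {W W' : N.graph.Dart → ℕ → ℝ} (h : N.IsWeight W)
    (h' : N.IsWeight W') (d : N.graph.Dart) : N.edgeMean lam W W' d ≤ N.cap d := by
  have h1 := edgeMean_den_pos hl h h' d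
  rw [edgeMean, div_le_iff₀ (by linarith), Finset.mul_sum]
  refine Finset.sum_le_sum fun x hx => ?_
  rw [mul_comm]
  refine mul_le_mul_of_nonneg_right ?_ (mul_nonneg (mul_nonneg (h.nonneg d x) (h'.nonneg _ x))
    (by positivity))
  rw [Finset.mem_range] at hx
  exact_mod_cast (show x ≤ N.cap d by omega)

/-- If the occupancies at `v` under the two extremal limits agree, then so do the messages that
leave `v`. -/
theorem wLow_eq_wHigh_of_wOcc_eq {lam : ℝ} (hl : 0 < lam) {v : N.V}
    (he : N.wOcc (N.wLow lam) v = N.wOcc (N.wHigh lam) v) {e : N.graph.Dart} (hv : e.fst = v) :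
    N.wLow lam e = N.wHigh lam e := by
  have wl := isWeight_wLow (N := N) hl
  have wh := isWeight_wHigh (N := N) hl
  have pl := pf2_wLow (N := N) hl
  have ph : ∀ d, PF2 (N.wHigh lam d) := fun d =>
    PF2.of_tendsto (Eventually.of_forall fun _ => pf2_wIter hl _ d) (tendsto_wHigh hl d)
  have hle := LRLE.convAt_of_pf2_right (S := N.inDarts v) (fun d _ => lrle_wLow_wHigh hl d)
    (fun d _ => wl.nonneg d) (fun d _ => ph d) fun d _ => by rw [wh.zero]; exact one_pos
  have h1 := sum_convAt_pos wl v (N.b v)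
  have h2 := sum_convAt_pos wh v (N.b v)
  rw [wOcc, wOcc, div_eq_div_iff (by linarith) (by linarith)] at he
  have hz : ∀ {W : N.graph.Dart → ℕ → ℝ}, N.IsWeight W → convAt (N.inDarts v) W 0 = 1 := fun h => by
    rw [convAt_zero]; exact Finset.prod_eq_one fun d _ => h.zero d
  -- equal means make the two convolutions proportional up to `b`; both take the value `1` at `0`
  have hS : ∀ n ≤ N.b v, convAt (N.inDarts v) (N.wLow lam) n
      = convAt (N.inDarts v) (N.wHigh lam) n := by
    intro n hn
    have := hle.eq_of_mean_eq (M := N.b v + 1) (by linarith) (show n < N.b v + 1 by omega)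
    rwa [hz wl, hz wh, mul_one, one_mul] at this
  -- ordered factors with the same convolution agree; only their values up to `b` enter the
  -- messages that leave `v`
  have hd : ∀ d ∈ N.inDarts v, ∀ n ≤ N.b v, N.wLow lam d n = N.wHigh lam d n := fun d hd n hn =>
    eq_of_convAt_eq (fun d _ => wl.nonneg d) (fun d _ => (lrle_wLow_wHigh hl d).le_of_zero
      (wl.zero d) (wh.zero d)) (fun d _ => wl.zero d) (fun d _ => wh.zero d) (hS n hn) hd
  have hcum : ∀ k ≤ N.b v, N.cum (N.wLow lam) e k = N.cum (N.wHigh lam) e k := by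
    intro k hk
    refine seqConv_congr_le (fun n hn => convAt_congr_le fun d hd' x hx => hd d ?_ x ?_) fun _ _ => rfl
    · rw [mem_preDarts] at hd'; rw [mem_inDarts, hd'.1, hv]
    · omega
  have key : N.wUpdate lam (N.wHigh lam) e = N.wUpdate lam (N.wLow lam) e := by
    ext x
    rw [Network.wUpdate_eq, Network.wUpdate_eq, hv, hcum _ le_rfl]
    by_cases hx : x ≤ N.b v
    · simp only [revSeq, hx, if_true, hcum _ (Nat.sub_le _ _)]
    · simp only [revSeq, hx, if_false]
  rwa [wUpdate_wHigh hl, wUpdate_wLow hl] at key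

end Network
end

noncomputable section

/-! ### The limit of large activity -/

/-- A non-negative sequence that grows at least by the factor `1 / ε` at every step up to `b` has a
mean on `[0, b]` within `b ε` of `b`. -/
theorem sub_mean_le {f : ℕ → ℝ} (hf : ∀ n, 0 ≤ f n) {b : ℕ} {ε : ℝ}
    (h : ∀ n < b, f n ≤ ε * f (n + 1)) (hpos : 0 < ∑ n ∈ Finset.range (b + 1), f n) (hε : 0 ≤ ε) :
    (b : ℝ) - (∑ n ∈ Finset.range (b + 1), f n * n) / ∑ n ∈ Finset.range (b + 1), f n ≤ b * ε := by
  have h1 : ∑ n ∈ Finset.range b, f n ≤ ε * ∑ n ∈ Finset.range (b + 1), f n := by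
    rw [Finset.sum_range_succ', mul_add, Finset.mul_sum]
    have := Finset.sum_le_sum fun n hn => h n (Finset.mem_range.1 hn)
    linarith [mul_nonneg hε (hf 0)]
  have h2 : (b : ℝ) * (∑ n ∈ Finset.range (b + 1), f n) - ∑ n ∈ Finset.range (b + 1), f n * n
      ≤ b * ∑ n ∈ Finset.range b, f n := by
    rw [Finset.mul_sum, ← Finset.sum_sub_distrib, Finset.sum_range_succ, Finset.mul_sum]
    have : ∑ n ∈ Finset.range b, ((b : ℝ) * f n - f n * n) ≤ ∑ n ∈ Finset.range b, (b : ℝ) * f n :=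
      Finset.sum_le_sum fun n _ => by linarith [mul_nonneg (hf n) (Nat.cast_nonneg (α := ℝ) n)]
    linarith [mul_comm (b : ℝ) (f b)]
  rw [sub_le_iff_le_add, ← sub_le_iff_le_add', le_div_iff₀ hpos]
  nlinarith [mul_le_mul_of_nonneg_left h1 (Nat.cast_nonneg (α := ℝ) b)]

theorem exists_tendsto_of_monotoneOn {f : ℝ → ℝ} (hf : MonotoneOn f (Ioi 0)) {B : ℝ}
    (hB : ∀ t, 0 < t → f t ≤ B) : ∃ l, Tendsto f atTop (𝓝 l) := by
  have hm : Monotone fun t => f (max t 1) := fun s t hst =>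
    hf (mem_Ioi.2 (lt_max_of_lt_right one_pos)) (mem_Ioi.2 (lt_max_of_lt_right one_pos)) (max_le_max_right 1 hst)
  refine ⟨_, (tendsto_atTop_ciSup hm ⟨B, ?_⟩).congr' ?_⟩
  · rintro _ ⟨t, rfl⟩; exact hB _ (lt_max_of_lt_right one_pos)
  · filter_upwards [eventually_ge_atTop 1] with t ht
    rw [max_eq_left ht]

namespace Network

variable {X Y : Type*} {N : Network X Y}

theorem normalize_nonneg {W : N.graph.Dart → ℕ → ℝ} (h : N.IsWeight W) (d : N.graph.Dart) (x : ℕ) :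
    0 ≤ N.normalize W d x := (h.isMessage_normalize d).1 x

theorem normalize_le_one {W : N.graph.Dart → ℕ → ℝ} (h : N.IsWeight W) (d : N.graph.Dart) (x : ℕ) :
    N.normalize W d x ≤ 1 := by
  rcases lt_or_ge (N.cap d) x with hx | hx
  · rw [(h.isMessage_normalize d).2.1 x hx]; exact zero_le_one
  · rw [← (h.isMessage_normalize d).2.2]
    exact Finset.single_le_sum (f := fun t => N.normalize W d t)
      (fun t _ => normalize_nonneg h d t) (Finset.mem_range.2 (by omega))

theorem pf2_normalize {W : N.graph.Dart → ℕ → ℝ} (h : N.IsWeight W) (hp : ∀ d, PF2 (W d))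
    (d : N.graph.Dart) : PF2 (N.normalize W d) :=
  (hp d).const_mul (inv_nonneg.2 (zero_le_one.trans (h.one_le_sum d)))

variable (N) in
/-- The tail of a normalised message. -/
def msgTail (W : N.graph.Dart → ℕ → ℝ) (d : N.graph.Dart) (x : ℕ) : ℝ :=
  ∑ t ∈ Finset.range (N.cap d + 1), N.normalize W d t * if x ≤ t then 1 else 0

/-- Tails of messages are monotone for the likelihood-ratio order. -/
theorem msgTail_mono {W W' : N.graph.Dart → ℕ → ℝ} (h : N.IsWeight W) (h' : N.IsWeight W')
    {d : N.graph.Dart} (hle : LRLE (W d) (W' d)) (x : ℕ) : N.msgTail W d x ≤ N.msgTail W' d x := by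
  have h1 := h.one_le_sum d
  have h2 := h'.one_le_sum d
  have h3 := (hle.const_mul (c := (∑ t ∈ Finset.range (N.cap d + 1), W d t)⁻¹)
    (c' := (∑ t ∈ Finset.range (N.cap d + 1), W' d t)⁻¹) (by positivity)
    (by positivity)).sum_mul_sum_le (φ := fun t => if x ≤ t then 1 else 0) (fun i j hij => by
      dsimp only; split_ifs <;> first | omega | simp) (N.cap d + 1)
  have e1 := (h.isMessage_normalize d).2.2
  have e2 := (h'.isMessage_normalize d).2.2
  unfold normalize at e1 e2
  rw [e1, e2, mul_one, one_mul] at h3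
  exact h3

theorem msgTail_sub {W : N.graph.Dart → ℕ → ℝ} {d : N.graph.Dart} {x : ℕ} (hx : x ≤ N.cap d) :
    N.msgTail W d x - N.msgTail W d (x + 1) = N.normalize W d x := by
  unfold msgTail
  rw [← Finset.sum_sub_distrib, Finset.sum_eq_single x]
  · simp
  · intro t _ ht
    rw [← mul_sub]
    have : (if x ≤ t then (1 : ℝ) else 0) - (if x + 1 ≤ t then 1 else 0) = 0 := by
      split_ifs <;> first | omega | simp
    rw [this, mul_zero]
  · intro h; exact absurd (Finset.mem_range.2 (by omega)) h

theorem msgTail_le_one {W : N.graph.Dart → ℕ → ℝ} (h : N.IsWeight W) (d : N.graph.Dart) (x : ℕ) :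
    N.msgTail W d x ≤ 1 := by
  rw [← (h.isMessage_normalize d).2.2]
  refine Finset.sum_le_sum fun t _ => ?_
  split_ifs
  · simp
  · simpa using normalize_nonneg h d t

variable (N) in
/-- The limit of the messages as the activity tends to infinity. -/
def msgInf (d : N.graph.Dart) (x : ℕ) : ℝ :=
  limUnder atTop fun lam : ℝ => N.normalize (N.wLow lam) d x

variable (N) in
/-- The limit of the scaled weights as the activity tends to infinity. -/
def scInf (d : N.graph.Dart) (x : ℕ) : ℝ :=
  limUnder atTop fun lam : ℝ => scaled lam (N.wLow lam) d x

theorem tendsto_msgInf (d : N.graph.Dart) (x : ℕ) :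
    Tendsto (fun lam : ℝ => N.normalize (N.wLow lam) d x) atTop (𝓝 (N.msgInf d x)) := by
  refine tendsto_nhds_limUnder ?_
  rcases lt_or_ge (N.cap d) x with hx | hx
  · refine ⟨0, tendsto_const_nhds.congr' ?_⟩
    filter_upwards [eventually_gt_atTop 0] with lam hl
    rw [((isWeight_wLow hl).isMessage_normalize d).2.1 x hx]
  · -- the tails are monotone in the activity, and the masses are differences of tails
    have key : ∀ y, ∃ l, Tendsto (fun lam : ℝ => N.msgTail (N.wLow lam) d y) atTop (𝓝 l) := by
      refine fun y => exists_tendsto_of_monotoneOn (fun s hs t ht hst => ?_) fun t ht =>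
        msgTail_le_one (isWeight_wLow ht) d y
      exact msgTail_mono (isWeight_wLow hs) (isWeight_wLow ht) (wLow_lam_mono hs hst d).1 y
    obtain ⟨l, hl⟩ := key x
    obtain ⟨l', hl'⟩ := key (x + 1)
    exact ⟨_, (hl.sub hl').congr fun lam => msgTail_sub hx⟩

theorem tendsto_scInf (d : N.graph.Dart) (x : ℕ) :
    Tendsto (fun lam : ℝ => scaled lam (N.wLow lam) d x) atTop (𝓝 (N.scInf d x)) := by
  refine tendsto_nhds_limUnder ?_
  obtain ⟨l, hl⟩ := exists_tendsto_of_monotoneOn (f := fun lam => - scaled lam (N.wLow lam) d x)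
    (B := 0) (fun s hs t ht hst => neg_le_neg ((wLow_lam_mono hs hst d).2.le_of_zero
      (scaled_zero (isWeight_wLow ht) d) (scaled_zero (isWeight_wLow hs) d) x))
    fun t ht => neg_nonpos.2 (scaled_nonneg ht (isWeight_wLow ht) d x)
  exact ⟨-l, by simpa using hl.neg⟩

theorem msgInf_nonneg (d : N.graph.Dart) (x : ℕ) : 0 ≤ N.msgInf d x :=
  ge_of_tendsto (tendsto_msgInf d x) (by
    filter_upwards [eventually_gt_atTop 0] with lam hl
    exact normalize_nonneg (isWeight_wLow hl) d x)

theorem scInf_nonneg (d : N.graph.Dart) (x : ℕ) : 0 ≤ N.scInf d x :=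
  ge_of_tendsto (tendsto_scInf d x) (by
    filter_upwards [eventually_gt_atTop 0] with lam hl
    exact scaled_nonneg hl (isWeight_wLow hl) d x)

theorem scInf_zero (d : N.graph.Dart) : N.scInf d 0 = 1 := by
  refine tendsto_nhds_unique (tendsto_scInf d 0) (tendsto_const_nhds.congr' ?_)
  filter_upwards [eventually_gt_atTop 0] with lam hl
  rw [scaled_zero (isWeight_wLow hl)]

theorem pf2_scInf (d : N.graph.Dart) : PF2 (N.scInf d) :=
  PF2.of_tendsto (l := atTop) (f := fun lam => scaled lam (N.wLow lam) d) (by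
    filter_upwards [eventually_gt_atTop 0] with lam hl
    exact pf2_scaled hl (pf2_wLow hl) d) (tendsto_scInf d)

theorem sum_msgInf (d : N.graph.Dart) : ∑ x ∈ Finset.range (N.cap d + 1), N.msgInf d x = 1 := by
  refine tendsto_nhds_unique (tendsto_finsetSum _ fun x _ => tendsto_msgInf d x)
    (tendsto_const_nhds.congr' ?_)
  filter_upwards [eventually_gt_atTop 0] with lam hl
  exact ((isWeight_wLow hl).isMessage_normalize d).2.2.symm

theorem msgInf_eq_zero {d : N.graph.Dart} {x : ℕ} (h : N.cap d < x) : N.msgInf d x = 0 := by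
  refine tendsto_nhds_unique (tendsto_msgInf d x) (tendsto_const_nhds.congr' ?_)
  filter_upwards [eventually_gt_atTop 0] with lam hl
  rw [((isWeight_wLow hl).isMessage_normalize d).2.1 x h]

variable (N) in
/-- The smallest value charged by the limiting message. -/
def aInf (d : N.graph.Dart) : ℕ := suppInf (N.msgInf d)

variable (N) in
/-- The image of `aInf` under the capacity operator; it turns out to be the largest value in the
support of the limiting scaled weights. -/
def gInf : N.graph.Dart → ℕ := N.capUpdate N.aInf

theorem msgInf_aInf_pos (d : N.graph.Dart) : 0 < N.msgInf d (N.aInf d) := by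
  refine Nat.sInf_mem (s := {x | 0 < N.msgInf d x}) ?_
  by_contra hne
  rw [Set.not_nonempty_iff_eq_empty] at hne
  have h1 := sum_msgInf d
  rw [Finset.sum_eq_zero] at h1
  · exact zero_ne_one h1
  · intro x _
    refine le_antisymm ?_ (msgInf_nonneg d x)
    by_contra h2
    have : x ∈ ({x | 0 < N.msgInf d x} : Set ℕ) := not_le.1 h2
    rw [hne] at this
    exact this

theorem msgInf_of_lt_aInf {d : N.graph.Dart} {x : ℕ} (h : x < N.aInf d) : N.msgInf d x = 0 := by
  refine le_antisymm ?_ (msgInf_nonneg d x)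
  by_contra h2
  exact absurd (Nat.sInf_le (s := {x | 0 < N.msgInf d x}) (not_le.1 h2)) (not_le.2 h)

theorem aInf_le_cap (d : N.graph.Dart) : N.aInf d ≤ N.cap d := by
  by_contra h
  exact (msgInf_aInf_pos d).ne' (msgInf_eq_zero (not_le.1 h))

theorem cum_normalize (W : N.graph.Dart → ℕ → ℝ) (e : N.graph.Dart) (k : ℕ) :
    N.cum (N.normalize W) e k
      = (∏ d ∈ N.preDarts e, (∑ t ∈ Finset.range (N.cap d + 1), W d t)⁻¹) * N.cum W e k := by
  unfold cum
  rw [seqConv_one, seqConv_one, Finset.mul_sum]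
  exact Finset.sum_congr rfl fun n _ => convAt_const_mul _ _ _ _

/-- The scaled weights as a ratio of distribution functions of normalised messages, in which the
activity may tend to infinity. -/
theorem scaled_wUpdate_normalize {lam : ℝ} (hl : 0 < lam) {W : N.graph.Dart → ℕ → ℝ}
    (h : N.IsWeight W) (e : N.graph.Dart) {x : ℕ} (hc : x ≤ N.cap e) (hb : x ≤ N.b e.fst) :
    scaled lam (N.wUpdate lam W) e x
      = N.cum (N.normalize W) e (N.b e.fst - x) / N.cum (N.normalize W) e (N.b e.fst) := by
  have h1 : (∏ d ∈ N.preDarts e, (∑ t ∈ Finset.range (N.cap d + 1), W d t)⁻¹) ≠ 0 :=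
    Finset.prod_ne_zero_iff.2 fun d _ => inv_ne_zero (by linarith [h.one_le_sum d])
  rw [scaled_wUpdate hl, cum_normalize, cum_normalize, mul_div_mul_left _ _ h1]
  simp only [hc, hb, if_true, revSeq]
  rw [inv_mul_eq_div]

/-- When the total of the smallest charged values exceeds `b`, the convolution of the messages
grows arbitrarily fast up to `b`. -/
theorem exists_ratio (S : Finset N.graph.Dart) {b : ℕ} (hb : b < ∑ d ∈ S, N.aInf d) :
    ∃ ε : ℝ → ℝ, Tendsto ε atTop (𝓝 0) ∧ ∀ᶠ lam in atTop, 0 ≤ ε lam ∧ ∀ n < b,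
      convAt S (N.normalize (N.wLow lam)) n ≤ ε lam * convAt S (N.normalize (N.wLow lam)) (n + 1) := by
  set A := ∑ d ∈ S, N.aInf d
  have hA : Tendsto (fun lam => convAt S (N.normalize (N.wLow lam)) A) atTop
    (𝓝 (convAt S N.msgInf A)) := tendsto_convAt (fun d _ x => tendsto_msgInf d x) A
  have hA1 : Tendsto (fun lam => convAt S (N.normalize (N.wLow lam)) (A - 1)) atTop
    (𝓝 (convAt S N.msgInf (A - 1))) := tendsto_convAt (fun d _ x => tendsto_msgInf d x) (A - 1)
  have hpos : 0 < convAt S N.msgInf A :=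
    convAt_pos (fun d _ => msgInf_nonneg d) fun d _ => msgInf_aInf_pos d
  have h0 : convAt S N.msgInf (A - 1) = 0 :=
    convAt_eq_zero_of_lt (fun d _ => msgInf_nonneg d) (fun d _ x hx => msgInf_of_lt_aInf hx)
      (show A - 1 < A by omega)
  refine ⟨fun lam => convAt S (N.normalize (N.wLow lam)) (A - 1) /
    convAt S (N.normalize (N.wLow lam)) A, ?_, ?_⟩
  · have := hA1.div hA hpos.ne'
    rwa [h0, zero_div] at this
  · filter_upwards [eventually_gt_atTop 0, hA.eventually (lt_mem_nhds hpos)] with lam hl hp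
    have pf : PF2 (convAt S (N.normalize (N.wLow lam))) :=
      PF2.convAt fun d _ => pf2_normalize (isWeight_wLow hl) (pf2_wLow hl) d
    refine ⟨div_nonneg (pf.nonneg _) hp.le, fun n hn => ?_⟩
    rw [div_mul_eq_mul_div, le_div_iff₀ hp]
    have := pf.le (x := n) (y := A - 1) 1 (by omega)
    rw [show A - 1 + 1 = A by omega] at this
    linarith

theorem tendsto_cum_msgInf (e : N.graph.Dart) (k : ℕ) :
    Tendsto (fun lam => N.cum (N.normalize (N.wLow lam)) e k) atTop (𝓝 (N.cum N.msgInf e k)) :=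
  tendsto_cum tendsto_msgInf e k

theorem cum_msgInf_pos {e : N.graph.Dart} {k : ℕ} (h : ∑ d ∈ N.preDarts e, N.aInf d ≤ k) :
    0 < N.cum N.msgInf e k := by
  unfold cum
  rw [seqConv_one]
  exact Finset.sum_pos' (fun n _ => convAt_nonneg (fun d _ => msgInf_nonneg d) n)
    ⟨_, Finset.mem_range.2 (Nat.lt_succ_of_le h), convAt_pos (fun d _ => msgInf_nonneg d)
      fun d _ => msgInf_aInf_pos d⟩

theorem cum_msgInf_eq_zero {e : N.graph.Dart} {k : ℕ} (h : k < ∑ d ∈ N.preDarts e, N.aInf d) :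
    N.cum N.msgInf e k = 0 := by
  unfold cum
  rw [seqConv_one]
  refine Finset.sum_eq_zero fun n hn => ?_
  rw [Finset.mem_range] at hn
  exact convAt_eq_zero_of_lt (fun d _ => msgInf_nonneg d) (fun d _ x hx => msgInf_of_lt_aInf hx)
    (show n < _ by omega)

/-- The limiting scaled weights on `e` charge exactly the values up to `gInf e`. -/
theorem Regular.scInf_pos (hN : N.Regular) {e : N.graph.Dart} {x : ℕ} (hx : x ≤ N.gInf e) :
    0 < N.scInf e x := by
  rcases Nat.eq_zero_or_pos x with rfl | hx0
  · rw [scInf_zero]; exact one_pos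
  unfold gInf capUpdate at hx
  rw [le_min_iff] at hx
  have hs : ∑ d ∈ N.preDarts e, N.aInf d ≤ N.b e.fst - x := by omega
  have lim := (tendsto_cum_msgInf e (N.b e.fst - x)).div (tendsto_cum_msgInf e (N.b e.fst))
    (cum_msgInf_pos (hs.trans (Nat.sub_le _ _))).ne'
  have e1 : N.scInf e x = N.cum N.msgInf e (N.b e.fst - x) / N.cum N.msgInf e (N.b e.fst) := by
    refine tendsto_nhds_unique (tendsto_scInf e x) (lim.congr' ?_)
    filter_upwards [eventually_gt_atTop 0] with lam hl
    have := scaled_wUpdate_normalize hl (isWeight_wLow hl) e hx.1 (show x ≤ N.b e.fst by omega)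
    rw [hN.wUpdate_eq hl] at this
    exact this.symm
  rw [e1]
  exact div_pos (cum_msgInf_pos hs) (cum_msgInf_pos (hs.trans (Nat.sub_le _ _)))

theorem Regular.scInf_eq_zero (hN : N.Regular) {e : N.graph.Dart} {x : ℕ} (hx : N.gInf e < x) :
    N.scInf e x = 0 := by
  rcases lt_or_ge (N.cap e) x with hc | hc
  · refine tendsto_nhds_unique (tendsto_scInf e x) (tendsto_const_nhds.congr' ?_)
    filter_upwards [eventually_gt_atTop 0] with lam hl
    rw [scaled, (isWeight_wLow hl).cap e x hc, zero_mul]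
  rcases lt_or_ge (N.b e.fst) x with hb | hb
  · refine tendsto_nhds_unique (tendsto_scInf e x) (tendsto_const_nhds.congr' ?_)
    filter_upwards [eventually_gt_atTop 0] with lam hl
    rw [scaled, ← hN.wUpdate_eq hl, wUpdate_eq_zero hb, zero_mul]
  unfold gInf capUpdate at hx
  rw [min_lt_iff] at hx
  have hsx : N.b e.fst - x < ∑ d ∈ N.preDarts e, N.aInf d := by omega
  have e0 : ∀ lam : ℝ, 0 < lam → scaled lam (N.wLow lam) e x
      = N.cum (N.normalize (N.wLow lam)) e (N.b e.fst - x)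
        / N.cum (N.normalize (N.wLow lam)) e (N.b e.fst) := fun lam hl => by
    have := scaled_wUpdate_normalize hl (isWeight_wLow hl) e hc hb
    rwa [hN.wUpdate_eq hl] at this
  rcases le_or_gt (∑ d ∈ N.preDarts e, N.aInf d) (N.b e.fst) with hs | hs
  · have lim := (tendsto_cum_msgInf e (N.b e.fst - x)).div (tendsto_cum_msgInf e (N.b e.fst))
      (cum_msgInf_pos hs).ne'
    rw [cum_msgInf_eq_zero hsx, zero_div] at lim
    refine tendsto_nhds_unique (tendsto_scInf e x) (lim.congr' ?_)
    filter_upwards [eventually_gt_atTop 0] with lam hl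
    exact (e0 lam hl).symm
  · -- here numerator and denominator both tend to `0`, and log-concavity bounds their ratio
    obtain ⟨ε, hε, hε'⟩ := exists_ratio (N.preDarts e) hs
    refine le_antisymm ?_ (scInf_nonneg e x)
    refine le_of_tendsto_of_tendsto (tendsto_scInf e x) hε ?_
    filter_upwards [eventually_gt_atTop 0, hε'] with lam hl h2
    have hw := isWeight_wLow (N := N) hl
    have hx0 : 0 < x := by omega
    have nn := fun n => convAt_nonneg (S := N.preDarts e) (fun d _ => normalize_nonneg hw d) n
    rw [e0 lam hl]
    have hpos : 0 < N.cum (N.normalize (N.wLow lam)) e (N.b e.fst) := by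
      rw [cum_normalize]
      refine mul_pos (Finset.prod_pos fun d _ => inv_pos.2 (by linarith [hw.one_le_sum d])) ?_
      linarith [one_le_cum hw e (N.b e.fst)]
    rw [div_le_iff₀ hpos]
    refine (cum_mono (fun d => normalize_nonneg hw d) e
      (show N.b e.fst - x ≤ N.b e.fst - 1 by omega)).trans ?_
    unfold cum
    rw [seqConv_one, seqConv_one, show N.b e.fst - 1 + 1 = N.b e.fst by omega,
      Finset.sum_range_succ', mul_add, Finset.mul_sum]
    have := Finset.sum_le_sum fun n hn => h2.2 n (Finset.mem_range.1 hn)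
    linarith [mul_nonneg h2.1 (nn 0)]

/-- In the limit the geometric factor in `geomCum` becomes a point mass at `0`. -/
theorem tendsto_geomCum (e : N.graph.Dart) (k : ℕ) :
    Tendsto (fun lam => geomCum lam (N.wLow lam) e k) atTop
      (𝓝 (convAt (N.preDarts e) N.scInf k)) := by
  have h1 : seqConv (convAt (N.preDarts e) N.scInf) (fun n => (0 : ℝ) ^ n) k
      = convAt (N.preDarts e) N.scInf k := by
    unfold seqConv
    rw [Finset.sum_eq_single (k, 0)]
    · simp
    · rintro ⟨i, j⟩ hij hne
      rw [Finset.HasAntidiagonal.mem_antidiagonal] at hij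
      have : j ≠ 0 := by rintro rfl; exact hne (by ext <;> simp_all)
      simp [this]
    · intro h; exact absurd (Finset.HasAntidiagonal.mem_antidiagonal.2 (by simp)) h
  rw [← h1]
  exact tendsto_seqConv (fun n => tendsto_convAt (fun d _ x => tendsto_scInf d x) n)
    (fun n => tendsto_inv_atTop_zero.pow n) k

/-- The limiting messages form a fixed point of the iterated capacity operator. -/
theorem Regular.capUpdate_gInf (hN : N.Regular) : N.capUpdate N.gInf = N.aInf := by
  ext e
  set g := N.capUpdate N.gInf e with hg
  set Γ := ∑ d ∈ N.preDarts e, N.gInf d with hΓ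
  have hgdef : g = min (N.cap e) (N.b e.fst - Γ) := rfl
  have Cpos : ∀ j ≤ Γ, 0 < convAt (N.preDarts e) N.scInf j := fun j hj =>
    (PF2.convAt fun d _ => pf2_scInf d).pos_of_le
      (convAt_zero_pos fun d _ => by rw [scInf_zero]; exact one_pos)
      (convAt_pos (fun d _ => scInf_nonneg d) fun d _ => hN.scInf_pos le_rfl) hj
  have Czero : ∀ j, Γ < j → convAt (N.preDarts e) N.scInf j = 0 := fun j hj =>
    convAt_eq_zero_of_gt (fun d _ => scInf_nonneg d) (fun d _ x hx => hN.scInf_eq_zero hx) hj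
  -- up to a constant, the message on `e` is the sequence `geomCum` read backwards from `b`
  have form : ∀ lam : ℝ, 0 < lam → ∃ K : ℝ, 0 ≤ K ∧ ∀ x ≤ N.cap e, x ≤ N.b e.fst →
      N.normalize (N.wLow lam) e x = K * geomCum lam (N.wLow lam) e (N.b e.fst - x) := by
    intro lam hl
    have hw := isWeight_wLow (N := N) hl
    refine ⟨(∑ t ∈ Finset.range (N.cap e + 1), N.wLow lam e t)⁻¹ *
      ((N.cum (N.wLow lam) e (N.b e.fst))⁻¹ * lam ^ N.b e.fst), ?_, fun x hc hb => ?_⟩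
    · have h1 := hw.one_le_sum e
      have h2 := one_le_cum hw e (N.b e.fst)
      positivity
    · rw [normalize, mul_assoc]
      congr 1
      have := congrFun (wUpdate_eq_geom hl (N.wLow lam) e) x
      rw [hN.wUpdate_eq hl] at this
      rw [this]
      simp [revSeq, hc, hb]
  -- values below `g` get no mass: by log-concavity the mass of `x` is at most the ratio of
  -- `geomCum` at `Γ + 1` and at `Γ`, which tends to `0`
  have low : ∀ x < g, N.msgInf e x = 0 := by
    intro x hx
    rw [hgdef, lt_min_iff] at hx
    have key : ∀ᶠ lam : ℝ in atTop, N.normalize (N.wLow lam) e x * geomCum lam (N.wLow lam) e Γ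
        ≤ geomCum lam (N.wLow lam) e (Γ + 1) := by
      filter_upwards [eventually_gt_atTop 0] with lam hl
      have hw := isWeight_wLow (N := N) hl
      obtain ⟨K, hK, hK'⟩ := form lam hl
      have pf := pf2_geomCum hl (pf2_wLow hl) e
      have h1 := pf.le (x := Γ) (y := N.b e.fst - (x + 1)) 1 (by omega)
      rw [show N.b e.fst - (x + 1) + 1 = N.b e.fst - x by omega] at h1
      have h2 := hK' (x + 1) (by omega) (by omega)
      have h3 := normalize_le_one hw e (x + 1)
      rw [hK' x (by omega) (by omega)]
      rw [h2] at h3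
      calc K * geomCum lam (N.wLow lam) e (N.b e.fst - x) * geomCum lam (N.wLow lam) e Γ
          ≤ (K * geomCum lam (N.wLow lam) e (N.b e.fst - (x + 1)))
            * geomCum lam (N.wLow lam) e (Γ + 1) := by
              have := mul_le_mul_of_nonneg_left h1 hK
              linarith
        _ ≤ 1 * geomCum lam (N.wLow lam) e (Γ + 1) :=
              mul_le_mul_of_nonneg_right h3 (pf.nonneg _)
        _ = _ := one_mul _
    have := le_of_tendsto_of_tendsto ((tendsto_msgInf e x).mul (tendsto_geomCum e Γ))
      (tendsto_geomCum e (Γ + 1)) key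
    rw [Czero _ (Nat.lt_succ_self _)] at this
    have h1 := Cpos Γ le_rfl
    nlinarith [msgInf_nonneg e x]
  refine le_antisymm ?_ ?_
  · by_contra h
    exact (msgInf_aInf_pos e).ne' (low _ (not_le.1 h))
  · by_contra h
    rw [not_le] at h
    set a := N.aInf e with ha
    have hac : a ≤ N.cap e := aInf_le_cap e
    -- otherwise `g` is below the support; but the ratio of the masses of `g` and of `a` is the ratio
    -- of two values of `geomCum`, the first of which stays positive since `b - g ≤ Γ`
    have hbg : N.b e.fst - g ≤ Γ := by omega
    have hab : a ≤ N.b e.fst := by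
      by_contra hab
      have : N.msgInf e a = 0 := by
        refine tendsto_nhds_unique (tendsto_msgInf e a) (tendsto_const_nhds.congr' ?_)
        filter_upwards [eventually_gt_atTop 0] with lam hl
        rw [normalize, ← hN.wUpdate_eq hl, wUpdate_eq_zero (not_le.1 hab), mul_zero]
      exact (msgInf_aInf_pos e).ne' this
    have key : ∀ᶠ lam : ℝ in atTop, N.normalize (N.wLow lam) e g
        * geomCum lam (N.wLow lam) e (N.b e.fst - a)
        = N.normalize (N.wLow lam) e a * geomCum lam (N.wLow lam) e (N.b e.fst - g) := by
      filter_upwards [eventually_gt_atTop 0] with lam hl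
      obtain ⟨K, hK, hK'⟩ := form lam hl
      rw [hK' g (by omega) (by omega), hK' a (by omega) (by omega)]
      ring
    have := tendsto_nhds_unique_of_eventuallyEq
      ((tendsto_msgInf e g).mul (tendsto_geomCum e (N.b e.fst - a)))
      ((tendsto_msgInf e a).mul (tendsto_geomCum e (N.b e.fst - g))) key
    rw [msgInf_of_lt_aInf h, zero_mul] at this
    exact (mul_pos (msgInf_aInf_pos e) (Cpos _ hbg)).ne this

end Network
end

noncomputable section

namespace Network

variable {X Y : Type*} {N : Network X Y}

/-! ### Limits of the occupancies -/

theorem wOcc_normalize (W : N.graph.Dart → ℕ → ℝ) (h : N.IsWeight W) (v : N.V) :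
    N.wOcc (N.normalize W) v = N.wOcc W v := by
  have e1 : ∀ n, convAt (N.inDarts v) (N.normalize W) n
      = (∏ d ∈ N.inDarts v, (∑ t ∈ Finset.range (N.cap d + 1), W d t)⁻¹)
        * convAt (N.inDarts v) W n := convAt_const_mul _ _ _
  have hc : (∏ d ∈ N.inDarts v, (∑ t ∈ Finset.range (N.cap d + 1), W d t)⁻¹) ≠ 0 :=
    Finset.prod_ne_zero_iff.2 fun d _ => inv_ne_zero (by linarith [h.one_le_sum d])
  unfold wOcc
  simp only [e1, mul_assoc, ← Finset.mul_sum]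
  rw [mul_div_mul_left _ _ hc]

/-- If the convolution grows by a factor tending to infinity at every step up to `b`, the occupancy
tends to `b`. -/
theorem tendsto_wOcc_of_ratio {W : ℝ → N.graph.Dart → ℕ → ℝ} {v : N.V}
    (hW : ∀ᶠ lam in atTop, N.IsWeight (W lam))
    (h : ∃ ε : ℝ → ℝ, Tendsto ε atTop (𝓝 0) ∧ ∀ᶠ lam in atTop, 0 ≤ ε lam ∧ ∀ n < N.b v,
      convAt (N.inDarts v) (W lam) n ≤ ε lam * convAt (N.inDarts v) (W lam) (n + 1)) :
    Tendsto (fun lam => N.wOcc (W lam) v) atTop (𝓝 (N.b v)) := by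
  obtain ⟨ε, hε, hε'⟩ := h
  have lim : Tendsto (fun lam => (N.b v : ℝ) - N.b v * ε lam) atTop (𝓝 (N.b v)) := by
    simpa using (tendsto_const_nhds (x := (N.b v : ℝ))).sub (hε.const_mul (N.b v : ℝ))
  refine tendsto_of_tendsto_of_tendsto_of_le_of_le' lim tendsto_const_nhds ?_ ?_
  · filter_upwards [hW, hε'] with lam h1 h2
    have := sub_mean_le (convAt_nonneg (S := N.inDarts v) fun d _ => h1.nonneg d) h2.2
      (by linarith [sum_convAt_pos h1 v (N.b v)]) h2.1
    unfold wOcc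
    linarith
  · filter_upwards [hW] with lam h1
    exact wOcc_le h1 v

/-- The occupancies converge to those of the limiting messages, including the convention
`D_v = b_v` when these leave no admissible configuration: the mean then concentrates at `b_v`. -/
theorem tendsto_wOcc_msgInf (v : N.V) :
    Tendsto (fun lam => N.wOcc (N.wLow lam) v) atTop (𝓝 (N.occupancy N.msgInf v)) := by
  unfold occupancy
  split_ifs with h
  · have lim := fun n => tendsto_convAt (S := N.inDarts v) (m := fun lam : ℝ => N.normalize (N.wLow lam))
      (l := atTop) (fun d _ x => tendsto_msgInf d x) n
    have hpos : 0 < ∑ n ∈ Finset.range (N.b v + 1), convAt (N.inDarts v) N.msgInf n :=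
      Finset.sum_pos' (fun n _ => convAt_nonneg (fun d _ => msgInf_nonneg d) n)
        ⟨_, Finset.mem_range.2 (Nat.lt_succ_of_le h), convAt_pos (fun d _ => msgInf_nonneg d)
          fun d _ => msgInf_aInf_pos d⟩
    have := (tendsto_finsetSum (Finset.range (N.b v + 1)) fun n _ =>
      (lim n).const_mul (n : ℝ)).div (tendsto_finsetSum _ fun n _ => lim n) hpos.ne'
    refine this.congr' ?_
    filter_upwards [eventually_gt_atTop 0] with lam hl
    rw [← wOcc_normalize _ (isWeight_wLow hl)]
    simp only [wOcc, Pi.div_apply, mul_comm]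
  · obtain ⟨ε, hε, hε'⟩ := exists_ratio (N.inDarts v) (not_le.1 h)
    refine tendsto_wOcc_of_ratio ?_ ⟨ε, hε, ?_⟩
    · filter_upwards [eventually_gt_atTop 0] with lam hl using isWeight_wLow hl
    · filter_upwards [hε', eventually_gt_atTop 0] with lam h2 hl
      refine ⟨h2.1, fun n hn => ?_⟩
      have := h2.2 n hn
      have hc : 0 < (∏ d ∈ N.inDarts v, (∑ t ∈ Finset.range (N.cap d + 1), N.wLow lam d t)⁻¹) :=
        Finset.prod_pos fun d _ => inv_pos.2 (by linarith [(isWeight_wLow hl).one_le_sum d])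
      rw [show N.normalize (N.wLow lam) = fun d x => (∑ t ∈ Finset.range (N.cap d + 1),
        N.wLow lam d t)⁻¹ * N.wLow lam d x from rfl, convAt_const_mul, convAt_const_mul,
        mul_left_comm] at this
      exact le_of_mul_le_mul_left this hc

/-- If the smallest charged values already exhaust the capacity, the vertex is saturated. -/
theorem occupancy_msgInf_eq {v : N.V} (h : N.b v ≤ ∑ d ∈ N.inDarts v, N.aInf d) :
    N.occupancy N.msgInf v = N.b v := by
  unfold occupancy
  split_ifs with h1
  · have he : ∑ d ∈ N.inDarts v, N.aInf d = N.b v := le_antisymm h1 h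
    have hz : ∀ n < N.b v, convAt (N.inDarts v) N.msgInf n = 0 := fun n hn =>
      convAt_eq_zero_of_lt (fun d _ => msgInf_nonneg d) (fun d _ x hx => msgInf_of_lt_aInf hx)
        (by omega)
    have hpos : 0 < convAt (N.inDarts v) N.msgInf (N.b v) := by
      rw [← he]
      exact convAt_pos (fun d _ => msgInf_nonneg d) fun d _ => msgInf_aInf_pos d
    rw [Finset.sum_range_succ, Finset.sum_range_succ, Finset.sum_eq_zero, Finset.sum_eq_zero]
    · rw [zero_add, zero_add, mul_div_assoc, div_self hpos.ne', mul_one]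
    · intro n hn; exact hz n (Finset.mem_range.1 hn)
    · intro n hn; rw [hz n (Finset.mem_range.1 hn), mul_zero]
  · rfl

/-- If the supports of the limiting scaled weights reach beyond `b_v`, the factor `λ ^ n` favours the
largest admissible value and the vertex fills up. -/
theorem Regular.tendsto_wOcc_of_lt (hN : N.Regular) {v : N.V}
    (h : N.b v < ∑ d ∈ N.inDarts v, N.gInf d) :
    Tendsto (fun lam => N.wOcc (N.wLow lam) v) atTop (𝓝 (N.b v)) := by
  rcases Nat.eq_zero_or_pos (N.b v) with h0 | h0
  · refine tendsto_const_nhds.congr' ?_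
    filter_upwards [eventually_gt_atTop 0] with lam hl
    refine le_antisymm ?_ (wOcc_le (isWeight_wLow hl) v)
    rw [h0, Nat.cast_zero]; exact wOcc_nonneg (isWeight_wLow hl) v
  set b := N.b v
  have hC := fun n => tendsto_convAt (S := N.inDarts v) (m := fun lam : ℝ => scaled lam (N.wLow lam))
      (l := atTop) (fun d _ x => tendsto_scInf d x) n
  have hpos : 0 < convAt (N.inDarts v) N.scInf b :=
    (PF2.convAt fun d _ => pf2_scInf d).pos_of_le
      (convAt_zero_pos fun d _ => by rw [scInf_zero]; exact one_pos)
      (convAt_pos (fun d _ => scInf_nonneg d) fun d _ => hN.scInf_pos le_rfl) h.le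
  refine tendsto_wOcc_of_ratio ?_ ⟨fun lam => lam⁻¹ *
    (convAt (N.inDarts v) (scaled lam (N.wLow lam)) (b - 1) /
      convAt (N.inDarts v) (scaled lam (N.wLow lam)) b), ?_, ?_⟩
  · filter_upwards [eventually_gt_atTop 0] with lam hl using isWeight_wLow hl
  · have := tendsto_inv_atTop_zero.mul ((hC (b - 1)).div (hC b) hpos.ne')
    rwa [zero_mul] at this
  · filter_upwards [eventually_gt_atTop 0, (hC b).eventually (lt_mem_nhds hpos)] with lam hl hp
    have pf : PF2 (convAt (N.inDarts v) (scaled lam (N.wLow lam))) :=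
      PF2.convAt fun d _ => pf2_scaled hl (pf2_wLow hl) d
    refine ⟨mul_nonneg (inv_nonneg.2 hl.le) (div_nonneg (pf.nonneg _) hp.le), fun n hn => ?_⟩
    have e : ∀ n, convAt (N.inDarts v) (N.wLow lam) n
        = convAt (N.inDarts v) (scaled lam (N.wLow lam)) n * lam ^ n := by
      intro n
      have h2 : convAt (N.inDarts v) (scaled lam (N.wLow lam)) n
        = convAt (N.inDarts v) (N.wLow lam) n * lam⁻¹ ^ n := convAt_mul_pow _ _ _ _
      rw [h2, mul_assoc, ← mul_pow, inv_mul_cancel₀ hl.ne', one_pow, mul_one]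
    have h1 := pf.le (x := n) (y := b - 1) 1 (by omega)
    rw [show b - 1 + 1 = b by omega] at h1
    rw [e n, e (n + 1), pow_succ]
    have e2 : lam⁻¹ * (convAt (N.inDarts v) (scaled lam (N.wLow lam)) (b - 1) /
      convAt (N.inDarts v) (scaled lam (N.wLow lam)) b) *
        (convAt (N.inDarts v) (scaled lam (N.wLow lam)) (n + 1) * (lam ^ n * lam))
        = (convAt (N.inDarts v) (scaled lam (N.wLow lam)) (n + 1) *
          convAt (N.inDarts v) (scaled lam (N.wLow lam)) (b - 1) /
      convAt (N.inDarts v) (scaled lam (N.wLow lam)) b) * lam ^ n := by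
      field_simp
    rw [e2]
    refine mul_le_mul_of_nonneg_right ?_ (by positivity)
    rwa [le_div_iff₀ hp]

/-- The mean occupancy of an edge converges as soon as the supports of the two limits meet. -/
theorem tendsto_edgeMean {d : N.graph.Dart} {a : ℕ} (h1 : 0 < N.msgInf d a)
    (h2 : 0 < N.scInf d.symm a) :
    Tendsto (fun lam => N.edgeMean lam (N.wLow lam) (N.wLow lam) d) atTop
      (𝓝 ((∑ x ∈ Finset.range (N.cap d + 1), N.msgInf d x * N.scInf d.symm x * x) /
        ∑ x ∈ Finset.range (N.cap d + 1), N.msgInf d x * N.scInf d.symm x)) := by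
  have ha : a ≤ N.cap d := by
    by_contra h
    exact h1.ne' (msgInf_eq_zero (not_le.1 h))
  have hpos : 0 < ∑ x ∈ Finset.range (N.cap d + 1), N.msgInf d x * N.scInf d.symm x :=
    Finset.sum_pos' (fun x _ => mul_nonneg (msgInf_nonneg _ _) (scInf_nonneg _ _))
      ⟨a, Finset.mem_range.2 (by omega), mul_pos h1 h2⟩
  have := (tendsto_finsetSum (Finset.range (N.cap d + 1)) fun x _ =>
    ((tendsto_msgInf d x).mul (tendsto_scInf d.symm x)).mul_const (x : ℝ)).div
    (tendsto_finsetSum (Finset.range (N.cap d + 1)) fun x _ =>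
      (tendsto_msgInf d x).mul (tendsto_scInf d.symm x)) hpos.ne'
  refine this.congr' ?_
  filter_upwards [eventually_gt_atTop 0] with lam hl
  have hs := (isWeight_wLow (N := N) hl).one_le_sum d
  simp only [Pi.div_apply, normalize, scaled, mul_assoc, ← Finset.mul_sum, edgeMean]
  rw [mul_div_mul_left _ _ (by positivity)]

/-- An edge on which the limiting message is the point mass at the capacity fills up. -/
theorem Regular.tendsto_edgeMean_cap (hN : N.Regular) {d : N.graph.Dart} (h1 : N.aInf d = N.cap d)
    (h2 : N.gInf d.symm = N.cap d) :
    Tendsto (fun lam => N.edgeMean lam (N.wLow lam) (N.wLow lam) d) atTop (𝓝 (N.cap d)) := by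
  have p1 : 0 < N.msgInf d (N.cap d) := h1 ▸ msgInf_aInf_pos d
  have p2 : 0 < N.scInf d.symm (N.cap d) := hN.scInf_pos h2.ge
  have := tendsto_edgeMean p1 p2
  have hz : ∀ x ∈ Finset.range (N.cap d), N.msgInf d x = 0 := fun x hx =>
    msgInf_of_lt_aInf (by rw [h1]; exact Finset.mem_range.1 hx)
  rw [Finset.sum_range_succ, Finset.sum_range_succ, Finset.sum_eq_zero, Finset.sum_eq_zero, zero_add,
    zero_add, mul_div_right_comm, div_self (mul_pos p1 p2).ne', one_mul] at this
  · exact this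
  · intro x hx; rw [hz x hx, zero_mul]
  · intro x hx; rw [hz x hx, zero_mul, zero_mul]

/-- An edge on which the limiting scaled weight is the point mass at `0` empties. -/
theorem Regular.tendsto_edgeMean_zero (hN : N.Regular) {d : N.graph.Dart} (h1 : N.aInf d = 0)
    (h2 : N.gInf d.symm = 0) :
    Tendsto (fun lam => N.edgeMean lam (N.wLow lam) (N.wLow lam) d) atTop (𝓝 0) := by
  have p1 : 0 < N.msgInf d 0 := by
    have := msgInf_aInf_pos d
    rwa [h1] at this
  have p2 : 0 < N.scInf d.symm 0 := hN.scInf_pos h2.ge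
  have := tendsto_edgeMean p1 p2
  rw [Finset.sum_eq_zero, zero_div] at this
  · exact this
  · intro x _
    rcases Nat.eq_zero_or_pos x with rfl | hx
    · simp
    · rw [hN.scInf_eq_zero (by omega), mul_zero, zero_mul]

/-! ### Fixed points of the iterated capacity operator -/

theorem capUpdate_le_cap (a : N.graph.Dart → ℕ) (d : N.graph.Dart) : N.capUpdate a d ≤ N.cap d :=
  min_le_left _ _

theorem sum_preDarts_symm {v : N.V} {d : N.graph.Dart} (hd : d ∈ N.inDarts v)
    (a : N.graph.Dart → ℕ) : ∑ e ∈ N.preDarts d.symm, a e + a d = ∑ e ∈ N.inDarts v, a e := by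
  classical
  rw [preDarts_symm N hd, ← Finset.sum_erase_add _ _ hd]

theorem capUpdate_symm {v : N.V} {d : N.graph.Dart} (hd : d ∈ N.inDarts v) (a : N.graph.Dart → ℕ) :
    N.capUpdate a d.symm = min (N.cap d) (N.b v - (∑ e ∈ N.inDarts v, a e - a d)) := by
  have h1 := sum_preDarts_symm hd a
  have h2 : d.symm.fst = v := (mem_inDarts N).1 hd
  unfold capUpdate
  rw [cap_symm, h2, ← h1, Nat.add_sub_cancel]

variable (N) in
/-- The second term of the function `F`. -/
def slack (a : N.graph.Dart → ℕ) (v : N.V) : ℕ :=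
  if N.b v < ∑ d ∈ N.inDarts v, N.cap d then N.b v - ∑ d ∈ N.inDarts v, a d.symm else 0

variable (N) in
/-- The vertices whose incoming marks sum to less than their capacity. -/
def Unsat (a : N.graph.Dart → ℕ) (v : N.V) : Prop := ∑ d ∈ N.inDarts v, a d < N.b v

open Classical in
/-- Dichotomy at a vertex `v` for a fixed point of the iterated capacity operator, where `g` is
the image of `a`: either the edges towards unsaturated neighbours are filled and the slack is zero,
or the marks `g` towards `v` exceed its capacity and only the edges to unsaturated neighbours
carry marks. -/
theorem fixed_dichotomy {a g : N.graph.Dart → ℕ} (hg : g = N.capUpdate a) (ha : a = N.capUpdate g)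
    (v : N.V) :
    (N.slack a v = 0 ∧ ∀ d ∈ N.inDarts v, N.Unsat a d.fst → a d.symm = N.cap d ∧ g d = N.cap d) ∨
    (N.b v < ∑ d ∈ N.inDarts v, g d ∧
      (∀ d ∈ N.inDarts v, ¬ N.Unsat a d.fst → a d.symm = 0 ∧ g d = 0) ∧
      (∑ d ∈ N.inDarts v, if N.Unsat a d.fst then a d.symm else 0) + N.slack a v = N.b v) := by
  have hae : ∀ d ∈ N.inDarts v,
      a d.symm = min (N.cap d) (N.b v - (∑ e ∈ N.inDarts v, g e - g d)) := fun d hd => by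
    conv_lhs => rw [ha]
    exact capUpdate_symm hd g
  have hgd : ∀ d : N.graph.Dart,
      g d = min (N.cap d) (N.b d.fst - (∑ e ∈ N.inDarts d.fst, a e - a d.symm)) := fun d => by
    have h1 : d.symm ∈ N.inDarts d.fst := (mem_inDarts N).2 rfl
    have := capUpdate_symm h1 a
    rw [SimpleGraph.Dart.symm_symm, cap_symm] at this
    rw [← this, hg]
  have hle : ∀ d ∈ N.inDarts v, g d ≤ ∑ e ∈ N.inDarts v, g e := fun d hd =>
    Finset.single_le_sum (f := g) (fun _ _ => Nat.zero_le _) hd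
  have hale : ∀ d : N.graph.Dart, a d.symm ≤ ∑ e ∈ N.inDarts d.fst, a e := fun d =>
    Finset.single_le_sum (f := a) (fun _ _ => Nat.zero_le _) ((mem_inDarts N).2 rfl)
  have hgc : ∀ d : N.graph.Dart, g d ≤ N.cap d := fun d => by rw [hg]; exact capUpdate_le_cap a d
  have hok : ∀ d : N.graph.Dart, N.Unsat a d.fst → min (N.cap d) (a d.symm + 1) ≤ g d := by
    intro d hd
    have h1 := hgd d
    have h2 := hale d
    unfold Unsat at hd
    omega
  -- the constraint at `v` is void, and every outgoing mark equals the capacity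
  by_cases hc : ∑ d ∈ N.inDarts v, N.cap d ≤ N.b v
  · left
    refine ⟨by simp [slack, not_lt.2 hc], fun d hd hu => ?_⟩
    have h1 : ∑ e ∈ N.preDarts d.symm, g e + N.cap d ≤ ∑ e ∈ N.inDarts v, N.cap e := by
      rw [← sum_preDarts_symm hd]
      exact Nat.add_le_add_right (Finset.sum_le_sum fun e _ => hgc e) _
    have h2 := sum_preDarts_symm hd g
    have h3 := hae d hd
    have h4 := hok d hu
    have h5 := hgc d
    omega
  rw [not_le] at hc
  -- if `g` leaves room at `v`, the outgoing marks add up to at least `b v`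
  by_cases hG : ∑ d ∈ N.inDarts v, g d ≤ N.b v
  · left
    constructor
    · have : N.b v ≤ ∑ d ∈ N.inDarts v, a d.symm := by
        by_cases hall : ∀ d ∈ N.inDarts v, a d.symm = N.cap d
        · rw [Finset.sum_congr rfl hall]; exact hc.le
        · push Not at hall
          obtain ⟨d, hd, hne⟩ := hall
          have h1 := hae d hd
          have h2 := hle d hd
          rw [← Finset.sum_erase_add _ _ hd] at hG ⊢
          have h3 : ∑ e ∈ (N.inDarts v).erase d, g e ≤ ∑ e ∈ (N.inDarts v).erase d, a e.symm := by
            refine Finset.sum_le_sum fun e he => ?_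
            have he' := Finset.mem_of_mem_erase he
            have h4 := hae e he'
            have h5 := hle e he'
            have h6 := hgc e
            rw [← Finset.sum_erase_add _ _ hd] at h4 h5
            omega
          rw [← Finset.sum_erase_add _ _ hd] at h1 h2
          omega
      simp only [slack, hc, if_true]
      omega
    · intro d hd hu
      have h1 := hae d hd
      have h2 := hok d hu
      have h3 := hgc d
      have h4 := hle d hd
      omega
  · -- if `g` exceeds `b v`, the marks on the edges to saturated neighbours vanish, and the slack is
    -- what the other outgoing marks leave of `b v`
    right
    rw [not_le] at hG
    have hz : ∀ d ∈ N.inDarts v, ¬ N.Unsat a d.fst → a d.symm = 0 ∧ g d = 0 := by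
      intro d hd hu
      have h1 := hae d hd
      have h2 := hgd d
      have h3 := hle d hd
      have h4 := hale d
      unfold Unsat at hu
      omega
    refine ⟨hG, hz, ?_⟩
    have e1 : (∑ d ∈ N.inDarts v, if N.Unsat a d.fst then a d.symm else 0)
        = ∑ d ∈ N.inDarts v, a d.symm := by
      refine Finset.sum_congr rfl fun d hd => ?_
      split_ifs with h
      · rfl
      · exact (hz d hd h).1.symm
    have e2 : ∑ d ∈ N.inDarts v, a d.symm ≤ N.b v := by
      by_cases hall : ∀ d ∈ N.inDarts v, a d.symm = 0
      · rw [Finset.sum_eq_zero hall]; exact Nat.zero_le _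
      · push Not at hall
        obtain ⟨d, hd, hne⟩ := hall
        have h1 := hae d hd
        have h2 := hle d hd
        rw [← Finset.sum_erase_add _ _ hd] at hG ⊢
        have h3 : ∑ e ∈ (N.inDarts v).erase d, a e.symm ≤ ∑ e ∈ (N.inDarts v).erase d, g e := by
          refine Finset.sum_le_sum fun e he => ?_
          have he' := Finset.mem_of_mem_erase he
          have h4 := hae e he'
          have h5 := hle e he'
          rw [← Finset.sum_erase_add _ _ hd] at h4 h5
          omega
        rw [← Finset.sum_erase_add _ _ hd] at h1 h2
        omega
    rw [e1]
    simp only [slack, hc, if_true]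
    omega

open Classical in
/-- Local form of weak duality: at every vertex, the fractional occupancies of the edges to
unsaturated neighbours are bounded by the marks on these edges plus the slack. -/
theorem sum_unsat_le {a : N.graph.Dart → ℕ} (ha : N.capUpdate (N.capUpdate a) = a) (v : N.V)
    {x : N.graph.Dart → ℝ} (hx0 : ∀ d ∈ N.inDarts v, 0 ≤ x d) (hxc : ∀ d ∈ N.inDarts v, x d ≤ N.cap d)
    (hxb : ∑ d ∈ N.inDarts v, x d ≤ N.b v) :
    (∑ d ∈ N.inDarts v, if N.Unsat a d.fst then x d else 0)
      ≤ (∑ d ∈ N.inDarts v, if N.Unsat a d.fst then (a d.symm : ℝ) else 0) + N.slack a v := by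
  rcases fixed_dichotomy rfl ha.symm v with ⟨_, h2⟩ | ⟨_, _, h3⟩
  · refine (Finset.sum_le_sum fun d hd => ?_).trans (le_add_of_nonneg_right (Nat.cast_nonneg _))
    split_ifs with h
    · rw [(h2 d hd h).1]; exact hxc d hd
    · exact le_rfl
  · have h4 : (∑ d ∈ N.inDarts v, if N.Unsat a d.fst then (a d.symm : ℝ) else 0) + N.slack a v
        = N.b v := by
      rw [← h3]; push_cast; rfl
    rw [h4]
    refine (Finset.sum_le_sum fun d hd => ?_).trans hxb
    split_ifs
    · exact le_rfl
    · exact hx0 d hd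

open Classical in
/-- For the marks of the limiting messages the bound of `sum_unsat_le` is attained in the
limit. -/
theorem Regular.tendsto_sum_unsat (hN : N.Regular) (v : N.V) :
    Tendsto (fun lam => ∑ d ∈ N.inDarts v, if N.Unsat N.aInf d.fst then
        N.edgeMean lam (N.wLow lam) (N.wLow lam) d else 0) atTop
      (𝓝 ((∑ d ∈ N.inDarts v, if N.Unsat N.aInf d.fst then (N.aInf d.symm : ℝ) else 0)
        + N.slack N.aInf v)) := by
  have esymm : ∀ (lam : ℝ) (d : N.graph.Dart), N.edgeMean lam (N.wLow lam) (N.wLow lam) d.symm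
      = N.edgeMean lam (N.wLow lam) (N.wLow lam) d := fun lam d => edgeMean_symm _ _ _ _
  rcases fixed_dichotomy (N := N) (a := N.aInf) (g := N.gInf) rfl hN.capUpdate_gInf.symm v with
    ⟨h1, h2⟩ | ⟨h1, h2, h3⟩
  · rw [h1, Nat.cast_zero, add_zero]
    refine tendsto_finsetSum _ fun d hd => ?_
    split_ifs with h
    · obtain ⟨h3, h4⟩ := h2 d hd h
      have := hN.tendsto_edgeMean_cap (d := d.symm) (by rw [h3, cap_symm])
        (by rw [SimpleGraph.Dart.symm_symm, h4, cap_symm])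
      simp only [esymm, cap_symm] at this
      rwa [h3]
    · exact tendsto_const_nhds
  · have h4 : (∑ d ∈ N.inDarts v, if N.Unsat N.aInf d.fst then (N.aInf d.symm : ℝ) else 0)
        + N.slack N.aInf v = N.b v := by
      rw [← h3]; push_cast; rfl
    rw [h4]
    have l1 := hN.tendsto_wOcc_of_lt h1
    have l2 : Tendsto (fun lam => ∑ d ∈ N.inDarts v, if N.Unsat N.aInf d.fst then 0 else
        N.edgeMean lam (N.wLow lam) (N.wLow lam) d) atTop (𝓝 0) := by
      have l4 : ∀ d ∈ N.inDarts v, Tendsto (fun lam => if N.Unsat N.aInf d.fst then 0 else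
          N.edgeMean lam (N.wLow lam) (N.wLow lam) d) atTop (𝓝 (0 : ℝ)) := by
        intro d hd
        by_cases h : N.Unsat N.aInf d.fst
        · simp only [h, if_true]; exact tendsto_const_nhds
        · simp only [h, if_false]
          obtain ⟨h5, h6⟩ := h2 d hd h
          have := hN.tendsto_edgeMean_zero (d := d.symm) h5 (by rwa [SimpleGraph.Dart.symm_symm])
          simpa only [esymm] using this
      simpa using tendsto_finsetSum _ l4
    have l3 := l1.sub l2
    rw [sub_zero] at l3
    refine l3.congr' ?_
    filter_upwards [eventually_gt_atTop 0] with lam hl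
    rw [wOcc_eq_sum_edgeMean hl (isWeight_wLow hl), hN.wUpdate_eq hl, ← Finset.sum_sub_distrib]
    refine Finset.sum_congr rfl fun d _ => ?_
    split_ifs <;> simp

end Network
end

noncomputable section

/-! ### Local maps between networks -/

/-- A network with a distinguished vertex, not up to isomorphism. -/
abbrev VertexNetwork (X Y : Type*) := Σ N : Network X Y, N.V

/-- A network with a distinguished directed edge, not up to isomorphism. -/
abbrev DartNetwork (X Y : Type*) := Σ N : Network X Y, N.graph.Dart

namespace Network

variable {X Y : Type*} {N N' : Network X Y}

/-- The directed edge `d'` lies over the directed edge `d` under a map of the vertices. -/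
def DartRel (φ : N.V → N'.V) (d : N.graph.Dart) (d' : N'.graph.Dart) : Prop :=
  φ d.fst = d'.fst ∧ φ d.snd = d'.snd

theorem DartRel.symm {φ : N.V → N'.V} {d : N.graph.Dart} {d' : N'.graph.Dart} (h : DartRel φ d d') :
    DartRel φ d.symm d'.symm := ⟨h.2, h.1⟩

/-- A map between the vertices of two networks that is a local isomorphism at `v`, with marks on
the edges at `v` moved by less than `1`.  No global injectivity is required. -/
structure GoodAt [PseudoMetricSpace Y] (φ : N.V → N'.V) (v : N.V) : Prop where
  b : N'.b (φ v) = N.b v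
  bij : BijOn φ (N.graph.neighborSet v) (N'.graph.neighborSet (φ v))
  dart : ∀ (d : N.graph.Dart) (d' : N'.graph.Dart), d.fst = v → DartRel φ d d' →
    N'.cap d' = N.cap d ∧ dist (N.emark d) (N'.emark d') < 1 ∧
      dist (N.emark d.symm) (N'.emark d'.symm) < 1

theorem dist_le_succ_of_adj {u v w : N.V} {k : ℕ} (huv : N.graph.Adj u v)
    (h : N.graph.dist v w ≤ k) : N.graph.dist u w ≤ k + 1 := by
  have h1 := N.connected.dist_triangle (u := u) (v := v) (w := w)
  have h2 : N.graph.dist u v = 1 := SimpleGraph.dist_eq_one_iff_adj.2 huv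
  omega

variable [PseudoMetricSpace Y]

/-- A local isomorphism at `v` induces a bijection between the directed edges into `v` and those
into the image of `v`. -/
theorem GoodAt.exists_bij {φ : N.V → N'.V} {v : N.V} (h : GoodAt φ v) :
    ∃ i : ∀ d ∈ N.inDarts v, N'.graph.Dart,
      (∀ d hd, i d hd ∈ N'.inDarts (φ v) ∧ DartRel φ d (i d hd)) ∧
      (∀ d₁ h₁ d₂ h₂, i d₁ h₁ = i d₂ h₂ → d₁ = d₂) ∧
      ∀ d' ∈ N'.inDarts (φ v), ∃ d hd, i d hd = d' := by
  have adj : ∀ d ∈ N.inDarts v, N'.graph.Adj (φ d.fst) (φ v) := fun d hd => by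
    have h1 := (mem_inDarts N).1 hd
    subst h1
    exact (h.bij.mapsTo (show d.fst ∈ N.graph.neighborSet d.snd from d.adj.symm)).symm
  refine ⟨fun d hd => ⟨(φ d.fst, φ v), adj d hd⟩, fun d hd => ⟨(mem_inDarts N').2 rfl, rfl, ?_⟩,
    fun d₁ h₁ d₂ h₂ he => ?_, fun d' hd' => ?_⟩
  · exact congrArg φ ((mem_inDarts N).1 hd)
  · have e1 := (mem_inDarts N).1 h₁
    have e2 := (mem_inDarts N).1 h₂
    have h3 : φ d₁.fst = φ d₂.fst := congrArg (fun d : N'.graph.Dart => d.fst) he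
    have h4 : d₁.fst = d₂.fst := h.bij.injOn (e1 ▸ d₁.adj.symm) (e2 ▸ d₂.adj.symm) h3
    ext
    · exact h4
    · exact e1.trans e2.symm
  · have e1 := (mem_inDarts N').1 hd'
    obtain ⟨w, hw, hw'⟩ := h.bij.surjOn (show d'.fst ∈ N'.graph.neighborSet (φ v) from e1 ▸ d'.adj.symm)
    refine ⟨⟨(w, v), (show N.graph.Adj v w from hw).symm⟩, (mem_inDarts N).2 rfl, ?_⟩
    ext
    · exact hw'
    · exact e1.symm

theorem GoodAt.sum_inDarts {φ : N.V → N'.V} {v : N.V} (h : GoodAt φ v) {M : Type*} [AddCommMonoid M]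
    {f : N.graph.Dart → M} {f' : N'.graph.Dart → M}
    (hf : ∀ d d', d.snd = v → DartRel φ d d' → f d = f' d') :
    ∑ d ∈ N.inDarts v, f d = ∑ d ∈ N'.inDarts (φ v), f' d := by
  obtain ⟨i, h1, h2, h3⟩ := h.exists_bij
  exact Finset.sum_bij i (fun d hd => (h1 d hd).1) h2 h3
    fun d hd => hf d _ ((mem_inDarts N).1 hd) (h1 d hd).2

theorem GoodAt.convAt_preDarts {φ : N.V → N'.V} {e : N.graph.Dart} {e' : N'.graph.Dart}
    (h : GoodAt φ e.fst) (he : DartRel φ e e') {f : N.graph.Dart → ℕ → ℝ}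
    {f' : N'.graph.Dart → ℕ → ℝ} (hf : ∀ d d', d.snd = e.fst → DartRel φ d d' → f d = f' d') :
    convAt (N.preDarts e) f = convAt (N'.preDarts e') f' := by
  obtain ⟨i, h1, h2, h3⟩ := h.exists_bij
  have sub : ∀ d ∈ N.preDarts e, d ∈ N.inDarts e.fst := fun d hd =>
    (mem_inDarts N).2 ((mem_preDarts N).1 hd).1
  refine convAt_bij _ _ _ _ (fun d hd => i d (sub d hd)) (fun d hd => ?_)
    (fun d₁ h₁ d₂ h₂ h => h2 _ _ _ _ h) (fun d' hd' => ?_)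
    fun d hd => hf d _ ((mem_preDarts N).1 hd).1 (h1 d _).2
  · obtain ⟨m1, m2⟩ := h1 d (sub d hd)
    rw [mem_preDarts]
    refine ⟨((mem_inDarts N').1 m1).trans he.1, fun h4 => ((mem_preDarts N).1 hd).2 ?_⟩
    have h5 : φ d.fst = φ e.snd := by rw [m2.1, h4, he.2]; rfl
    have e1 : d.snd = e.fst := ((mem_preDarts N).1 hd).1
    have h6 : d.fst = e.snd := h.bij.injOn (e1 ▸ d.adj.symm) e.adj h5
    ext
    · exact h6
    · exact e1
  · rw [mem_preDarts] at hd'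
    obtain ⟨d, hd, hd2⟩ := h3 d' ((mem_inDarts N').2 (hd'.1.trans he.1.symm))
    refine ⟨d, (mem_preDarts N).2 ⟨(mem_inDarts N).1 hd, ?_⟩, hd2⟩
    rintro rfl
    refine hd'.2 ?_
    have := (h1 _ hd).2
    rw [hd2] at this
    ext
    · exact this.1.symm.trans he.2
    · exact this.2.symm.trans he.1

/-- The `k`-th iterate of the update on a directed edge is determined by the ball of radius `k`
around its tail. -/
theorem wIter_eq_of_good (lam : ℝ) {φ : N.V → N'.V} (k : ℕ) {e : N.graph.Dart} {e' : N'.graph.Dart}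
    (he : DartRel φ e e') (h : ∀ v, N.graph.dist e.fst v ≤ k → GoodAt φ v) :
    N.wIter lam k e = N'.wIter lam k e' := by
  induction k generalizing e e' with
  | zero => rfl
  | succ k ih =>
    have h0 : GoodAt φ e.fst := h _ (by simp)
    have hc : convAt (N.preDarts e) (N.wIter lam k) = convAt (N'.preDarts e') (N'.wIter lam k) := by
      refine h0.convAt_preDarts he fun d d' hd hdd => ih hdd fun v hv => h v ?_
      exact dist_le_succ_of_adj (hd ▸ d.adj.symm) hv
    have hcap := (h0.dart e e' rfl he).1
    have hb := h0.b
    rw [he.1] at hb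
    ext x
    rw [wIter, wIter]
    simp only [wUpdate, bpWeight, hc, hcap, hb]

end Network

open Network

variable {X Y : Type*} [PseudoMetricSpace Y]

/-- Sets of networks with a distinguished vertex that are determined by a ball around it. -/
def IsLocalVertexSet (E : Set (VertexNetwork X Y)) : Prop :=
  ∃ k : ℕ, ∀ (P Q : VertexNetwork X Y) (φ : P.1.V → Q.1.V), φ P.2 = Q.2 →
    (∀ v, P.1.graph.dist P.2 v ≤ k → GoodAt φ v) → (P ∈ E ↔ Q ∈ E)

/-- Sets of networks with a distinguished directed edge that are determined by a ball around
it. -/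
def IsLocalDartSet (E : Set (DartNetwork X Y)) : Prop :=
  ∃ k : ℕ, ∀ (P Q : DartNetwork X Y) (φ : P.1.V → Q.1.V), DartRel φ P.2 Q.2 →
    (∀ v, P.1.graph.dist P.2.fst v ≤ k ∨ P.1.graph.dist P.2.snd v ≤ k → GoodAt φ v) →
      (P ∈ E ↔ Q ∈ E)

/-- The σ-algebra generated by the local sets. -/
instance VertexNetwork.measurableSpace : MeasurableSpace (VertexNetwork X Y) :=
  MeasurableSpace.generateFrom {E | IsLocalVertexSet E}

/-- The σ-algebra generated by the local sets. -/
instance DartNetwork.measurableSpace : MeasurableSpace (DartNetwork X Y) :=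
  MeasurableSpace.generateFrom {E | IsLocalDartSet E}

/-! ### Measurability of local functions -/

theorem measurable_vertex_of_local {Z : Type*} [MeasurableSpace Z] {f : VertexNetwork X Y → Z} (k : ℕ)
    (h : ∀ (P Q : VertexNetwork X Y) (φ : P.1.V → Q.1.V), φ P.2 = Q.2 →
      (∀ v, P.1.graph.dist P.2 v ≤ k → GoodAt φ v) → f P = f Q) : Measurable f := fun s _ =>
  MeasurableSpace.measurableSet_generateFrom ⟨k, fun P Q φ h1 h2 => by
    rw [mem_preimage, mem_preimage, h P Q φ h1 h2]⟩

theorem measurable_dart_of_local {Z : Type*} [MeasurableSpace Z] {f : DartNetwork X Y → Z} (k : ℕ)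
    (h : ∀ (P Q : DartNetwork X Y) (φ : P.1.V → Q.1.V), DartRel φ P.2 Q.2 →
      (∀ v, P.1.graph.dist P.2.fst v ≤ k ∨ P.1.graph.dist P.2.snd v ≤ k → GoodAt φ v) →
        f P = f Q) : Measurable f := fun s _ =>
  MeasurableSpace.measurableSet_generateFrom ⟨k, fun P Q φ h1 h2 => by
    rw [mem_preimage, mem_preimage, h P Q φ h1 h2]⟩

theorem measurable_b : Measurable fun P : VertexNetwork X Y => P.1.b P.2 :=
  measurable_vertex_of_local 0 fun P Q φ h1 h2 => by rw [← h1, (h2 P.2 (by simp)).b]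

theorem measurable_cap : Measurable fun p : DartNetwork X Y => p.1.cap p.2 :=
  measurable_dart_of_local 0 fun P Q φ h1 h2 => (((h2 P.2.fst (by simp)).dart _ _ rfl h1).1).symm

theorem measurable_dart_fst : Measurable fun p : DartNetwork X Y => (⟨p.1, p.2.fst⟩ : VertexNetwork X Y) :=
  measurable_generateFrom fun _ ⟨k, hE⟩ => MeasurableSpace.measurableSet_generateFrom
    ⟨k, fun _ _ φ h1 h2 => hE _ _ φ h1.1 fun v hv => h2 v (Or.inl hv)⟩

theorem measurable_dart_snd : Measurable fun p : DartNetwork X Y => (⟨p.1, p.2.snd⟩ : VertexNetwork X Y) :=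
  measurable_generateFrom fun _ ⟨k, hE⟩ => MeasurableSpace.measurableSet_generateFrom
    ⟨k, fun _ _ φ h1 h2 => hE _ _ φ h1.2 fun v hv => h2 v (Or.inr hv)⟩

theorem measurable_dart_symm : Measurable fun p : DartNetwork X Y => (⟨p.1, p.2.symm⟩ : DartNetwork X Y) :=
  measurable_generateFrom fun _ ⟨k, hE⟩ => MeasurableSpace.measurableSet_generateFrom
    ⟨k, fun _ _ φ h1 h2 => hE _ _ φ h1.symm fun v hv => h2 v hv.symm⟩

theorem measurable_wIter (lam : ℝ) (k x : ℕ) :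
    Measurable fun p : DartNetwork X Y => p.1.wIter lam k p.2 x :=
  measurable_dart_of_local k fun P Q φ h1 h2 => by
    rw [wIter_eq_of_good lam k h1 fun v hv => h2 v (Or.inl hv)]

theorem isPiSystem_local : IsPiSystem {E : Set (DartNetwork X Y) | IsLocalDartSet E} := by
  rintro E ⟨k, hE⟩ F ⟨l, hF⟩ _
  refine ⟨max k l, fun P Q φ h1 h2 => and_congr (hE P Q φ h1 fun v hv => h2 v ?_)
    (hF P Q φ h1 fun v hv => h2 v ?_)⟩
  · exact hv.imp (fun h => h.trans (le_max_left _ _)) fun h => h.trans (le_max_left _ _)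
  · exact hv.imp (fun h => h.trans (le_max_right _ _)) fun h => h.trans (le_max_right _ _)

/-- The number of directed edges in `E` at the distinguished vertex; as this number is finite,
complements can be treated by subtraction. -/
theorem measurable_sum_indicator {E : Set (DartNetwork X Y)} (hE : MeasurableSet E) :
    Measurable fun P : VertexNetwork X Y =>
      ∑ d ∈ P.1.inDarts P.2, E.indicator (fun _ => (1 : ℝ≥0∞)) ⟨P.1, d⟩ := by
  have loc : ∀ E : Set (DartNetwork X Y), IsLocalDartSet E → Measurable fun P : VertexNetwork X Y =>
      ∑ d ∈ P.1.inDarts P.2, E.indicator (fun _ => (1 : ℝ≥0∞)) ⟨P.1, d⟩ := by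
    rintro E ⟨k, hE⟩
    refine measurable_vertex_of_local (k + 1) fun P Q φ h1 h2 => ?_
    rw [← h1]
    refine (h2 P.2 (by simp)).sum_inDarts fun d d' hd hdd => ?_
    have : (⟨P.1, d⟩ : DartNetwork X Y) ∈ E ↔ (⟨Q.1, d'⟩ : DartNetwork X Y) ∈ E := by
      refine hE _ _ φ hdd fun v hv => h2 v ?_
      rcases hv with hv | hv
      · exact dist_le_succ_of_adj (hd ▸ d.adj.symm) hv
      · change P.1.graph.dist d.snd v ≤ k at hv
        rw [hd] at hv; omega
    by_cases h : (⟨P.1, d⟩ : DartNetwork X Y) ∈ E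
    · rw [indicator_of_mem h, indicator_of_mem (this.1 h)]
    · rw [indicator_of_notMem h, indicator_of_notMem (fun h' => h (this.2 h'))]
  induction E, hE using MeasurableSpace.induction_on_inter rfl isPiSystem_local with
  | empty => simp
  | basic E hE => exact loc E hE
  | compl E hE ih =>
    have h1 := loc univ ⟨0, fun _ _ _ _ _ => by simp⟩
    have e : (fun P : VertexNetwork X Y =>
        ∑ d ∈ P.1.inDarts P.2, Eᶜ.indicator (fun _ => (1 : ℝ≥0∞)) ⟨P.1, d⟩)
        = fun P => (∑ d ∈ P.1.inDarts P.2, univ.indicator (fun _ => (1 : ℝ≥0∞))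
            (⟨P.1, d⟩ : DartNetwork X Y))
          - ∑ d ∈ P.1.inDarts P.2, E.indicator (fun _ => (1 : ℝ≥0∞)) ⟨P.1, d⟩ := by
      ext P
      refine ENNReal.eq_sub_of_add_eq ?_ ?_
      · refine ENNReal.sum_ne_top.2 fun d _ => ?_
        by_cases h : (⟨P.1, d⟩ : DartNetwork X Y) ∈ E <;> simp [h]
      · rw [← Finset.sum_add_distrib]
        refine Finset.sum_congr rfl fun d _ => ?_
        by_cases h : (⟨P.1, d⟩ : DartNetwork X Y) ∈ E <;> simp [h]
    rw [e]
    exact h1.sub ih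
  | iUnion E hd hE ih =>
    have e : (fun P : VertexNetwork X Y =>
        ∑ d ∈ P.1.inDarts P.2, (⋃ i, E i).indicator (fun _ => (1 : ℝ≥0∞)) ⟨P.1, d⟩)
        = fun P => ∑' i, ∑ d ∈ P.1.inDarts P.2, (E i).indicator (fun _ => (1 : ℝ≥0∞)) ⟨P.1, d⟩ := by
      ext P
      rw [Summable.tsum_finsetSum fun _ _ => ENNReal.summable]
      refine Finset.sum_congr rfl fun d _ => ?_
      by_cases h : (⟨P.1, d⟩ : DartNetwork X Y) ∈ ⋃ i, E i
      · obtain ⟨i, hi⟩ := mem_iUnion.1 h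
        rw [indicator_of_mem h, tsum_eq_single i, indicator_of_mem hi]
        exact fun j hj => indicator_of_notMem (fun h' => disjoint_left.1 (hd hj) h' hi) _
      · rw [indicator_of_notMem h]
        refine (ENNReal.tsum_eq_zero.2 fun i => indicator_of_notMem (fun h' => h ?_) _).symm
        exact mem_iUnion.2 ⟨i, h'⟩
    rw [e]
    exact Measurable.tsum ih

/-- Sums over the directed edges into the distinguished vertex preserve measurability. -/
theorem measurable_sum_inDarts {f : DartNetwork X Y → ℝ≥0∞} (hf : Measurable f) :
    Measurable fun P : VertexNetwork X Y => ∑ d ∈ P.1.inDarts P.2, f ⟨P.1, d⟩ := by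
  refine Measurable.ennreal_induction (motive := fun f : DartNetwork X Y → ℝ≥0∞ => Measurable
    fun P : VertexNetwork X Y => ∑ d ∈ P.1.inDarts P.2, f ⟨P.1, d⟩) (fun c E hE => ?_)
    (fun f g _ _ _ h1 h2 => ?_) (fun f _ hmono h => ?_) hf
  · have e : (fun P : VertexNetwork X Y => ∑ d ∈ P.1.inDarts P.2, E.indicator (fun _ => c) ⟨P.1, d⟩)
        = fun P => c * ∑ d ∈ P.1.inDarts P.2, E.indicator (fun _ => (1 : ℝ≥0∞)) ⟨P.1, d⟩ := by
      ext P
      rw [Finset.mul_sum]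
      refine Finset.sum_congr rfl fun d _ => ?_
      by_cases h : (⟨P.1, d⟩ : DartNetwork X Y) ∈ E <;> simp [h]
    rw [e]
    exact (measurable_sum_indicator hE).const_mul c
  · simp only [Pi.add_apply, Finset.sum_add_distrib]
    exact h1.add h2
  · have e : (fun P : VertexNetwork X Y => ∑ d ∈ P.1.inDarts P.2, (fun p => ⨆ n, f n p) ⟨P.1, d⟩)
        = fun P => ⨆ n, ∑ d ∈ P.1.inDarts P.2, f n ⟨P.1, d⟩ := by
      ext P
      exact ENNReal.finsetSum_iSup_of_monotone fun d i j hij => hmono hij _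
    rw [e]
    exact Measurable.iSup h

theorem measurableSet_exists_inDarts {E : Set (DartNetwork X Y)} (hE : MeasurableSet E) :
    MeasurableSet {P : VertexNetwork X Y | ∃ d ∈ P.1.inDarts P.2, (⟨P.1, d⟩ : DartNetwork X Y) ∈ E} := by
  have h := measurable_sum_indicator hE (measurableSet_singleton 0).compl
  convert h using 1
  ext P
  simp

/-! ### Invariance under isomorphisms -/

/-- Measurable sets are saturated for maps that are local isomorphisms at every vertex, in particular
for isomorphisms. -/
theorem mem_iff_of_good {E : Set (DartNetwork X Y)} (hE : MeasurableSet E) {P Q : DartNetwork X Y}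
    (φ : P.1.V → Q.1.V) (h : DartRel φ P.2 Q.2) (hφ : ∀ v, GoodAt φ v) : P ∈ E ↔ Q ∈ E := by
  induction E, hE using MeasurableSpace.generateFrom_induction with
  | hC E hE _ => obtain ⟨k, hk⟩ := hE; exact hk P Q φ h fun v _ => hφ v
  | empty => simp
  | compl E _ ih => exact not_congr ih
  | iUnion E _ ih => simp only [mem_iUnion, ih]

theorem vertex_mem_iff_of_good {E : Set (VertexNetwork X Y)} (hE : MeasurableSet E)
    {P Q : VertexNetwork X Y} (φ : P.1.V → Q.1.V) (h : φ P.2 = Q.2) (hφ : ∀ v, GoodAt φ v) :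
    P ∈ E ↔ Q ∈ E := by
  induction E, hE using MeasurableSpace.generateFrom_induction with
  | hC E hE _ => obtain ⟨k, hk⟩ := hE; exact hk P Q φ h fun v _ => hφ v
  | empty => simp
  | compl E _ ih => exact not_congr ih
  | iUnion E _ ih => simp only [mem_iUnion, ih]

theorem eq_of_good {Z : Type*} [MeasurableSpace Z] [MeasurableSingletonClass Z]
    {f : DartNetwork X Y → Z} (hf : Measurable f) {P Q : DartNetwork X Y}
    (φ : P.1.V → Q.1.V) (h : DartRel φ P.2 Q.2) (hφ : ∀ v, GoodAt φ v) : f P = f Q :=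
  (((mem_iff_of_good (hf (measurableSet_singleton (f P))) φ h hφ).1 rfl)).symm

theorem vertex_eq_of_good {Z : Type*} [MeasurableSpace Z] [MeasurableSingletonClass Z]
    {f : VertexNetwork X Y → Z} (hf : Measurable f) {P Q : VertexNetwork X Y}
    (φ : P.1.V → Q.1.V) (h : φ P.2 = Q.2) (hφ : ∀ v, GoodAt φ v) : f P = f Q :=
  (((vertex_mem_iff_of_good (hf (measurableSet_singleton (f P))) φ h hφ).1 rfl)).symm

end

noncomputable section

/-! ### Comparison of balls -/

namespace PointedNetwork

open Network

variable {ι : Type} {X Y : Type*}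

theorem ball_mono (P : PointedNetwork ι X Y) {j k : ℕ} (h : j ≤ k) : P.ball j ⊆ P.ball k :=
  fun _ ⟨i, hi⟩ => ⟨i, hi.trans h⟩

theorem mem_ball_succ_of_adj {P : PointedNetwork ι X Y} {k : ℕ} {u v : P.1.V} (hu : u ∈ P.ball k)
    (h : P.1.graph.Adj u v) : v ∈ P.ball (k + 1) := by
  obtain ⟨i, hi⟩ := hu
  refine ⟨i, ?_⟩
  rw [SimpleGraph.dist_comm] at hi ⊢
  exact dist_le_succ_of_adj h.symm hi

theorem exists_adj_of_mem_ball_succ {P : PointedNetwork ι X Y} {k : ℕ} {v : P.1.V}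
    (hv : v ∈ P.ball (k + 1)) (h : v ∉ P.ball k) : ∃ u ∈ P.ball k, P.1.graph.Adj u v := by
  obtain ⟨i, hi⟩ := hv
  obtain ⟨p, hp⟩ := P.1.connected.exists_walk_length_eq_dist v (P.2 i)
  cases p with
  | nil => exact absurd ⟨i, by simp⟩ h
  | cons ha p =>
    refine ⟨_, ⟨i, ?_⟩, ha.symm⟩
    rw [SimpleGraph.Walk.length_cons, SimpleGraph.dist_comm] at hp
    rw [SimpleGraph.dist_comm]
    exact (SimpleGraph.dist_le p).trans (by omega)

theorem finite_ball [Finite ι] (P : PointedNetwork ι X Y) (k : ℕ) : (P.ball k).Finite := by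
  induction k with
  | zero =>
    refine (finite_range P.2).subset ?_
    rintro v ⟨i, hi⟩
    exact ⟨i, P.1.connected.dist_eq_zero_iff.1 (Nat.le_zero.1 hi)⟩
  | succ k ih =>
    refine (ih.union (ih.biUnion fun u _ => P.1.locallyFinite u)).subset fun v hv => ?_
    by_cases h : v ∈ P.ball k
    · exact Or.inl h
    · obtain ⟨u, hu, ha⟩ := exists_adj_of_mem_ball_succ hv h
      exact Or.inr (mem_biUnion hu ha)

/-- The graph isomorphism `φ` respects all the structure of the two networks. -/
structure IsIso (P Q : PointedNetwork ι X Y) (φ : P.1.graph ≃g Q.1.graph) : Prop where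
  pts : ∀ i, φ (P.2 i) = Q.2 i
  b : ∀ v, Q.1.b (φ v) = P.1.b v
  c : ∀ e, Q.1.c (φ.mapEdgeSet e) = P.1.c e
  vmark : ∀ v, Q.1.vmark (φ v) = P.1.vmark v
  emark : ∀ d, Q.1.emark (φ.toHom.mapDart d) = P.1.emark d

theorem isomorphic_iff {P Q : PointedNetwork ι X Y} : Isomorphic P Q ↔ ∃ φ, IsIso P Q φ :=
  ⟨fun ⟨φ, h1, h2, h3, h4, h5⟩ => ⟨φ, h1, h2, h3, h4, h5⟩,
    fun ⟨φ, h1, h2, h3, h4, h5⟩ => ⟨φ, h1, h2, h3, h4, h5⟩⟩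

/-- The map `φ` of vertices restricts to an isomorphism of the balls of radius `k` as in the
definition of `PointedNetwork.Near`. -/
structure NearBy [PseudoMetricSpace X] [PseudoMetricSpace Y] (k : ℕ) (ε : ℝ)
    (P Q : PointedNetwork ι X Y) (φ : P.1.V → Q.1.V) : Prop where
  pts : ∀ i, φ (P.2 i) = Q.2 i
  bij : BijOn φ (P.ball k) (Q.ball k)
  adj : ∀ u ∈ P.ball k, ∀ v ∈ P.ball k, Q.1.graph.Adj (φ u) (φ v) ↔ P.1.graph.Adj u v
  b : ∀ v ∈ P.ball k, Q.1.b (φ v) = P.1.b v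
  vmark : ∀ v ∈ P.ball k, dist (P.1.vmark v) (Q.1.vmark (φ v)) < ε
  dart : ∀ (d : P.1.graph.Dart) (d' : Q.1.graph.Dart), d.fst ∈ P.ball k → d.snd ∈ P.ball k →
    DartRel φ d d' → Q.1.cap d' = P.1.cap d ∧ dist (P.1.emark d) (Q.1.emark d') < ε

variable [PseudoMetricSpace X] [PseudoMetricSpace Y] {k : ℕ} {ε : ℝ}
  {P Q S : PointedNetwork ι X Y}

open Classical in
theorem near_iff : Near k ε P Q ↔ ∃ φ, NearBy k ε P Q φ := by
  constructor
  · rintro ⟨ψ, h1, h2, h3, h4⟩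
    have := Q.1.connected.nonempty
    have e : ∀ v (hv : v ∈ P.ball k), (if h : v ∈ P.ball k then (ψ ⟨v, h⟩ : Q.1.V)
      else Classical.arbitrary _) = ψ ⟨v, hv⟩ := fun v hv => dif_pos hv
    refine ⟨fun v => if h : v ∈ P.ball k then ψ ⟨v, h⟩ else Classical.arbitrary _, fun i => ?_,
      ⟨fun v hv => ?_, fun u hu v hv h => ?_, fun w hw => ?_⟩, fun u hu v hv => ?_, fun v hv => ?_,
      fun v hv => ?_, ?_⟩
    · exact (e _ (P.root_mem_ball k i)).trans (congrArg Subtype.val (h1 i))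
    · simp only [e _ hv]; exact (ψ ⟨v, hv⟩).2
    · simp only [e _ hu, e _ hv] at h
      exact congrArg Subtype.val (ψ.injective (Subtype.ext h))
    · refine ⟨ψ.symm ⟨w, hw⟩, (ψ.symm ⟨w, hw⟩).2, ?_⟩
      simp only [e _ (ψ.symm ⟨w, hw⟩).2]
      simp
    · simp only [e _ hu, e _ hv]
      exact ψ.map_adj_iff (v := ⟨u, hu⟩) (w := ⟨v, hv⟩)
    · simp only [e _ hv]; exact h2 ⟨v, hv⟩
    · simp only [e _ hv]; exact h3 ⟨v, hv⟩
    · rintro ⟨⟨u, v⟩, h⟩ ⟨⟨u', v'⟩, h'⟩ hu hv ⟨r1, r2⟩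
      simp only [e _ hu, e _ hv] at r1 r2
      subst r1 r2
      exact h4 ⟨u, hu⟩ ⟨v, hv⟩ h h'
  · rintro ⟨φ, h⟩
    refine ⟨⟨h.bij.equiv, ?_⟩, fun i => Subtype.ext (h.pts i), fun v => h.b v v.2,
      fun v => h.vmark v v.2, fun u v ha ha' =>
        h.dart ⟨(u, v), ha⟩ ⟨(φ u, φ v), ha'⟩ u.2 v.2 ⟨rfl, rfl⟩⟩
    rintro ⟨u, hu⟩ ⟨v, hv⟩
    exact h.adj u hu v hv

theorem NearBy.near {φ : P.1.V → Q.1.V} (h : NearBy k ε P Q φ) : Near k ε P Q := near_iff.2 ⟨φ, h⟩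

/-- A partial isomorphism of balls respects the smaller balls as well, since each ball consists of
the previous one and of the neighbours of its vertices. -/
theorem NearBy.mapsTo {φ : P.1.V → Q.1.V} (h : NearBy k ε P Q φ) {j : ℕ} (hj : j ≤ k) :
    MapsTo φ (P.ball j) (Q.ball j) := by
  induction j with
  | zero =>
    rintro v ⟨i, hi⟩
    have : P.2 i = v := P.1.connected.dist_eq_zero_iff.1 (Nat.le_zero.1 hi)
    exact ⟨i, by rw [← this, h.pts]; simp⟩
  | succ j ih =>
    intro v hv
    by_cases hv' : v ∈ P.ball j
    · exact Q.ball_mono (Nat.le_succ j) (ih (by omega) hv')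
    · obtain ⟨u, hu, ha⟩ := exists_adj_of_mem_ball_succ hv hv'
      exact mem_ball_succ_of_adj (ih (by omega) hu) ((h.adj u (P.ball_mono (by omega) hu) v
        (P.ball_mono hj hv)).2 ha)

theorem NearBy.surjOn {φ : P.1.V → Q.1.V} (h : NearBy k ε P Q φ) {j : ℕ} (hj : j ≤ k) :
    SurjOn φ (P.ball j) (Q.ball j) := by
  induction j with
  | zero =>
    rintro v ⟨i, hi⟩
    have : Q.2 i = v := Q.1.connected.dist_eq_zero_iff.1 (Nat.le_zero.1 hi)
    exact ⟨P.2 i, P.root_mem_ball 0 i, by rw [h.pts, this]⟩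
  | succ j ih =>
    intro v hv
    by_cases hv' : v ∈ Q.ball j
    · obtain ⟨u, hu, e⟩ := ih (by omega) hv'
      exact ⟨u, P.ball_mono (Nat.le_succ j) hu, e⟩
    · obtain ⟨u, hu, ha⟩ := exists_adj_of_mem_ball_succ hv hv'
      obtain ⟨u, hu', rfl⟩ := ih (by omega) hu
      obtain ⟨v, hv2, rfl⟩ := h.bij.surjOn (Q.ball_mono hj hv)
      exact ⟨v, mem_ball_succ_of_adj hu' ((h.adj u (P.ball_mono (by omega) hu') v hv2).1 ha), rfl⟩

theorem NearBy.mono {φ : P.1.V → Q.1.V} (h : NearBy k ε P Q φ) {j : ℕ} (hj : j ≤ k) {ε' : ℝ}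
    (hε : ε ≤ ε') : NearBy j ε' P Q φ where
  pts := h.pts
  bij := ⟨h.mapsTo hj, h.bij.injOn.mono (P.ball_mono hj), h.surjOn hj⟩
  adj u hu v hv := h.adj u (P.ball_mono hj hu) v (P.ball_mono hj hv)
  b v hv := h.b v (P.ball_mono hj hv)
  vmark v hv := (h.vmark v (P.ball_mono hj hv)).trans_le hε
  dart d d' h1 h2 h3 :=
    have := h.dart d d' (P.ball_mono hj h1) (P.ball_mono hj h2) h3
    ⟨this.1, this.2.trans_le hε⟩

theorem NearBy.trans {ε' : ℝ} {φ : P.1.V → Q.1.V} {ψ : Q.1.V → S.1.V} (h : NearBy k ε P Q φ)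
    (h' : NearBy k ε' Q S ψ) : NearBy k (ε + ε') P S (ψ ∘ φ) where
  pts i := by rw [Function.comp, h.pts, h'.pts]
  bij := h'.bij.comp h.bij
  adj u hu v hv := (h'.adj _ (h.bij.mapsTo hu) _ (h.bij.mapsTo hv)).trans (h.adj u hu v hv)
  b v hv := (h'.b _ (h.bij.mapsTo hv)).trans (h.b v hv)
  vmark v hv := (dist_triangle _ _ _).trans_lt
    (add_lt_add (h.vmark v hv) (h'.vmark _ (h.bij.mapsTo hv)))
  dart d d' h1 h2 h3 := by
    have h4 : Q.1.graph.Adj (φ d.fst) (φ d.snd) := (h.adj _ h1 _ h2).2 d.adj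
    have a := h.dart d ⟨(φ d.fst, φ d.snd), h4⟩ h1 h2 ⟨rfl, rfl⟩
    have b := h'.dart ⟨(φ d.fst, φ d.snd), h4⟩ d' (h.bij.mapsTo h1) (h.bij.mapsTo h2) h3
    exact ⟨b.1.trans a.1, (dist_triangle _ _ _).trans_lt (add_lt_add a.2 b.2)⟩

theorem NearBy.symm [Nonempty P.1.V] {φ : P.1.V → Q.1.V} (h : NearBy k ε P Q φ) :
    NearBy k ε Q P (Function.invFunOn φ (P.ball k)) := by
  have r := h.bij.invOn_invFunOn
  have m : MapsTo (Function.invFunOn φ (P.ball k)) (Q.ball k) (P.ball k) := h.bij.surjOn.mapsTo_invFunOn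
  refine ⟨fun i => ?_, h.bij.symm r.symm, fun u hu v hv => ?_, fun v hv => ?_, fun v hv => ?_,
    fun d d' h1 h2 h3 => ?_⟩
  · rw [← h.pts]; exact r.1 (P.root_mem_ball k i)
  · rw [← h.adj _ (m hu) _ (m hv), r.2 hu, r.2 hv]
  · rw [← h.b _ (m hv), r.2 hv]
  · have := h.vmark _ (m hv)
    rw [r.2 hv, dist_comm] at this
    exact this
  · have := h.dart d' d (h3.1 ▸ m h1) (h3.2 ▸ m h2) ⟨h3.1 ▸ r.2 h1, h3.2 ▸ r.2 h2⟩
    exact ⟨this.1.symm, dist_comm (P.1.emark d') _ ▸ this.2⟩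

theorem Near.mono (h : Near k ε P Q) {j : ℕ} (hj : j ≤ k) {ε' : ℝ} (hε : ε ≤ ε') : Near j ε' P Q := by
  obtain ⟨φ, h⟩ := near_iff.1 h
  exact (h.mono hj hε).near

theorem Near.trans {ε' : ℝ} (h : Near k ε P Q) (h' : Near k ε' Q S) : Near k (ε + ε') P S := by
  obtain ⟨φ, h⟩ := near_iff.1 h
  obtain ⟨ψ, h'⟩ := near_iff.1 h'
  exact (h.trans h').near

theorem Near.symm (h : Near k ε P Q) : Near k ε Q P := by
  obtain ⟨φ, h⟩ := near_iff.1 h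
  have := P.1.connected.nonempty
  exact h.symm.near

/-- An isomorphism moves no mark at all. -/
theorem IsIso.nearBy {φ : P.1.graph ≃g Q.1.graph} (h : IsIso P Q φ) (k : ℕ) (hε : 0 < ε) :
    NearBy k ε P Q φ := by
  obtain ⟨h1, h2, h3, h4, h5⟩ := h
  have hd : ∀ u v, Q.1.graph.dist (φ u) (φ v) = P.1.graph.dist u v := fun u v => by
    refine le_antisymm ?_ ?_
    · obtain ⟨p, hp⟩ := P.1.connected.exists_walk_length_eq_dist u v
      rw [← hp, ← SimpleGraph.Walk.length_map φ.toHom p]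
      exact SimpleGraph.dist_le _
    · obtain ⟨p, hp⟩ := Q.1.connected.exists_walk_length_eq_dist (φ u) (φ v)
      have := SimpleGraph.dist_le (p.map φ.symm.toHom)
      rw [SimpleGraph.Walk.length_map, hp] at this
      simpa using this
  have hb : ∀ v k, φ v ∈ Q.ball k ↔ v ∈ P.ball k := fun v k =>
    exists_congr fun i => by rw [← h1, hd]
  refine ⟨h1, ⟨fun v hv => (hb v k).2 hv, φ.injective.injOn, fun w hw => ?_⟩,
    fun u _ v _ => φ.map_adj_iff, fun v _ => h2 v, fun v _ => ?_, fun d d' _ _ hdd => ?_⟩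
  · obtain ⟨v, rfl⟩ := φ.surjective w
    exact ⟨v, (hb v k).1 hw, rfl⟩
  · rw [h4, dist_self]; exact hε
  · obtain ⟨⟨u, v⟩, ha⟩ := d
    have e : d' = φ.toHom.mapDart ⟨(u, v), ha⟩ := by
      ext
      · exact hdd.1.symm
      · exact hdd.2.symm
    subst e
    refine ⟨?_, by rw [h5, dist_self]; exact hε⟩
    exact h3 ⟨s(u, v), ha⟩

theorem Isomorphic.exists_nearBy (h : Isomorphic P Q) :
    ∃ φ : P.1.V → Q.1.V, ∀ k ε, 0 < ε → NearBy k ε P Q φ := by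
  obtain ⟨φ, h⟩ := isomorphic_iff.1 h
  exact ⟨φ, fun k _ hε => h.nearBy k hε⟩

theorem Isomorphic.near (h : Isomorphic P Q) (hε : 0 < ε) : Near k ε P Q := by
  obtain ⟨φ, h⟩ := h.exists_nearBy
  exact (h k ε hε).near

/-- The discrete data agree on the ball of radius `k + 1`, which contains the neighbours of the
vertices of the ball of radius `k`. -/
theorem NearBy.goodAt {φ : P.1.V → Q.1.V} (h : NearBy (k + 1) 1 P Q φ) {v : P.1.V}
    (hv : v ∈ P.ball k) : GoodAt φ v := by
  have hv' := P.ball_mono (Nat.le_succ k) hv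
  refine ⟨h.b v hv', ⟨fun w hw => ?_, ?_, fun w hw => ?_⟩, ?_⟩
  · exact (h.adj _ hv' _ (mem_ball_succ_of_adj hv hw)).2 hw
  · exact h.bij.injOn.mono fun w hw => mem_ball_succ_of_adj hv hw
  · have h1 : w ∈ Q.ball (k + 1) := mem_ball_succ_of_adj (h.mapsTo (Nat.le_succ k) hv) hw
    obtain ⟨w, hw2, rfl⟩ := h.bij.surjOn h1
    exact ⟨w, (h.adj _ hv' _ hw2).1 hw, rfl⟩
  · rintro d d' rfl hdd
    have hs := mem_ball_succ_of_adj hv d.adj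
    have a := h.dart d d' hv' hs hdd
    exact ⟨a.1, a.2, (h.dart d.symm d'.symm hs hv' hdd.symm).2⟩

/-- Nearby networks are related by a map that is a local isomorphism near the distinguished
vertices. -/
theorem Near.exists_goodAt (h : Near (k + 1) 1 P Q) :
    ∃ φ : P.1.V → Q.1.V, (∀ i, φ (P.2 i) = Q.2 i) ∧ ∀ v ∈ P.ball k, GoodAt φ v := by
  obtain ⟨φ, h⟩ := near_iff.1 h
  exact ⟨φ, h.pts, fun v hv => h.goodAt hv⟩

theorem IsIso.goodAt [Nonempty ι] {φ : P.1.graph ≃g Q.1.graph} (h : IsIso P Q φ) (v : P.1.V) :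
    GoodAt φ v :=
  (h.nearBy (P.1.graph.dist (P.2 (Classical.arbitrary ι)) v + 1) one_pos).goodAt ⟨_, le_rfl⟩

theorem Isomorphic.exists_goodAt [Nonempty ι] (h : Isomorphic P Q) :
    ∃ φ : P.1.V → Q.1.V, (∀ i, φ (P.2 i) = Q.2 i) ∧ ∀ v, GoodAt φ v := by
  obtain ⟨φ, h⟩ := isomorphic_iff.1 h
  exact ⟨φ, h.pts, h.goodAt⟩

end PointedNetwork

end

noncomputable section

/-! ### The local topology -/

namespace PointedNetwork

open Network

variable {ι : Type} {X Y : Type*} [PseudoMetricSpace X] [PseudoMetricSpace Y] {k : ℕ} {ε : ℝ}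
  {P Q S : PointedNetwork ι X Y}

theorem Near.refl (k : ℕ) (hε : 0 < ε) (P : PointedNetwork ι X Y) : Near k ε P P :=
  (isomorphic_equivalence.refl P).near hε

/-- Closeness of marks to within `ε` is preserved without loss, so it descends to isomorphism
classes. -/
theorem Near.trans_isomorphic (h : Near k ε P Q) (h' : Isomorphic Q S) : Near k ε P S := by
  obtain ⟨φ, h⟩ := near_iff.1 h
  obtain ⟨ψ, h'⟩ := h'.exists_nearBy
  have hv : ∀ v ∈ Q.ball k, dist (Q.1.vmark v) (S.1.vmark (ψ v)) ≤ 0 := fun v hv =>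
    le_of_forall_pos_le_add fun δ hδ => by simpa using ((h' k δ hδ).vmark v hv).le
  have hd : ∀ (d : Q.1.graph.Dart) (d' : S.1.graph.Dart), d.fst ∈ Q.ball k → d.snd ∈ Q.ball k →
      DartRel ψ d d' → dist (Q.1.emark d) (S.1.emark d') ≤ 0 := fun d d' h1 h2 h3 =>
    le_of_forall_pos_le_add fun δ hδ => by simpa using ((h' k δ hδ).dart d d' h1 h2 h3).2.le
  have t := h.trans (h' k 1 one_pos)
  refine NearBy.near (φ := ψ ∘ φ) ⟨t.pts, t.bij, t.adj, t.b, fun v hv' => ?_, fun d d' h1 h2 h3 =>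
    ⟨(t.dart d d' h1 h2 h3).1, ?_⟩⟩
  · refine (dist_triangle _ _ _).trans_lt (add_lt_of_lt_of_nonpos (h.vmark v hv') (hv _ (h.bij.mapsTo hv')))
  · have h4 : Q.1.graph.Adj (φ d.fst) (φ d.snd) := (h.adj _ h1 _ h2).2 d.adj
    exact (dist_triangle _ _ _).trans_lt (add_lt_of_lt_of_nonpos
      (h.dart d ⟨(φ d.fst, φ d.snd), h4⟩ h1 h2 ⟨rfl, rfl⟩).2
      (hd ⟨(φ d.fst, φ d.snd), h4⟩ d' (h.bij.mapsTo h1) (h.bij.mapsTo h2) h3))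

/-- As balls are finite, the strict inequalities for the marks leave some room. -/
theorem Near.exists_lt [Finite ι] (h : Near k ε P Q) : ∃ δ < ε, Near k δ P Q := by
  obtain ⟨φ, h⟩ := near_iff.1 h
  have hf : (P.ball k).Finite := P.finite_ball k
  have hfd : {d : P.1.graph.Dart | d.fst ∈ P.ball k ∧ d.snd ∈ P.ball k}.Finite := by
    refine Finite.of_injOn (f := fun d => (d.fst, d.snd)) (t := P.ball k ×ˢ P.ball k)
      (fun d hd => ⟨hd.1, hd.2⟩) (fun d _ d' _ e => ?_) (hf.prod hf)
    ext
    · exact congrArg Prod.fst e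
    · exact congrArg Prod.snd e
  have hv : ∀ v ∈ P.ball k, ∀ᶠ δ in 𝓝[<] ε, dist (P.1.vmark v) (Q.1.vmark (φ v)) < δ :=
    fun v hv => Ioo_mem_nhdsLT (h.vmark v hv) |> Filter.mem_of_superset <| fun _ hx => hx.1
  have hd : ∀ d ∈ {d : P.1.graph.Dart | d.fst ∈ P.ball k ∧ d.snd ∈ P.ball k},
      ∀ᶠ δ in 𝓝[<] ε, ∀ d', DartRel φ d d' → dist (P.1.emark d) (Q.1.emark d') < δ := by
    rintro d ⟨h1, h2⟩
    have h4 : Q.1.graph.Adj (φ d.fst) (φ d.snd) := (h.adj _ h1 _ h2).2 d.adj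
    refine Filter.mem_of_superset (Ioo_mem_nhdsLT
      (h.dart d ⟨(φ d.fst, φ d.snd), h4⟩ h1 h2 ⟨rfl, rfl⟩).2) fun δ hδ d' hdd => ?_
    have e : d' = ⟨(φ d.fst, φ d.snd), h4⟩ := by
      ext
      · exact hdd.1.symm
      · exact hdd.2.symm
    rw [e]; exact hδ.1
  obtain ⟨δ, ⟨h1, h2⟩, h3⟩ := (((eventually_all_finite hf).2 hv).and
    ((eventually_all_finite hfd).2 hd)).and (self_mem_nhdsWithin (s := Iio ε)) |>.exists
  exact ⟨δ, h3, NearBy.near ⟨h.pts, h.bij, h.adj, h.b, h1, fun d d' a b c =>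
    ⟨(h.dart d d' a b c).1, h2 d ⟨a, b⟩ d' c⟩⟩⟩

/-- A property of networks that persists nearby. -/
def IsNearOpen (Ψ : PointedNetwork ι X Y → Prop) : Prop :=
  ∀ P, Ψ P → ∃ k ε, 0 < ε ∧ ∀ Q, Near k ε P Q → Ψ Q

theorem isNearOpen_near [Finite ι] (P : PointedNetwork ι X Y) (k : ℕ) (ε : ℝ) :
    IsNearOpen (Near k ε P) := fun Q hQ => by
  obtain ⟨δ, hδ, h⟩ := hQ.exists_lt
  exact ⟨k, ε - δ, by linarith, fun S hS => (h.trans hS).mono le_rfl (by linarith)⟩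

end PointedNetwork

namespace NetworkSpace

open PointedNetwork Network

variable {ι : Type} {X Y : Type*}

theorem mk_out (q : NetworkSpace ι X Y) : mk q.net q.pts = q := Quotient.out_eq q

theorem isomorphic_out_mk (P : PointedNetwork ι X Y) :
    Isomorphic (Quotient.out (mk P.1 P.2)) P :=
  Quotient.exact (Quotient.out_eq (mk P.1 P.2))

theorem mk_eq_mk {P Q : PointedNetwork ι X Y} (h : Isomorphic P Q) : mk P.1 P.2 = mk Q.1 Q.2 :=
  Quotient.sound h

variable [PseudoMetricSpace X] [PseudoMetricSpace Y]

instance : BorelSpace (NetworkSpace ι X Y) := ⟨rfl⟩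

/-- The classes whose ball of radius `k` is close to that of `P`. -/
def nearSet (P : PointedNetwork ι X Y) (k : ℕ) (ε : ℝ) : Set (NetworkSpace ι X Y) :=
  {q | Near k ε P (Quotient.out q)}

theorem image_near (P : PointedNetwork ι X Y) (k : ℕ) (ε : ℝ) :
    Quotient.mk (PointedNetwork.setoid ι X Y) '' {Q | Near k ε P Q} = nearSet P k ε := by
  ext q
  constructor
  · rintro ⟨Q, hQ, rfl⟩
    exact Near.trans_isomorphic hQ (isomorphic_equivalence.symm (isomorphic_out_mk Q))
  · intro h
    exact ⟨Quotient.out q, h, Quotient.out_eq q⟩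

theorem topology_eq : (inferInstance : TopologicalSpace (NetworkSpace ι X Y)) =
    TopologicalSpace.generateFrom {S | ∃ P k ε, 0 < ε ∧ S = nearSet P k ε} := by
  refine congrArg TopologicalSpace.generateFrom ?_
  simp only [image_near]

theorem isOpen_nearSet (P : PointedNetwork ι X Y) (k : ℕ) {ε : ℝ} (hε : 0 < ε) :
    IsOpen (nearSet P k ε) :=
  TopologicalSpace.isOpen_generateFrom_of_mem ⟨P, k, ε, hε, (image_near P k ε).symm⟩

theorem mem_nearSet_self (q : NetworkSpace ι X Y) (k : ℕ) {ε : ℝ} (hε : 0 < ε) :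
    q ∈ nearSet (Quotient.out q) k ε := Near.refl k hε _

theorem isOpen_of_isNearOpen {Ψ : PointedNetwork ι X Y → Prop} (h : IsNearOpen Ψ) :
    IsOpen {q : NetworkSpace ι X Y | Ψ (Quotient.out q)} := by
  rw [isOpen_iff_forall_mem_open]
  intro q hq
  obtain ⟨k, ε, hε, h⟩ := h _ hq
  exact ⟨nearSet (Quotient.out q) k ε, fun q' hq' => h _ hq', isOpen_nearSet _ _ hε,
    mem_nearSet_self q k hε⟩

/-- The sets `nearSet` around `q` form a neighbourhood basis at `q`, although the topology is only
generated by such sets. -/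
theorem exists_nearSet_subset [Finite ι] {U : Set (NetworkSpace ι X Y)} (hU : IsOpen U)
    {q : NetworkSpace ι X Y} (hq : q ∈ U) :
    ∃ k ε, 0 < ε ∧ nearSet (Quotient.out q) k ε ⊆ U := by
  rw [isOpen_mk] at hU
  induction hU with
  | basic S hS =>
    obtain ⟨P, k, ε, -, rfl⟩ := hS
    rw [image_near] at hq ⊢
    obtain ⟨k', ε', h1, h2⟩ := isNearOpen_near P k ε _ hq
    exact ⟨k', ε', h1, fun q' hq' => h2 _ hq'⟩
  | univ => exact ⟨0, 1, one_pos, subset_univ _⟩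
  | inter S T _ _ h1 h2 =>
    obtain ⟨k, ε, hε, h⟩ := h1 hq.1
    obtain ⟨k', ε', hε', h'⟩ := h2 hq.2
    refine ⟨max k k', min ε ε', lt_min hε hε', fun q' hq' => ⟨h ?_, h' ?_⟩⟩
    · exact Near.mono hq' (le_max_left _ _) (min_le_left _ _)
    · exact Near.mono hq' (le_max_right _ _) (min_le_right _ _)
  | sUnion S _ ih =>
    obtain ⟨T, hT, hqT⟩ := hq
    obtain ⟨k, ε, hε, h⟩ := ih T hT hqT
    exact ⟨k, ε, hε, h.trans (subset_sUnion_of_mem hT)⟩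

end NetworkSpace

/-! ### Second countability -/

namespace PointedNetwork

open Network

variable {ι : Type} {X Y : Type*}

/-- The combinatorial data of a ball whose vertices have been numbered: the adjacency relation,
the distinguished vertices and the capacities. -/
abbrev Shape (ι : Type) :=
  Σ n : ℕ, (Fin n → Fin n → Bool) × (ι → Fin n) × (Fin n → ℕ) × (Fin n → Fin n → ℕ)

/-- The numbering `e` of the ball of radius `k` gives it the combinatorial data `σ`. -/
structure HasShape (k : ℕ) (σ : Shape ι) (P : PointedNetwork ι X Y) (e : Fin σ.1 → P.1.V) :
    Prop where
  inj : Function.Injective e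
  range : Set.range e = P.ball k
  adj : ∀ i j, P.1.graph.Adj (e i) (e j) ↔ σ.2.1 i j = true
  pts : ∀ i, e (σ.2.2.1 i) = P.2 i
  b : ∀ i, P.1.b (e i) = σ.2.2.2.1 i
  cap : ∀ (d : P.1.graph.Dart) i j, d.fst = e i → d.snd = e j → P.1.cap d = σ.2.2.2.2 i j

/-- The marks of a numbered ball. -/
def HasShape.marks {k : ℕ} {σ : Shape ι} {P : PointedNetwork ι X Y} {e : Fin σ.1 → P.1.V}
    (h : HasShape k σ P e) : (Fin σ.1 → X) × ({p : Fin σ.1 × Fin σ.1 // σ.2.1 p.1 p.2 = true} → Y) :=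
  (fun i => P.1.vmark (e i), fun p => P.1.emark ⟨(e p.1.1, e p.1.2), (h.adj _ _).2 p.2⟩)

open Classical in
theorem exists_hasShape [Finite ι] (k : ℕ) (P : PointedNetwork ι X Y) :
    ∃ (σ : Shape ι) (e : Fin σ.1 → P.1.V), HasShape k σ P e := by
  have := (P.finite_ball k).fintype
  let e := (Fintype.equivFin (P.ball k)).symm
  refine ⟨⟨_, fun i j => decide (P.1.graph.Adj (e i) (e j)), fun i => e.symm ⟨P.2 i, P.root_mem_ball k i⟩,
    fun i => P.1.b (e i), fun i j => if h : P.1.graph.Adj (e i) (e j) then P.1.cap ⟨(_, _), h⟩ else 0⟩,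
    fun i => e i, ?_⟩
  refine ⟨Subtype.val_injective.comp e.injective, ?_, fun i j => by simp, fun i => by simp,
    fun i => rfl, fun d i j h1 h2 => ?_⟩
  · change Set.range (Subtype.val ∘ e) = _
    rw [e.surjective.range_comp, Subtype.range_coe]
  · obtain ⟨⟨u, v⟩, h⟩ := d
    change u = _ at h1
    change v = _ at h2
    subst h1 h2
    simp [h]

variable [PseudoMetricSpace X] [PseudoMetricSpace Y]

/-- Balls with the same combinatorial data are compared by their marks, in a finite product. -/
theorem near_of_hasShape {k : ℕ} {ε : ℝ} {σ : Shape ι} {P Q : PointedNetwork ι X Y}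
    {e : Fin σ.1 → P.1.V} {f : Fin σ.1 → Q.1.V} (h : HasShape k σ P e) (h' : HasShape k σ Q f)
    (hm : dist h.marks h'.marks < ε) : Near k ε P Q := by
  have := Q.1.connected.nonempty
  let φ : P.1.V → Q.1.V := Function.extend e f fun _ => Classical.arbitrary _
  have hφ : ∀ i, φ (e i) = f i := h.inj.extend_apply _ _
  have hb : ∀ v ∈ P.ball k, ∃ i, e i = v := fun v hv => by rwa [← h.range] at hv
  refine NearBy.near (φ := φ) ⟨fun i => ?_, ⟨fun v hv => ?_, fun u hu v hv huv => ?_, fun w hw => ?_⟩,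
    fun u hu v hv => ?_, fun v hv => ?_, fun v hv => ?_, fun d d' h1 h2 hdd => ?_⟩
  · rw [← h.pts, hφ, h'.pts]
  · obtain ⟨i, rfl⟩ := hb v hv
    rw [hφ, ← h'.range]
    exact mem_range_self i
  · obtain ⟨i, rfl⟩ := hb u hu
    obtain ⟨j, rfl⟩ := hb v hv
    rw [hφ, hφ] at huv
    rw [h'.inj huv]
  · rw [← h'.range] at hw
    obtain ⟨i, rfl⟩ := hw
    exact ⟨e i, h.range ▸ mem_range_self i, hφ i⟩
  · obtain ⟨i, rfl⟩ := hb u hu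
    obtain ⟨j, rfl⟩ := hb v hv
    rw [hφ, hφ, h'.adj, h.adj]
  · obtain ⟨i, rfl⟩ := hb v hv
    rw [hφ, h'.b, h.b]
  · obtain ⟨i, rfl⟩ := hb v hv
    rw [hφ]
    exact (dist_le_pi_dist h.marks.1 h'.marks.1 i).trans_lt ((le_max_left _ _).trans_lt hm)
  · obtain ⟨i, hi⟩ := hb _ h1
    obtain ⟨j, hj⟩ := hb _ h2
    have r1 : d'.fst = f i := by rw [← hdd.1, ← hi, hφ]
    have r2 : d'.snd = f j := by rw [← hdd.2, ← hj, hφ]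
    refine ⟨by rw [h.cap d i j hi.symm hj.symm, h'.cap d' i j r1 r2], ?_⟩
    have ha : σ.2.1 i j = true := (h.adj _ _).1 (by rw [hi, hj]; exact d.adj)
    have m := (dist_le_pi_dist h.marks.2 h'.marks.2 ⟨(i, j), ha⟩).trans_lt
      ((le_max_right _ _).trans_lt hm)
    have e1 : d = ⟨(e i, e j), (h.adj _ _).2 ha⟩ := by
      ext
      · exact hi.symm
      · exact hj.symm
    have e2 : d' = ⟨(f i, f j), (h'.adj _ _).2 ha⟩ := by
      ext
      · exact r1
      · exact r2
    rw [e1, e2]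
    exact m

/-- Countably many networks approximate all networks. -/
theorem exists_countable_near [Finite ι] [SecondCountableTopology X] [SecondCountableTopology Y]
    (k : ℕ) : ∃ C : Set (PointedNetwork ι X Y), C.Countable ∧
      ∀ (Q : PointedNetwork ι X Y) (ε : ℝ), 0 < ε → ∃ P ∈ C, Near k ε P Q := by
  let M : ∀ σ : Shape ι, Set ((Fin σ.1 → X) × ({p : Fin σ.1 × Fin σ.1 // σ.2.1 p.1 p.2 = true} → Y)) :=
    fun σ => {m | ∃ (P : PointedNetwork ι X Y) (e : _) (h : HasShape k σ P e), h.marks = m}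
  choose D hDc hDd using fun σ : Shape ι => TopologicalSpace.exists_countable_dense (M σ)
  choose P e h hm using fun (σ : Shape ι) (m : M σ) => m.2
  refine ⟨⋃ σ, (P σ) '' (D σ), countable_iUnion fun σ => (hDc σ).image _, fun Q ε hε => ?_⟩
  obtain ⟨σ, f, hf⟩ := exists_hasShape k Q
  obtain ⟨m, hmD, hm'⟩ := (hDd σ).exists_dist_lt ⟨hf.marks, Q, f, hf, rfl⟩ hε
  refine ⟨P σ m, mem_iUnion.2 ⟨σ, mem_image_of_mem _ hmD⟩, near_of_hasShape (h σ m) hf ?_⟩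
  rw [hm, dist_comm]
  exact hm'

end PointedNetwork

namespace NetworkSpace

open PointedNetwork Network

variable {ι : Type} {X Y : Type*} [PseudoMetricSpace X] [PseudoMetricSpace Y]

instance [Finite ι] [SecondCountableTopology X] [SecondCountableTopology Y] :
    SecondCountableTopology (NetworkSpace ι X Y) := by
  choose C hC hC' using exists_countable_near (ι := ι) (X := X) (Y := Y)
  refine (TopologicalSpace.isTopologicalBasis_of_isOpen_of_nhds
    (s := ⋃ k, ⋃ n : ℕ, (fun P => nearSet P k (1 / ((n : ℝ) + 1))) '' C k) ?_ ?_).secondCountableTopology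
    (countable_iUnion fun k => countable_iUnion fun n => (hC k).image _)
  · intro U hU
    simp only [mem_iUnion, mem_image] at hU
    obtain ⟨k, n, P, -, rfl⟩ := hU
    exact isOpen_nearSet P k (by positivity)
  · intro q U hq hU
    obtain ⟨k, ε, hε, h⟩ := exists_nearSet_subset hU hq
    obtain ⟨n, hn⟩ := exists_nat_one_div_lt (half_pos hε)
    obtain ⟨P, hP, hPq⟩ := hC' k (Quotient.out q) (1 / ((n : ℝ) + 1)) (by positivity)
    refine ⟨nearSet P k (1 / ((n : ℝ) + 1)), ?_, hPq, fun q' hq' => h ?_⟩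
    · simp only [mem_iUnion]
      exact ⟨k, n, P, hP, rfl⟩
    · exact (hPq.symm.trans hq').mono le_rfl (by linarith)

/-- To check measurability of a map into a space of networks it suffices to consider the sets of
networks with a ball close to a given one. -/
theorem measurable_of_nearSet [Finite ι] [SecondCountableTopology X] [SecondCountableTopology Y]
    {Z : Type*} [MeasurableSpace Z] {f : Z → NetworkSpace ι X Y}
    (h : ∀ P k ε, 0 < ε → MeasurableSet (f ⁻¹' nearSet P k ε)) : Measurable f := by
  have e := borel_eq_generateFrom_of_subbasis (topology_eq (ι := ι) (X := X) (Y := Y))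
  change @Measurable _ _ _ (borel _) f
  rw [e]
  refine measurable_generateFrom ?_
  rintro _ ⟨P, k, ε, hε, rfl⟩
  exact h P k ε hε

end NetworkSpace

end

noncomputable section

/-! ### Points joined to the root -/

open PointedNetwork Network NetworkSpace

variable {X Y : Type*}

/-- The networks whose distinguished vertex is joined to a point of `E` by a walk of length `n`. -/
def walkSet (E : Set (VertexNetwork X Y)) : ℕ → Set (VertexNetwork X Y)
  | 0 => E
  | n + 1 => {P | ∃ d ∈ P.1.inDarts P.2, (⟨P.1, d.fst⟩ : VertexNetwork X Y) ∈ walkSet E n}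

theorem mem_walkSet {E : Set (VertexNetwork X Y)} {N : Network X Y} {u v : N.V}
    (p : N.graph.Walk u v) (h : (⟨N, v⟩ : VertexNetwork X Y) ∈ E) :
    (⟨N, u⟩ : VertexNetwork X Y) ∈ walkSet E p.length := by
  induction p with
  | nil => exact h
  | cons ha p ih => exact ⟨⟨(_, _), ha.symm⟩, (mem_inDarts N).2 rfl, ih h⟩

theorem exists_of_mem_walkSet {E : Set (VertexNetwork X Y)} {N : Network X Y} {u : N.V} {n : ℕ}
    (h : (⟨N, u⟩ : VertexNetwork X Y) ∈ walkSet E n) : ∃ v, (⟨N, v⟩ : VertexNetwork X Y) ∈ E := by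
  induction n generalizing u with
  | zero => exact ⟨u, h⟩
  | succ n ih =>
    obtain ⟨d, -, hd⟩ := h
    exact ih hd

/-- A sum over all vertices of a function that vanishes off the neighbours of `v` is a sum over the
directed edges into `v`. -/
theorem sum_inDarts_eq_tsum (N : Network X Y) (v : N.V) (f : N.graph.Dart → ℝ≥0∞)
    (F : N.V → ℝ≥0∞) (h : ∀ d, d.snd = v → F d.fst = f d) (h0 : ∀ u, ¬ N.graph.Adj u v → F u = 0) :
    ∑' u, F u = ∑ d ∈ N.inDarts v, f d := by
  classical
  rw [tsum_eq_sum (s := (N.inDarts v).image fun d => d.fst), Finset.sum_image]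
  · exact Finset.sum_congr rfl fun d hd => h d ((mem_inDarts N).1 hd)
  · intro d hd d' hd' e
    ext
    · exact e
    · exact ((mem_inDarts N).1 hd).trans ((mem_inDarts N).1 hd').symm
  · intro u hu
    refine h0 u fun ha => hu (Finset.mem_image.2 ⟨⟨(u, v), ha⟩, (mem_inDarts N).2 rfl, rfl⟩)

variable [PseudoMetricSpace Y]

theorem measurableSet_walkSet {E : Set (VertexNetwork X Y)} (hE : MeasurableSet E) (n : ℕ) :
    MeasurableSet (walkSet E n) := by
  induction n with
  | zero => exact hE
  | succ n ih => exact measurableSet_exists_inDarts (measurable_dart_fst ih)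

theorem measurableSet_exists_vertex {E : Set (VertexNetwork X Y)} (hE : MeasurableSet E) :
    MeasurableSet {P : VertexNetwork X Y | ∃ v, (⟨P.1, v⟩ : VertexNetwork X Y) ∈ E} := by
  have : {P : VertexNetwork X Y | ∃ v, (⟨P.1, v⟩ : VertexNetwork X Y) ∈ E} = ⋃ n, walkSet E n := by
    ext P
    rw [mem_iUnion]
    constructor
    · rintro ⟨v, hv⟩
      obtain ⟨p⟩ := P.1.connected.preconnected P.2 v
      exact ⟨p.length, mem_walkSet p hv⟩
    · rintro ⟨n, hn⟩
      exact exists_of_mem_walkSet hn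
  rw [this]
  exact MeasurableSet.iUnion fun n => measurableSet_walkSet hE n

theorem measurableSet_exists_dart {E : Set (DartNetwork X Y)} (hE : MeasurableSet E) :
    MeasurableSet {P : VertexNetwork X Y | ∃ d, (⟨P.1, d⟩ : DartNetwork X Y) ∈ E} := by
  convert measurableSet_exists_vertex (measurableSet_exists_inDarts hE) using 1
  ext P
  exact ⟨fun ⟨d, h⟩ => ⟨d.snd, d, (mem_inDarts _).2 rfl, h⟩, fun ⟨_, d, _, h⟩ => ⟨d, h⟩⟩

/-! ### The Mass-Transport Principle for directed edges -/

variable [PseudoMetricSpace X]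

/-- Passing to a representative is measurable. -/
theorem measurable_toVertexNetwork :
    Measurable fun q : RootedSpace X Y => (⟨q.net, q.root⟩ : VertexNetwork X Y) := by
  refine measurable_generateFrom ?_
  rintro E ⟨k, hE⟩
  refine (isOpen_of_isNearOpen (Ψ := fun P : PointedNetwork (Fin 1) X Y =>
    (⟨P.1, P.2 0⟩ : VertexNetwork X Y) ∈ E) fun P hP => ⟨k + 1, 1, one_pos, fun Q hQ => ?_⟩).measurableSet
  obtain ⟨φ, h1, h2⟩ := hQ.exists_goodAt
  exact (hE ⟨P.1, P.2 0⟩ ⟨Q.1, Q.2 0⟩ φ (h1 0) fun v hv => h2 v ⟨0, hv⟩).1 hP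

open Classical in
/-- The function of a network with two distinguished vertices that is `f` if they are the
endpoints of a directed edge and `0` otherwise. -/
def dartFun (f : DartNetwork X Y → ℝ≥0∞) (P : PointedNetwork (Fin 2) X Y) : ℝ≥0∞ :=
  if h : P.1.graph.Adj (P.2 0) (P.2 1) then f ⟨P.1, ⟨(P.2 0, P.2 1), h⟩⟩ else 0

theorem isOpen_exists_dart {E : Set (DartNetwork X Y)} (hE : IsLocalDartSet E) :
    IsOpen {q : BirootedSpace X Y | ∃ h : q.net.graph.Adj (q.pts 0) (q.pts 1),
      (⟨q.net, ⟨(q.pts 0, q.pts 1), h⟩⟩ : DartNetwork X Y) ∈ E} := by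
  obtain ⟨k, hE⟩ := hE
  refine isOpen_of_isNearOpen (Ψ := fun P : PointedNetwork (Fin 2) X Y =>
    ∃ h : P.1.graph.Adj (P.2 0) (P.2 1), (⟨P.1, ⟨(P.2 0, P.2 1), h⟩⟩ : DartNetwork X Y) ∈ E)
    fun P ⟨h, hP⟩ => ⟨k + 1, 1, one_pos, fun Q hQ => ?_⟩
  obtain ⟨φ, h1, h2⟩ := hQ.exists_goodAt
  have ha : Q.1.graph.Adj (Q.2 0) (Q.2 1) := by
    rw [← h1, ← h1]
    exact (h2 _ (P.root_mem_ball k 0)).bij.mapsTo h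
  refine ⟨ha, (hE ⟨P.1, ⟨(P.2 0, P.2 1), h⟩⟩ ⟨Q.1, ⟨(Q.2 0, Q.2 1), ha⟩⟩ φ ⟨h1 0, h1 1⟩
    fun v hv => h2 v ?_).1 hP⟩
  rcases hv with hv | hv
  · exact ⟨0, hv⟩
  · exact ⟨1, hv⟩

/-- Extension by zero makes functions of a directed edge admissible in the definition of
unimodularity. -/
theorem measurable_dartFun {f : DartNetwork X Y → ℝ≥0∞} (hf : Measurable f) :
    Measurable fun q : BirootedSpace X Y => dartFun f (Quotient.out q) := by
  classical
  have hA : MeasurableSet {q : BirootedSpace X Y | q.net.graph.Adj (q.pts 0) (q.pts 1)} := by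
    have := (isOpen_exists_dart (X := X) (Y := Y) (E := univ) ⟨0, by simp⟩).measurableSet
    simpa using this
  refine Measurable.dite (s := {q : BirootedSpace X Y | q.net.graph.Adj (q.pts 0) (q.pts 1)})
    (f := fun q => f ⟨q.1.net, ⟨(q.1.pts 0, q.1.pts 1), q.2⟩⟩) (g := fun _ => 0)
    (hf.comp ?_) measurable_const hA
  refine measurable_generateFrom ?_
  intro E hE
  refine ⟨_, (isOpen_exists_dart hE).measurableSet, ?_⟩
  ext q
  exact ⟨fun ⟨_, h⟩ => h, fun h => ⟨q.2, h⟩⟩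

theorem dartFun_eq {f : DartNetwork X Y → ℝ≥0∞} (hf : Measurable f)
    {P Q : PointedNetwork (Fin 2) X Y} (h : Isomorphic P Q) : dartFun f P = dartFun f Q := by
  obtain ⟨φ, h1, h2⟩ := h.exists_goodAt
  obtain ⟨ψ, h1', h2'⟩ := (isomorphic_equivalence.symm h).exists_goodAt
  by_cases ha : P.1.graph.Adj (P.2 0) (P.2 1)
  · have hb : Q.1.graph.Adj (Q.2 0) (Q.2 1) := by
      rw [← h1, ← h1]
      exact (h2 _).bij.mapsTo ha
    rw [dartFun, dartFun, dif_pos ha, dif_pos hb]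
    exact eq_of_good hf φ ⟨h1 0, h1 1⟩ h2
  · have hb : ¬ Q.1.graph.Adj (Q.2 0) (Q.2 1) := fun hb => ha <| by
      rw [← h1', ← h1']
      exact (h2' _).bij.mapsTo hb
    rw [dartFun, dartFun, dif_neg ha, dif_neg hb]

/-- The Mass-Transport Principle for mass sent along directed edges. -/
theorem IsUnimodular.lintegral_sum_inDarts {ρ : Measure (RootedSpace X Y)} (hρ : IsUnimodular ρ)
    {f : DartNetwork X Y → ℝ≥0∞} (hf : Measurable f) :
    ∫⁻ q, ∑ d ∈ q.net.inDarts q.root, f ⟨q.net, d.symm⟩ ∂ρ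
      = ∫⁻ q, ∑ d ∈ q.net.inDarts q.root, f ⟨q.net, d⟩ ∂ρ := by
  have h := hρ.massTransport (fun q => dartFun f (Quotient.out q)) (measurable_dartFun hf)
  have e : ∀ (N : Network X Y) (u v : N.V), dartFun f (Quotient.out (NetworkSpace.mk N ![u, v]))
      = dartFun f ⟨N, ![u, v]⟩ := fun N u v => dartFun_eq hf (isomorphic_out_mk ⟨N, ![u, v]⟩)
  simp only [e] at h
  convert h using 1
  · refine lintegral_congr fun q => (sum_inDarts_eq_tsum _ _ _ _ (fun d hd => ?_) fun u hu => ?_).symm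
    · rw [← hd]
      exact dif_pos d.symm.adj
    · exact dif_neg fun h => hu h.symm
  · refine lintegral_congr fun q => (sum_inDarts_eq_tsum _ _ _ _ (fun d hd => ?_) fun u hu => ?_).symm
    · rw [← hd]
      exact dif_pos d.adj
    · exact dif_neg fun h => hu h

theorem measurable_comp_root {Z : Type*} [MeasurableSpace Z] {f : VertexNetwork X Y → Z}
    (hf : Measurable f) : Measurable fun q : RootedSpace X Y => f ⟨q.net, q.root⟩ :=
  hf.comp measurable_toVertexNetwork

/-- What almost surely does not happen at the root almost surely happens nowhere. -/
theorem IsUnimodular.ae_forall_vertex {ρ : Measure (RootedSpace X Y)} (hρ : IsUnimodular ρ)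
    {E : Set (VertexNetwork X Y)} (hE : MeasurableSet E)
    (h : ∀ᵐ q ∂ρ, (⟨q.net, q.root⟩ : VertexNetwork X Y) ∉ E) :
    ∀ᵐ q ∂ρ, ∀ v : q.net.V, (⟨q.net, v⟩ : VertexNetwork X Y) ∉ E := by
  have hn : ∀ n, ∀ᵐ q ∂ρ, (⟨q.net, q.root⟩ : VertexNetwork X Y) ∉ walkSet E n := by
    intro n
    induction n with
    | zero => exact h
    | succ n ih =>
      have hm : Measurable fun p : DartNetwork X Y =>
          (walkSet E n).indicator (fun _ => (1 : ℝ≥0∞)) ⟨p.1, p.2.fst⟩ :=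
        (measurable_const.indicator (measurableSet_walkSet hE n)).comp measurable_dart_fst
      have e := hρ.lintegral_sum_inDarts hm
      have z : ∫⁻ q : RootedSpace X Y, ∑ d ∈ q.net.inDarts q.root,
          (walkSet E n).indicator (fun _ => (1 : ℝ≥0∞)) ⟨q.net, d.symm.fst⟩ ∂ρ = 0 := by
        rw [lintegral_eq_zero_of_ae_eq_zero]
        filter_upwards [ih] with q hq
        refine Finset.sum_eq_zero fun d hd => indicator_of_notMem ?_ _
        have : d.symm.fst = q.root := (mem_inDarts _).1 hd
        rwa [this]
      rw [z, eq_comm, lintegral_eq_zero_iff (measurable_comp_root (measurable_sum_inDarts hm))] at e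
      filter_upwards [e] with q hq ⟨d, hd, hd'⟩
      have := Finset.sum_eq_zero_iff.1 hq d hd
      rw [indicator_of_mem hd'] at this
      exact one_ne_zero this
  filter_upwards [ae_all_iff.2 hn] with q hq v hv
  obtain ⟨p⟩ := q.net.connected.preconnected q.root v
  exact hq _ (mem_walkSet p hv)

/-- The version of `IsUnimodular.ae_forall_vertex` for directed edges. -/
theorem IsUnimodular.ae_forall_dart {ρ : Measure (RootedSpace X Y)} (hρ : IsUnimodular ρ)
    {E : Set (DartNetwork X Y)} (hE : MeasurableSet E)
    (h : ∀ᵐ q ∂ρ, ∀ d ∈ q.net.inDarts q.root, (⟨q.net, d⟩ : DartNetwork X Y) ∉ E) :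
    ∀ᵐ q ∂ρ, ∀ d : q.net.graph.Dart, (⟨q.net, d⟩ : DartNetwork X Y) ∉ E := by
  filter_upwards [hρ.ae_forall_vertex (measurableSet_exists_inDarts hE)
    (h.mono fun q hq ⟨d, hd, hd'⟩ => hq d hd hd')] with q hq d hd
  exact hq d.snd ⟨d, (mem_inDarts _).2 rfl, hd⟩

end

noncomputable section

/-! ### Functions approximated by local ones -/

open PointedNetwork Network NetworkSpace

variable {ι : Type} {X Y : Type*}

section approximation

variable [PseudoMetricSpace Y]

/-- The `ℕ`-valued functions of a directed edge obtained from those that depend on a ball only by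
repeatedly taking pointwise limits of sequences. -/
inductive LocalLimit : (DartNetwork X Y → ℕ) → Prop
  | loc (a : DartNetwork X Y → ℕ) (k : ℕ)
      (h : ∀ (P Q : DartNetwork X Y) (φ : P.1.V → Q.1.V), DartRel φ P.2 Q.2 →
        (∀ v, P.1.graph.dist P.2.fst v ≤ k ∨ P.1.graph.dist P.2.snd v ≤ k → GoodAt φ v) →
          a P = a Q) : LocalLimit a
  | lim (a : DartNetwork X Y → ℕ) (u : ℕ → DartNetwork X Y → ℕ) (hu : ∀ n, LocalLimit (u n))
      (h : ∀ p, ∀ᶠ n in atTop, u n p = a p) : LocalLimit a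

theorem LocalLimit.map₂ (g : ℕ → ℕ → ℕ) {a b : DartNetwork X Y → ℕ} (ha : LocalLimit a)
    (hb : LocalLimit b) : LocalLimit fun p => g (a p) (b p) := by
  induction ha with
  | loc a k h =>
    induction hb with
    | loc b l h' =>
      refine .loc _ (max k l) fun P Q φ h1 h2 => ?_
      rw [h P Q φ h1 fun v hv => h2 v ?_, h' P Q φ h1 fun v hv => h2 v ?_]
      · exact hv.imp (fun h => h.trans (le_max_right _ _)) fun h => h.trans (le_max_right _ _)
      · exact hv.imp (fun h => h.trans (le_max_left _ _)) fun h => h.trans (le_max_left _ _)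
    | lim b u _ h' ih => exact .lim _ _ ih fun p => (h' p).mono fun n hn => by rw [hn]
  | lim a u _ h ih => exact .lim _ _ ih fun p => (h p).mono fun n hn => by rw [hn]

open Classical in
theorem localLimit_indicator {E : Set (DartNetwork X Y)} (hE : MeasurableSet E) :
    LocalLimit fun p => if p ∈ E then 1 else 0 := by
  induction E, hE using MeasurableSpace.generateFrom_induction with
  | hC E hE _ =>
    obtain ⟨k, hk⟩ := hE
    exact .loc _ k fun P Q φ h1 h2 => by simp only [hk P Q φ h1 h2]
  | empty => exact .loc _ 0 fun _ _ _ _ _ => by simp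
  | compl E _ ih =>
    convert ih.map₂ (fun x _ => 1 - x) ih using 2 with p
    by_cases h : p ∈ E <;> simp [h]
  | iUnion E _ ih =>
    have h : ∀ n, LocalLimit fun p => if p ∈ ⋃ i < n, E i then 1 else 0 := by
      intro n
      induction n with
      | zero => exact .loc _ 0 fun _ _ _ _ _ => by simp
      | succ n hn =>
        convert hn.map₂ max (ih n) using 2 with p
        rw [biUnion_lt_succ]
        by_cases h : p ∈ E n <;> by_cases h' : p ∈ ⋃ i < n, E i <;> simp only [mem_union, h, h'] <;> simp
    refine .lim _ _ h fun p => ?_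
    by_cases hp : p ∈ ⋃ i, E i
    · obtain ⟨i, hi⟩ := mem_iUnion.1 hp
      filter_upwards [eventually_gt_atTop i] with n hn
      rw [if_pos hp, if_pos (mem_iUnion₂.2 ⟨i, hn, hi⟩)]
    · refine Eventually.of_forall fun n => ?_
      rw [if_neg hp, if_neg]
      exact fun h => hp (iUnion₂_subset_iUnion _ _ h)

/-- Since measurable functions are limits of local ones, the preimages needed in `measurable_mark`
can be treated by induction. -/
theorem localLimit_of_measurable {a : DartNetwork X Y → ℕ} (ha : Measurable a) : LocalLimit a := by
  classical
  have h : ∀ n, LocalLimit fun p => if a p < n then a p else 0 := by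
    intro n
    induction n with
    | zero => exact .loc _ 0 fun _ _ _ _ _ => by simp
    | succ n hn =>
      convert hn.map₂ (fun x y => x + n * y)
        (localLimit_indicator (ha (measurableSet_singleton n))) using 2 with p
      simp only [mem_preimage, mem_singleton_iff]
      split_ifs <;> omega
  refine .lim _ _ h fun p => ?_
  filter_upwards [eventually_gt_atTop (a p)] with n hn
  rw [if_pos hn]

end approximation

/-! ### Adding marks -/

/-- Add a mark in `ℕ` to every directed edge. -/
def Network.addMark (N : Network X Y) (a : N.graph.Dart → ℕ) : Network X (Y × ℕ) :=
  { V := N.V, graph := N.graph, connected := N.connected, locallyFinite := N.locallyFinite,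
    b := N.b, c := N.c, vmark := N.vmark, emark := fun d => (N.emark d, a d) }

namespace PointedNetwork

/-- Add the mark `a` to every directed edge. -/
def mark (a : DartNetwork X Y → ℕ) (P : PointedNetwork ι X Y) : PointedNetwork ι X (Y × ℕ) :=
  ⟨P.1.addMark fun d => a ⟨P.1, d⟩, P.2⟩

/-- Forget the additional mark. -/
def forget (P : PointedNetwork ι X (Y × ℕ)) : PointedNetwork ι X Y := ⟨P.1.forget, P.2⟩

theorem Isomorphic.forget {P Q : PointedNetwork ι X (Y × ℕ)} (h : Isomorphic P Q) :
    Isomorphic P.forget Q.forget := by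
  obtain ⟨φ, h⟩ := isomorphic_iff.1 h
  exact isomorphic_iff.2 ⟨φ, h.pts, h.b, h.c, h.vmark, fun d => congrArg Prod.fst (h.emark d)⟩

variable [PseudoMetricSpace X] [PseudoMetricSpace Y] {k : ℕ} {ε : ℝ}

theorem Isomorphic.mark [Nonempty ι] {a : DartNetwork X Y → ℕ} (ha : Measurable a)
    {P Q : PointedNetwork ι X Y} (h : Isomorphic P Q) : Isomorphic (P.mark a) (Q.mark a) := by
  obtain ⟨φ, h⟩ := isomorphic_iff.1 h
  exact isomorphic_iff.2 ⟨φ, h.pts, h.b, h.c, h.vmark, fun d => Prod.ext (h.emark d)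
    (eq_of_good ha (P := ⟨P.1, d⟩) (Q := ⟨Q.1, φ.toHom.mapDart d⟩) φ ⟨rfl, rfl⟩ h.goodAt).symm⟩

theorem NearBy.forget {P Q : PointedNetwork ι X (Y × ℕ)} {φ : P.1.V → Q.1.V}
    (h : NearBy k ε P Q φ) : NearBy k ε P.forget Q.forget φ where
  pts := h.pts
  bij := h.bij
  adj := h.adj
  b := h.b
  vmark := h.vmark
  dart d d' h1 h2 h3 := ⟨(h.dart d d' h1 h2 h3).1,
    (le_max_left _ _).trans_lt (h.dart d d' h1 h2 h3).2⟩

theorem NearBy.mark {P Q : PointedNetwork ι X Y} {φ : P.1.V → Q.1.V}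
    (h : NearBy k ε P Q φ) (hε : 0 < ε) {a a' : DartNetwork X Y → ℕ}
    (ha : ∀ d d', d.fst ∈ P.ball k → d.snd ∈ P.ball k → DartRel φ d d' →
      a ⟨P.1, d⟩ = a' ⟨Q.1, d'⟩) : NearBy k ε (P.mark a) (Q.mark a') φ where
  pts := h.pts
  bij := h.bij
  adj := h.adj
  b := h.b
  vmark := h.vmark
  dart d d' h1 h2 h3 := by
    refine ⟨(h.dart d d' h1 h2 h3).1, max_lt (h.dart d d' h1 h2 h3).2 ?_⟩
    have e := ha d d' h1 h2 h3
    change dist (a ⟨P.1, d⟩) (a' ⟨Q.1, d'⟩) < ε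
    rw [e, dist_self]
    exact hε

theorem Near.mark_congr {P : PointedNetwork ι X (Y × ℕ)} {Q : PointedNetwork ι X Y}
    {a a' : DartNetwork X Y → ℕ} (h : Near k ε P (Q.mark a))
    (ha : ∀ d : Q.1.graph.Dart, d.fst ∈ Q.ball k → d.snd ∈ Q.ball k → a ⟨Q.1, d⟩ = a' ⟨Q.1, d⟩) :
    Near k ε P (Q.mark a') := by
  obtain ⟨φ, h⟩ := near_iff.1 h
  refine near_iff.2 ⟨φ, h.pts, h.bij, h.adj, h.b, h.vmark, fun d d' h1 h2 h3 => ?_⟩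
  have := h.dart d d' h1 h2 h3
  refine ⟨this.1, ?_⟩
  have e := ha d' (h3.1 ▸ h.bij.mapsTo h1) (h3.2 ▸ h.bij.mapsTo h2)
  have e' : (Q.mark a').1.emark d' = (Q.mark a).1.emark d' := Prod.ext rfl e.symm
  rw [e']
  exact this.2

/-- Adding local marks is continuous in the local topology: marks on the ball of radius `k` are
determined by a larger ball. -/
theorem isNearOpen_mark [Finite ι] {a : DartNetwork X Y → ℕ} {K : ℕ}
    (ha : ∀ (P Q : DartNetwork X Y) (φ : P.1.V → Q.1.V), DartRel φ P.2 Q.2 →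
      (∀ v, P.1.graph.dist P.2.fst v ≤ K ∨ P.1.graph.dist P.2.snd v ≤ K → GoodAt φ v) → a P = a Q)
    (P : PointedNetwork ι X (Y × ℕ)) (k : ℕ) (ε : ℝ) :
    IsNearOpen fun Q : PointedNetwork ι X Y => Near k ε P (Q.mark a) := by
  intro Q hQ
  obtain ⟨k', δ, hδ, h⟩ := isNearOpen_near P k ε _ hQ
  refine ⟨k' + K + 1, min δ 1, lt_min hδ one_pos, fun S hS => h _ ?_⟩
  obtain ⟨φ, hφ⟩ := near_iff.1 hS
  refine ((hφ.mono (by omega) (min_le_left _ _)).mark hδ fun d d' h1 h2 h3 => ?_).near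
  have hb : ∀ u v, u ∈ Q.ball k' → Q.1.graph.dist u v ≤ K → v ∈ Q.ball (k' + K) := by
    rintro u v ⟨i, hi⟩ huv
    exact ⟨i, (Q.1.connected.dist_triangle (v := u)).trans (add_le_add hi huv)⟩
  refine ha ⟨Q.1, d⟩ ⟨S.1, d'⟩ φ h3 fun v hv => (hφ.mono le_rfl (min_le_right _ _)).goodAt ?_
  rcases hv with hv | hv
  · exact hb _ _ h1 hv
  · exact hb _ _ h2 hv

end PointedNetwork

namespace NetworkSpace

/-- Add the mark `a` to every directed edge. -/
def mark (a : DartNetwork X Y → ℕ) (q : NetworkSpace ι X Y) : NetworkSpace ι X (Y × ℕ) :=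
  NetworkSpace.mk (q.net.addMark fun d => a ⟨q.net, d⟩) q.pts

theorem isomorphic_out_mark (a : DartNetwork X Y → ℕ) (q : NetworkSpace ι X Y) :
    Isomorphic (Quotient.out (q.mark a)) ((Quotient.out q).mark a) :=
  isomorphic_out_mk ((Quotient.out q).mark a)

variable [PseudoMetricSpace X] [PseudoMetricSpace Y]

theorem mark_mk [Nonempty ι] {a : DartNetwork X Y → ℕ} (ha : Measurable a)
    (P : PointedNetwork ι X Y) :
    (NetworkSpace.mk P.1 P.2).mark a = NetworkSpace.mk (P.mark a).1 (P.mark a).2 :=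
  mk_eq_mk (P := (Quotient.out (NetworkSpace.mk P.1 P.2)).mark a) ((isomorphic_out_mk P).mark ha)

theorem preimage_mark_nearSet (a : DartNetwork X Y → ℕ) (P : PointedNetwork ι X (Y × ℕ)) (k : ℕ)
    (ε : ℝ) : NetworkSpace.mark a ⁻¹' nearSet P k ε
      = {q | Near k ε P ((Quotient.out q).mark a)} := by
  ext q
  exact ⟨fun h => Near.trans_isomorphic h (isomorphic_out_mark a q), fun h =>
    Near.trans_isomorphic h (isomorphic_equivalence.symm (isomorphic_out_mark a q))⟩

/-- Adding marks that depend measurably on the network is measurable. -/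
theorem measurable_mark [Finite ι] [SecondCountableTopology X] [SecondCountableTopology Y]
    {a : DartNetwork X Y → ℕ} (ha : Measurable a) :
    Measurable (NetworkSpace.mark a : NetworkSpace ι X Y → NetworkSpace ι X (Y × ℕ)) := by
  refine measurable_of_nearSet fun P k ε _ => ?_
  rw [preimage_mark_nearSet]
  have := localLimit_of_measurable ha
  clear ha
  induction this with
  | loc a K h => exact (isOpen_of_isNearOpen (isNearOpen_mark h P k ε)).measurableSet
  | lim a u _ h ih =>
    have e : {q : NetworkSpace ι X Y | Near k ε P ((Quotient.out q).mark a)}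
        = {q | ∀ᶠ n in atTop, Near k ε P ((Quotient.out q).mark (u n))} := by
      ext q
      -- only finitely many marks in the ball matter, and these are eventually constant
      have hfd : {d : q.net.graph.Dart | d.fst ∈ (Quotient.out q).ball k ∧
          d.snd ∈ (Quotient.out q).ball k}.Finite := by
        have hf := (Quotient.out q).finite_ball k
        refine Finite.of_injOn (f := fun d => (d.fst, d.snd))
          (t := (Quotient.out q).ball k ×ˢ (Quotient.out q).ball k)
          (fun d hd => ⟨hd.1, hd.2⟩) (fun d _ d' _ e => ?_) (hf.prod hf)
        ext
        · exact congrArg Prod.fst e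
        · exact congrArg Prod.snd e
      have hev := (eventually_all_finite hfd).2 fun d _ => h ⟨q.net, d⟩
      constructor
      · intro hq
        filter_upwards [hev] with n hn
        exact hq.mark_congr fun d h1 h2 => (hn d ⟨h1, h2⟩).symm
      · intro hq
        obtain ⟨n, h1, h2⟩ := (hq.and hev).exists
        exact h1.mark_congr fun d h3 h4 => h2 d ⟨h3, h4⟩
    rw [e]
    simp only [eventually_atTop, ofPred_exists, ofPred_forall]
    exact MeasurableSet.iUnion fun n => MeasurableSet.iInter fun m => MeasurableSet.iInter fun _ => ih m

end NetworkSpace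

end

noncomputable section

/-! ### Markings that are functions of the network -/

open PointedNetwork Network NetworkSpace

variable {X Y : Type*}

theorem tsum_comp_iso {N N' : Network X Y} (φ : N.graph ≃g N'.graph) (f : N'.V → ℝ≥0∞) :
    ∑' v, f v = ∑' v, f (φ v) := (φ.toEquiv.tsum_eq f).symm

theorem isomorphic_out_forget (q : RootedSpace X (Y × ℕ)) :
    Isomorphic (Quotient.out q.forget) (Quotient.out q).forget :=
  isomorphic_out_mk (Quotient.out q).forget

theorem forget_mark (a : DartNetwork X Y → ℕ) (q : RootedSpace X Y) :
    RootedSpace.forget (q.mark a) = q :=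
  (mk_eq_mk (isomorphic_out_mark a q).forget).trans (mk_out q)

theorem PointedNetwork.mark_forget {ι : Type} {a : DartNetwork X Y → ℕ}
    {P : PointedNetwork ι X (Y × ℕ)} (h : ∀ d, P.1.extraMark d = a ⟨P.1.forget, d⟩) :
    P.forget.mark a = P :=
  congrArg (fun f => (⟨P.1.forget.addMark f, P.2⟩ : PointedNetwork ι X (Y × ℕ))) (funext h).symm

variable [PseudoMetricSpace Y]

theorem Network.GoodAt.forget {N N' : Network X (Y × ℕ)} {φ : N.V → N'.V} {v : N.V}
    (h : GoodAt φ v) : GoodAt (N := N.forget) (N' := N'.forget) φ v :=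
  ⟨h.b, h.bij, fun d d' h1 h2 => ⟨(h.dart d d' h1 h2).1,
    (le_max_left _ _).trans_lt (h.dart d d' h1 h2).2.1,
    (le_max_left _ _).trans_lt (h.dart d d' h1 h2).2.2⟩⟩

/-- Marks in `ℕ` at distance less than `1` are equal. -/
theorem extraMark_eq {N N' : Network X (Y × ℕ)} {φ : N.V → N'.V} {d : N.graph.Dart}
    {d' : N'.graph.Dart} (h : GoodAt φ d.fst) (hd : DartRel φ d d') :
    N.extraMark d = N'.extraMark d' := by
  have := (le_max_right _ _).trans_lt (h.dart d d' rfl hd).2.1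
  by_contra hne
  exact absurd this (not_lt.2 (Nat.pairwise_one_le_dist hne))

theorem measurable_dart_forget : Measurable fun p : DartNetwork X (Y × ℕ) =>
    (⟨p.1.forget, p.2⟩ : DartNetwork X Y) :=
  measurable_generateFrom fun _ ⟨k, hE⟩ => MeasurableSpace.measurableSet_generateFrom
    ⟨k, fun P Q φ h1 h2 => hE ⟨P.1.forget, P.2⟩ ⟨Q.1.forget, Q.2⟩ φ h1 fun v hv => (h2 v hv).forget⟩

theorem measurable_extraMark : Measurable fun p : DartNetwork X (Y × ℕ) => p.1.extraMark p.2 :=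
  measurable_dart_of_local 0 fun P Q φ h1 h2 => extraMark_eq (h2 _ (Or.inl (by simp))) h1

variable [PseudoMetricSpace X]

theorem measurable_forget [SecondCountableTopology X] [SecondCountableTopology Y] :
    Measurable (RootedSpace.forget : RootedSpace X (Y × ℕ) → RootedSpace X Y) := by
  refine measurable_of_nearSet fun P k ε _ => ?_
  have e : RootedSpace.forget ⁻¹' nearSet P k ε
      = {q : RootedSpace X (Y × ℕ) | Near k ε P (Quotient.out q).forget} := by
    ext q
    exact ⟨fun h => Near.trans_isomorphic h (isomorphic_out_forget q), fun h =>
      Near.trans_isomorphic h (isomorphic_equivalence.symm (isomorphic_out_forget q))⟩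
  rw [e]
  refine (isOpen_of_isNearOpen (Ψ := fun Q : PointedNetwork (Fin 1) X (Y × ℕ) =>
    Near k ε P Q.forget) fun Q hQ => ?_).measurableSet
  obtain ⟨k', δ, hδ, h⟩ := isNearOpen_near P k ε _ hQ
  refine ⟨k', δ, hδ, fun S hS => h _ ?_⟩
  obtain ⟨φ, hφ⟩ := near_iff.1 hS
  exact hφ.forget.near

/-- The range consists of the networks whose additional marks are the prescribed function of the
remaining structure. -/
theorem range_mark {a : DartNetwork X Y → ℕ} (ha : Measurable a) :
    range (NetworkSpace.mark a : RootedSpace X Y → RootedSpace X (Y × ℕ))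
      = {q | ∃ d : q.net.graph.Dart, q.net.extraMark d ≠ a ⟨q.net.forget, d⟩}ᶜ := by
  ext q
  constructor
  · rintro ⟨q, rfl⟩ ⟨d, hd⟩
    obtain ⟨φ, h⟩ := isomorphic_iff.1 (isomorphic_out_mark a q)
    obtain ⟨φ', h'⟩ := isomorphic_iff.1 (isomorphic_out_mark a q).forget
    refine hd ?_
    rw [extraMark_eq (h.goodAt _) (d := d) (d' := φ.toHom.mapDart d) ⟨rfl, rfl⟩]
    have hi : IsIso (Quotient.out (q.mark a)).forget (Quotient.out q) φ :=
      ⟨h.pts, h.b, h.c, h.vmark, fun d => congrArg Prod.fst (h.emark d)⟩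
    exact (eq_of_good ha (P := ⟨(q.mark a).net.forget, d⟩) (Q := ⟨q.net, φ.toHom.mapDart d⟩) φ ⟨rfl, rfl⟩
      hi.goodAt).symm
  · intro hq
    have h : ∀ d : q.net.graph.Dart, q.net.extraMark d = a ⟨q.net.forget, d⟩ := fun d => by
      by_contra h
      exact hq ⟨d, h⟩
    refine ⟨RootedSpace.forget q, (mark_mk ha (Quotient.out q).forget).trans ?_⟩
    rw [PointedNetwork.mark_forget h]
    exact mk_out q

/-- A marking that is a measurable function of the network embeds the space of rooted networks in
the space of marked ones. -/
theorem measurableEmbedding_mark [SecondCountableTopology X] [SecondCountableTopology Y]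
    {a : DartNetwork X Y → ℕ} (ha : Measurable a) :
    MeasurableEmbedding (NetworkSpace.mark a : RootedSpace X Y → RootedSpace X (Y × ℕ)) := by
  refine MeasurableEmbedding.of_measurable_inverse (measurable_mark ha) ?_ measurable_forget
    (forget_mark a)
  rw [range_mark ha]
  have hE : MeasurableSet {p : DartNetwork X (Y × ℕ) | p.1.extraMark p.2 ≠ a ⟨p.1.forget, p.2⟩} :=
    (measurableSet_eq_fun measurable_extraMark (ha.comp measurable_dart_forget)).compl
  exact (measurable_toVertexNetwork (measurableSet_exists_dart hE)).compl

/-- Adding marks that are a measurable function of the network preserves unimodularity. -/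
theorem IsUnimodular.map_mark [SecondCountableTopology X] [SecondCountableTopology Y]
    {ρ : Measure (RootedSpace X Y)} (hρ : IsUnimodular ρ) {a : DartNetwork X Y → ℕ}
    (ha : Measurable a) : IsUnimodular (ρ.map (NetworkSpace.mark a)) := by
  have := hρ.isProbabilityMeasure
  refine ⟨Measure.isProbabilityMeasure_map (measurable_mark ha).aemeasurable, fun f hf => ?_⟩
  rw [(measurableEmbedding_mark ha).lintegral_map, (measurableEmbedding_mark ha).lintegral_map]
  have h := hρ.massTransport (f ∘ NetworkSpace.mark a) (hf.comp (measurable_mark ha))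
  -- `c` is one of the two orders of the root and the other vertex
  have e : ∀ (q : RootedSpace X Y) (c : ∀ {N : Type}, N → N → Fin 2 → N)
      (hc : ∀ {N N' : Type} (φ : N → N') (u v : N), φ ∘ c u v = c (φ u) (φ v)),
      ∑' v, f (NetworkSpace.mk (q.mark a).net (c (q.mark a).root v))
        = ∑' v, (f ∘ NetworkSpace.mark a) (NetworkSpace.mk q.net (c q.root v)) := by
    intro q c hc
    obtain ⟨φ, h⟩ := isomorphic_iff.1 (isomorphic_out_mark a q)
    refine Eq.trans ?_ (tsum_comp_iso (N := (q.mark a).net) (N' := q.net.addMark fun d => a ⟨q.net, d⟩)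
      φ fun v => (f ∘ NetworkSpace.mark a) (NetworkSpace.mk q.net (c q.root v))).symm
    refine tsum_congr fun v => congrArg f ?_
    have e2 := mark_mk ha (⟨q.net, c q.root (φ v)⟩ : PointedNetwork (Fin 2) X Y)
    refine Eq.trans ?_ e2.symm
    refine mk_eq_mk (P := ⟨(q.mark a).net, c (q.mark a).root v⟩) (Q := ⟨q.net.addMark _, _⟩)
      (isomorphic_iff.2 ⟨φ, fun i => ?_, h.b, h.c, h.vmark, h.emark⟩)
    have e3 := congrFun (hc φ (q.mark a).root v) i
    refine e3.trans ?_
    have e4 : φ (q.mark a).root = q.root := h.pts 0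
    rw [e4]
    rfl
  have e1 := fun q => e q (fun u v => ![u, v]) fun φ u v => by ext i; fin_cases i <;> rfl
  have e2 := fun q => e q (fun u v => ![v, u]) fun φ u v => by ext i; fin_cases i <;> rfl
  simp only [e1, e2]
  exact h

end

noncomputable section

/-! ### Measurability of the messages -/

open PointedNetwork Network NetworkSpace

variable {X Y : Type*}

theorem aInf_eq_iff {N : Network X Y} {d : N.graph.Dart} {n : ℕ} :
    N.aInf d = n ↔ N.msgInf d n ≠ 0 ∧ ∀ x < n, N.msgInf d x = 0 := by
  constructor
  · rintro rfl
    exact ⟨(msgInf_aInf_pos d).ne', fun x hx => msgInf_of_lt_aInf hx⟩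
  · rintro ⟨h1, h2⟩
    refine le_antisymm (not_lt.1 fun h => h1 (msgInf_of_lt_aInf h)) (not_lt.1 fun h => ?_)
    exact (msgInf_aInf_pos d).ne' (h2 _ h)

theorem ofReal_wOcc {N : Network X Y} {lam : ℝ} (hl : 0 < lam) {W : N.graph.Dart → ℕ → ℝ}
    (hW : N.IsWeight W) (v : N.V) : ENNReal.ofReal (N.wOcc W v)
      = ∑ d ∈ N.inDarts v, ENNReal.ofReal (N.edgeMean lam W (N.wUpdate lam W) d) := by
  rw [wOcc_eq_sum_edgeMean hl hW, ENNReal.ofReal_sum_of_nonneg]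
  exact fun d _ => edgeMean_nonneg hl hW (hW.wUpdate hl) d

variable [PseudoMetricSpace Y]

theorem measurable_wLow {lam : ℝ} (hl : 0 < lam) (x : ℕ) :
    Measurable fun p : DartNetwork X Y => p.1.wLow lam p.2 x :=
  measurable_of_tendsto_metrizable (fun k => measurable_wIter lam (2 * k) x)
    (tendsto_pi_nhds.2 fun p => tendsto_wLow hl p.2 x)

theorem measurable_wHigh {lam : ℝ} (hl : 0 < lam) (x : ℕ) :
    Measurable fun p : DartNetwork X Y => p.1.wHigh lam p.2 x :=
  measurable_of_tendsto_metrizable (fun k => measurable_wIter lam (2 * k + 1) x)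
    (tendsto_pi_nhds.2 fun p => tendsto_wHigh hl p.2 x)

theorem measurable_sum_range_cap {g : ℕ → DartNetwork X Y → ℝ} (hg : ∀ x, Measurable (g x)) :
    Measurable fun p : DartNetwork X Y => ∑ x ∈ Finset.range (p.1.cap p.2 + 1), g x p := by
  have h : Measurable fun z : ℕ × DartNetwork X Y => ∑ x ∈ Finset.range (z.1 + 1), g x z.2 :=
    measurable_from_prod_countable_right fun n =>
      Finset.measurable_fun_sum (Finset.range (n + 1)) fun x _ => hg x
  exact h.comp (measurable_cap.prodMk measurable_id)

theorem measurable_edgeMean (lam : ℝ) {W W' : (N : Network X Y) → N.graph.Dart → ℕ → ℝ}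
    (hW : ∀ x, Measurable fun p : DartNetwork X Y => W p.1 p.2 x)
    (hW' : ∀ x, Measurable fun p : DartNetwork X Y => W' p.1 p.2 x) :
    Measurable fun p : DartNetwork X Y => p.1.edgeMean lam (W p.1) (W' p.1) p.2 := by
  have h : ∀ x, Measurable fun p : DartNetwork X Y => W p.1 p.2 x * W' p.1 p.2.symm x * lam⁻¹ ^ x :=
    fun x => ((hW x).mul ((hW' x).comp measurable_dart_symm)).mul_const _
  exact (measurable_sum_range_cap fun x => (h x).mul_const (x : ℝ)).div (measurable_sum_range_cap h)

theorem measurable_normalize {W : (N : Network X Y) → N.graph.Dart → ℕ → ℝ}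
    (hW : ∀ x, Measurable fun p : DartNetwork X Y => W p.1 p.2 x) (x : ℕ) :
    Measurable fun p : DartNetwork X Y => p.1.normalize (W p.1) p.2 x :=
  (measurable_sum_range_cap hW).inv.mul (hW x)

theorem measurable_msgInf (x : ℕ) : Measurable fun p : DartNetwork X Y => p.1.msgInf p.2 x := by
  have h : ∀ n : ℕ, Measurable fun p : DartNetwork X Y =>
      p.1.normalize (p.1.wLow ((n : ℝ) + 1)) p.2 x := fun n =>
    measurable_normalize (W := fun N => N.wLow ((n : ℝ) + 1))
      (fun x => measurable_wLow (by positivity) x) x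
  refine measurable_of_tendsto_metrizable h (tendsto_pi_nhds.2 fun p => ?_)
  exact (tendsto_msgInf p.2 x).comp
    (tendsto_atTop_add_const_right atTop 1 tendsto_natCast_atTop_atTop)

theorem measurable_aInf : Measurable fun p : DartNetwork X Y => p.1.aInf p.2 := by
  refine measurable_to_countable' fun n => ?_
  have e : (fun p : DartNetwork X Y => p.1.aInf p.2) ⁻¹' {n} = {p | p.1.msgInf p.2 n = 0}ᶜ ∩
      ⋂ x : ℕ, ⋂ _ : x < n, {p | p.1.msgInf p.2 x = 0} := by
    ext p
    simp only [mem_preimage, mem_singleton_iff, aInf_eq_iff, mem_inter_iff, mem_iInter]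
    rfl
  have hm : ∀ x, MeasurableSet {p : DartNetwork X Y | p.1.msgInf p.2 x = 0} := fun x =>
    measurable_msgInf x (measurableSet_singleton 0)
  rw [e]
  exact (hm n).compl.inter (MeasurableSet.iInter fun x => MeasurableSet.iInter fun _ => hm x)

/-- The version of `measurable_sum_inDarts` for natural numbers. -/
theorem measurable_nat_sum {a : DartNetwork X Y → ℕ} (ha : Measurable a) :
    Measurable fun P : VertexNetwork X Y => ∑ d ∈ P.1.inDarts P.2, a ⟨P.1, d⟩ := by
  refine measurable_to_countable' fun n => ?_
  have h := measurable_sum_inDarts (f := fun p => (a p : ℝ≥0∞)) ((measurable_of_countable _).comp ha)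
    (measurableSet_singleton (n : ℝ≥0∞))
  convert h using 1
  ext P
  simp only [mem_preimage, mem_singleton_iff]
  exact_mod_cast Iff.rfl

theorem measurable_slack {a : DartNetwork X Y → ℕ} (ha : Measurable a) :
    Measurable fun P : VertexNetwork X Y => P.1.slack (fun d => a ⟨P.1, d⟩) P.2 := by
  have h1 := measurable_nat_sum (measurable_cap (X := X) (Y := Y))
  have h2 := measurable_nat_sum (ha.comp measurable_dart_symm)
  exact Measurable.ite (measurableSet_lt measurable_b h1) (measurable_b.sub h2) measurable_const

theorem measurable_F {a : DartNetwork X Y → ℕ} (ha : Measurable a) :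
    Measurable fun P : VertexNetwork X Y => P.1.F (fun d => a ⟨P.1, d⟩) P.2 :=
  (measurable_b.min (measurable_nat_sum ha)).add (measurable_slack ha)

theorem measurableSet_unsat {a : DartNetwork X Y → ℕ} (ha : Measurable a) :
    MeasurableSet {P : VertexNetwork X Y | P.1.Unsat (fun d => a ⟨P.1, d⟩) P.2} :=
  measurableSet_lt (measurable_nat_sum ha) measurable_b

/-- Measurability comes from the expression of the occupancy as a sum over edges. -/
theorem measurable_wOcc_wLow {lam : ℝ} (hl : 0 < lam) :
    Measurable fun P : VertexNetwork X Y => P.1.wOcc (P.1.wLow lam) P.2 := by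
  have h := (measurable_sum_inDarts (measurable_edgeMean (X := X) (Y := Y) lam (W := fun N => N.wLow lam)
      (W' := fun N => N.wHigh lam) (measurable_wLow hl)
    (measurable_wHigh hl)).ennreal_ofReal).ennreal_toReal
  convert h using 2 with P
  have := ofReal_wOcc hl (isWeight_wLow (N := P.1) hl) P.2
  rw [wUpdate_wLow hl] at this
  rw [← this, ENNReal.toReal_ofReal (wOcc_nonneg (isWeight_wLow hl) P.2)]

theorem measurable_occupancy_msgInf :
    Measurable fun P : VertexNetwork X Y => P.1.occupancy P.1.msgInf P.2 := by
  have h : ∀ n : ℕ, Measurable fun P : VertexNetwork X Y =>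
      P.1.wOcc (P.1.wLow ((n : ℝ) + 1)) P.2 := fun n => measurable_wOcc_wLow (by positivity)
  refine measurable_of_tendsto_metrizable h (tendsto_pi_nhds.2 fun P => ?_)
  exact (tendsto_wOcc_msgInf P.2).comp
    (tendsto_atTop_add_const_right atTop 1 tendsto_natCast_atTop_atTop)

variable [PseudoMetricSpace X] {ρ : Measure (RootedSpace X Y)}

/-! ### Almost sure uniqueness -/

/-- By mass transport the expected occupancies at the root under the two extremal limits agree,
so the limits agree almost surely. -/
theorem IsUnimodular.ae_regular (hρ : IsUnimodular ρ)
    (hb : ∫⁻ q, (q.net.b q.root : ℝ≥0∞) ∂ρ < ∞) : ∀ᵐ q ∂ρ, q.net.Regular := by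
  have key : ∀ lam : ℝ, 0 < lam → ∀ᵐ q ∂ρ, q.net.wLow lam = q.net.wHigh lam := by
    intro lam hl
    have mE := (measurable_edgeMean (X := X) (Y := Y) lam (W := fun N => N.wLow lam)
      (W' := fun N => N.wHigh lam) (measurable_wLow hl)
      (measurable_wHigh hl)).ennreal_ofReal
    have mE' := (measurable_edgeMean (X := X) (Y := Y) lam (W := fun N => N.wHigh lam)
      (W' := fun N => N.wLow lam) (measurable_wHigh hl)
      (measurable_wLow hl)).ennreal_ofReal
    -- reversing an edge exchanges the two limits in `edgeMean`
    have h := hρ.lintegral_sum_inDarts mE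
    have e1 : ∀ (N : Network X Y) (v : N.V), ∑ d ∈ N.inDarts v,
        ENNReal.ofReal (N.edgeMean lam (N.wLow lam) (N.wHigh lam) d)
        = ENNReal.ofReal (N.wOcc (N.wLow lam) v) := fun N v => by
      rw [ofReal_wOcc hl (isWeight_wLow hl), wUpdate_wLow hl]
    have e2 : ∀ (N : Network X Y) (v : N.V), ∑ d ∈ N.inDarts v,
        ENNReal.ofReal (N.edgeMean lam (N.wHigh lam) (N.wLow lam) d)
        = ENNReal.ofReal (N.wOcc (N.wHigh lam) v) := fun N v => by
      rw [ofReal_wOcc hl (isWeight_wHigh hl), wUpdate_wHigh hl]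
    have m2 := measurable_comp_root (measurable_sum_inDarts mE')
    simp only [edgeMean_symm, e1, e2] at h m2
    have hle : ∀ q : RootedSpace X Y, ENNReal.ofReal (q.net.wOcc (q.net.wLow lam) q.root)
        ≤ ENNReal.ofReal (q.net.wOcc (q.net.wHigh lam) q.root) := fun q =>
      ENNReal.ofReal_le_ofReal (wOcc_mono (isWeight_wLow hl) (isWeight_wHigh hl)
        (fun d => PF2.of_tendsto (Eventually.of_forall fun _ => pf2_wIter hl _ d) (tendsto_wHigh hl d))
        (lrle_wLow_wHigh hl) q.root)
    have hfin : ∫⁻ q, ENNReal.ofReal (q.net.wOcc (q.net.wLow lam) q.root) ∂ρ ≠ ∞ := by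
      refine ((lintegral_mono fun q => ?_).trans_lt hb).ne
      rw [← ENNReal.ofReal_natCast]
      exact ENNReal.ofReal_le_ofReal (wOcc_le (isWeight_wLow hl) _)
    -- the pointwise ordered occupancies have the same finite integral
    have hae := ae_eq_of_ae_le_of_lintegral_le (Eventually.of_forall hle) hfin m2.aemeasurable h.le
    have mN : MeasurableSet {p : DartNetwork X Y | ∃ x, p.1.wLow lam p.2.symm x ≠ p.1.wHigh lam p.2.symm x} := by
      simp only [ofPred_exists]
      exact MeasurableSet.iUnion fun x => (measurableSet_eq_fun
        ((measurable_wLow hl x).comp measurable_dart_symm)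
        ((measurable_wHigh hl x).comp measurable_dart_symm)).compl
    have hroot : ∀ᵐ q ∂ρ, ∀ d ∈ q.net.inDarts q.root, (⟨q.net, d⟩ : DartNetwork X Y) ∉
        {p : DartNetwork X Y | ∃ x, p.1.wLow lam p.2.symm x ≠ p.1.wHigh lam p.2.symm x} := by
      filter_upwards [hae] with q hq d hd ⟨x, hx⟩
      have h1 : q.net.wOcc (q.net.wLow lam) q.root = q.net.wOcc (q.net.wHigh lam) q.root := by
        rwa [ENNReal.ofReal_eq_ofReal_iff (wOcc_nonneg (isWeight_wLow hl) _)
          (wOcc_nonneg (isWeight_wHigh hl) _)] at hq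
      exact hx (congrFun (wLow_eq_wHigh_of_wOcc_eq hl h1 (e := d.symm) ((mem_inDarts _).1 hd)) x)
    filter_upwards [hρ.ae_forall_dart mN hroot] with q hq
    ext d x
    by_contra hne
    refine hq d.symm ⟨x, ?_⟩
    rwa [SimpleGraph.Dart.symm_symm]
  have := ae_all_iff.2 fun r : ℚ => ae_all_iff.2 fun hr : 0 < r => key (r : ℝ) (by exact_mod_cast hr)
  exact this.mono fun q hq => regular_of_rat hq

end

noncomputable section

/-! ### Duality -/

open PointedNetwork Network NetworkSpace

variable {X Y : Type*}

open Classical in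
/-- The occupancy of `v` if the marks `a` saturate `v`; to this is added the mean occupancy of
every edge towards a neighbour that is not saturated.  On average this redistribution preserves
the occupancy. -/
def transported (lam : ℝ) (a : DartNetwork X Y → ℕ) (P : VertexNetwork X Y) : ℝ≥0∞ :=
  (if P.1.Unsat (fun d => a ⟨P.1, d⟩) P.2 then 0 else ENNReal.ofReal (P.1.wOcc (P.1.wLow lam) P.2))
    + ∑ d ∈ P.1.inDarts P.2, if P.1.Unsat (fun d => a ⟨P.1, d⟩) d.fst then
        ENNReal.ofReal (P.1.edgeMean lam (P.1.wLow lam) (P.1.wLow lam) d) else 0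

open Classical in
/-- The bound on `transported` given by the marks; on average it equals the function `F`. -/
def transportedMark (a : DartNetwork X Y → ℕ) (P : VertexNetwork X Y) : ℝ≥0∞ :=
  (if P.1.Unsat (fun d => a ⟨P.1, d⟩) P.2 then 0 else (P.1.b P.2 : ℝ≥0∞))
    + ((∑ d ∈ P.1.inDarts P.2, if P.1.Unsat (fun d => a ⟨P.1, d⟩) d.fst then
        (a ⟨P.1, d.symm⟩ : ℝ≥0∞) else 0) + P.1.slack (fun d => a ⟨P.1, d⟩) P.2)

open Classical in
theorem transported_sum_eq {lam : ℝ} (hl : 0 < lam) (a : DartNetwork X Y → ℕ) (P : VertexNetwork X Y) :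
    (∑ d ∈ P.1.inDarts P.2, if P.1.Unsat (fun d => a ⟨P.1, d⟩) d.fst then
        ENNReal.ofReal (P.1.edgeMean lam (P.1.wLow lam) (P.1.wLow lam) d) else 0)
      = ENNReal.ofReal (∑ d ∈ P.1.inDarts P.2, if P.1.Unsat (fun d => a ⟨P.1, d⟩) d.fst then
        P.1.edgeMean lam (P.1.wLow lam) (P.1.wLow lam) d else 0) := by
  rw [ENNReal.ofReal_sum_of_nonneg]
  · refine Finset.sum_congr rfl fun d _ => ?_
    split_ifs <;> simp
  · intro d _
    split_ifs
    · exact edgeMean_nonneg hl (isWeight_wLow hl) (isWeight_wLow hl) d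
    · exact le_rfl

open Classical in
theorem transportedMark_sum_eq (a : DartNetwork X Y → ℕ) (P : VertexNetwork X Y) :
    (∑ d ∈ P.1.inDarts P.2, if P.1.Unsat (fun d => a ⟨P.1, d⟩) d.fst then
        (a ⟨P.1, d.symm⟩ : ℝ≥0∞) else 0) + P.1.slack (fun d => a ⟨P.1, d⟩) P.2
      = ENNReal.ofReal ((∑ d ∈ P.1.inDarts P.2, if P.1.Unsat (fun d => a ⟨P.1, d⟩) d.fst then
        (a ⟨P.1, d.symm⟩ : ℝ) else 0) + P.1.slack (fun d => a ⟨P.1, d⟩) P.2) := by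
  rw [ENNReal.ofReal_add, ENNReal.ofReal_sum_of_nonneg, ENNReal.ofReal_natCast]
  · congr 1
    refine Finset.sum_congr rfl fun d _ => ?_
    split_ifs <;> simp
  · intro d _
    split_ifs <;> positivity
  · refine Finset.sum_nonneg fun d _ => ?_
    split_ifs <;> positivity
  · positivity

theorem ofReal_wOcc_le {N : Network X Y} {lam : ℝ} (hl : 0 < lam) (v : N.V) :
    ENNReal.ofReal (N.wOcc (N.wLow lam) v) ≤ N.b v := by
  rw [← ENNReal.ofReal_natCast]
  exact ENNReal.ofReal_le_ofReal (wOcc_le (isWeight_wLow hl) _)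

/-- Weak duality at a vertex. -/
theorem transported_le {lam : ℝ} (hl : 0 < lam) {a : DartNetwork X Y → ℕ} {P : VertexNetwork X Y}
    (hP : P.1.Regular)
    (ha : P.1.capUpdate (P.1.capUpdate fun d => a ⟨P.1, d⟩) = fun d => a ⟨P.1, d⟩) :
    transported lam a P ≤ transportedMark a P := by
  have wl := isWeight_wLow (N := P.1) hl
  refine add_le_add ?_ ?_
  · split_ifs
    · exact le_rfl
    · exact ofReal_wOcc_le hl _
  · rw [transported_sum_eq hl, transportedMark_sum_eq]
    refine ENNReal.ofReal_le_ofReal (sum_unsat_le ha P.2 (fun d _ => edgeMean_nonneg hl wl wl d)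
      (fun d _ => edgeMean_le hl wl wl d) ?_)
    have := wOcc_eq_sum_edgeMean hl wl P.2
    rw [hP.wUpdate_eq hl] at this
    rw [← this]
    exact wOcc_le wl _

/-- The bound needed for dominated convergence: each term of `transported` is at most `b`. -/
theorem transported_le_two_mul {lam : ℝ} (hl : 0 < lam) {a : DartNetwork X Y → ℕ}
    {P : VertexNetwork X Y} (hP : P.1.Regular) : transported lam a P ≤ 2 * (P.1.b P.2 : ℝ≥0∞) := by
  have wl := isWeight_wLow (N := P.1) hl
  have hb := ofReal_wOcc_le (N := P.1) hl P.2
  rw [two_mul]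
  refine add_le_add ?_ (le_trans ?_ hb)
  · split_ifs
    · exact zero_le
    · exact hb
  · rw [ofReal_wOcc hl wl, hP.wUpdate_eq hl]
    refine Finset.sum_le_sum fun d _ => ?_
    split_ifs
    · exact le_rfl
    · exact zero_le

/-- At the marks of the limiting messages, both parts of the bound are attained in the limit:
saturated vertices fill up, and so do the edges or vertices of `Regular.tendsto_sum_unsat`. -/
theorem tendsto_transported {P : VertexNetwork X Y} (hP : P.1.Regular) :
    Tendsto (fun lam => transported lam (fun p => p.1.aInf p.2) P) atTop
      (𝓝 (transportedMark (fun p => p.1.aInf p.2) P)) := by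
  refine Tendsto.add ?_ ?_
  · split_ifs with h
    · exact tendsto_const_nhds
    · have h1 := tendsto_wOcc_msgInf (N := P.1) P.2
      rw [occupancy_msgInf_eq (not_lt.1 h)] at h1
      simpa using ENNReal.tendsto_ofReal h1
  · have h1 := ENNReal.tendsto_ofReal (hP.tendsto_sum_unsat P.2)
    have e1 := transportedMark_sum_eq (fun p : DartNetwork X Y => p.1.aInf p.2) P
    have e2 := fun (lam : ℝ) (hl : 0 < lam) =>
      transported_sum_eq hl (fun p : DartNetwork X Y => p.1.aInf p.2) P
    beta_reduce at e1 e2 ⊢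
    rw [e1]
    refine Tendsto.congr' ?_ h1
    filter_upwards [eventually_gt_atTop 0] with lam hl
    rw [e2 lam hl]

variable [PseudoMetricSpace Y]

theorem measurable_transported {a : DartNetwork X Y → ℕ} (ha : Measurable a) {lam : ℝ} (hl : 0 < lam) :
    Measurable (transported lam a) := by
  have mE := (measurable_edgeMean (X := X) (Y := Y) lam (W := fun N => N.wLow lam)
      (W' := fun N => N.wLow lam) (measurable_wLow hl) (measurable_wLow hl)).ennreal_ofReal
  classical
  have m1 : Measurable fun P : VertexNetwork X Y => if P.1.Unsat (fun d => a ⟨P.1, d⟩) P.2 then 0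
      else ENNReal.ofReal (P.1.wOcc (P.1.wLow lam) P.2) :=
    Measurable.ite (measurableSet_unsat ha) measurable_const (measurable_wOcc_wLow hl).ennreal_ofReal
  have m2 : Measurable fun p : DartNetwork X Y => if p.1.Unsat (fun d => a ⟨p.1, d⟩) p.2.fst then
      ENNReal.ofReal (p.1.edgeMean lam (p.1.wLow lam) (p.1.wLow lam) p.2) else 0 :=
    Measurable.ite (measurable_dart_fst (measurableSet_unsat ha)) mE measurable_const
  have e : transported lam a = fun P => (if P.1.Unsat (fun d => a ⟨P.1, d⟩) P.2 then 0
      else ENNReal.ofReal (P.1.wOcc (P.1.wLow lam) P.2)) + ∑ d ∈ P.1.inDarts P.2,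
      if P.1.Unsat (fun d => a ⟨P.1, d⟩) d.fst then
        ENNReal.ofReal (P.1.edgeMean lam (P.1.wLow lam) (P.1.wLow lam) d) else 0 := by
    ext P
    unfold transported
    congr!
  rw [e]
  exact m1.add (measurable_sum_inDarts m2)

variable [PseudoMetricSpace X] {ρ : Measure (RootedSpace X Y)}

open Classical in
/-- Mass sent to the unsaturated vertices is on average the mass sent by them. -/
theorem IsUnimodular.lintegral_unsat (hρ : IsUnimodular ρ) {a : DartNetwork X Y → ℕ}
    (ha : Measurable a) {f : DartNetwork X Y → ℝ≥0∞} (hf : Measurable f) :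
    ∫⁻ q, ∑ d ∈ q.net.inDarts q.root, (if q.net.Unsat (fun d => a ⟨q.net, d⟩) d.fst then
        f ⟨q.net, d.symm⟩ else 0) ∂ρ
      = ∫⁻ q, (if q.net.Unsat (fun d => a ⟨q.net, d⟩) q.root then
        ∑ d ∈ q.net.inDarts q.root, f ⟨q.net, d⟩ else 0) ∂ρ := by
  have hm : Measurable fun p : DartNetwork X Y =>
      if p.1.Unsat (fun d => a ⟨p.1, d⟩) p.2.snd then f p else 0 :=
    Measurable.ite (measurable_dart_snd (measurableSet_unsat ha)) hf measurable_const
  refine (hρ.lintegral_sum_inDarts hm).trans (lintegral_congr fun q => ?_)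
  split_ifs with h
  · refine Finset.sum_congr rfl fun d hd => ?_
    rw [(mem_inDarts _).1 hd, if_pos h]
  · refine Finset.sum_eq_zero fun d hd => ?_
    rw [(mem_inDarts _).1 hd, if_neg h]

/-- An unsaturated vertex sends the mean occupancy of each of its edges to the other endpoint, that
is, it sends its whole occupancy. -/
theorem IsUnimodular.lintegral_transported (hρ : IsUnimodular ρ) (hN : ∀ᵐ q ∂ρ, q.net.Regular)
    {a : DartNetwork X Y → ℕ} (ha : Measurable a) {lam : ℝ} (hl : 0 < lam) :
    ∫⁻ q, transported lam a ⟨q.net, q.root⟩ ∂ρ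
      = ∫⁻ q, ENNReal.ofReal (q.net.wOcc (q.net.wLow lam) q.root) ∂ρ := by
  classical
  have mE := (measurable_edgeMean (X := X) (Y := Y) lam (W := fun N => N.wLow lam)
      (W' := fun N => N.wLow lam) (measurable_wLow hl) (measurable_wLow hl)).ennreal_ofReal
  have mD := measurable_comp_root (measurable_wOcc_wLow (X := X) (Y := Y) hl).ennreal_ofReal
  have mU := measurable_toVertexNetwork (X := X) (Y := Y) (measurableSet_unsat ha)
  have m1 : Measurable fun q : RootedSpace X Y =>
      if q.net.Unsat (fun d => a ⟨q.net, d⟩) q.root then 0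
        else ENNReal.ofReal (q.net.wOcc (q.net.wLow lam) q.root) :=
    Measurable.ite mU measurable_const mD
  have h := hρ.lintegral_unsat ha mE
  simp only [edgeMean_symm] at h
  unfold transported
  rw [lintegral_add_left m1, h, ← lintegral_add_left m1]
  refine lintegral_congr_ae ?_
  filter_upwards [hN] with q hq
  rw [ofReal_wOcc hl (isWeight_wLow hl), hq.wUpdate_eq hl]
  split_ifs <;> simp

/-- An unsaturated vertex sends the incoming marks to its neighbours; these marks sum to
`min (b, |a|)` there. -/
theorem IsUnimodular.lintegral_transportedMark (hρ : IsUnimodular ρ)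
    {a : DartNetwork X Y → ℕ} (ha : Measurable a) :
    ∫⁻ q, transportedMark a ⟨q.net, q.root⟩ ∂ρ
      = ∫⁻ q, (q.net.F (fun d => a ⟨q.net, d⟩) q.root : ℝ≥0∞) ∂ρ := by
  classical
  have mA : Measurable fun p : DartNetwork X Y => (a p : ℝ≥0∞) := (measurable_of_countable _).comp ha
  have mB : Measurable fun q : RootedSpace X Y => (q.net.b q.root : ℝ≥0∞) :=
    (measurable_of_countable (fun n : ℕ => (n : ℝ≥0∞))).comp
    (measurable_comp_root (measurable_b (X := X) (Y := Y)))
  have mS : Measurable fun q : RootedSpace X Y =>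
      (q.net.slack (fun d => a ⟨q.net, d⟩) q.root : ℝ≥0∞) :=
    (measurable_of_countable (fun n : ℕ => (n : ℝ≥0∞))).comp
    (measurable_comp_root (measurable_slack ha))
  have mU := measurable_toVertexNetwork (X := X) (Y := Y) (measurableSet_unsat ha)
  have m1 : Measurable fun q : RootedSpace X Y =>
      if q.net.Unsat (fun d => a ⟨q.net, d⟩) q.root then 0 else (q.net.b q.root : ℝ≥0∞) :=
    Measurable.ite mU measurable_const mB
  have h := hρ.lintegral_unsat ha mA
  unfold transportedMark
  dsimp only
  rw [lintegral_add_left m1, lintegral_add_right _ mS, h, ← lintegral_add_right _ mS,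
    ← lintegral_add_left m1]
  refine lintegral_congr fun q => ?_
  have e : q.net.F (fun d => a ⟨q.net, d⟩) q.root
      = min (q.net.b q.root) (∑ d ∈ q.net.inDarts q.root, a ⟨q.net, d⟩)
        + q.net.slack (fun d => a ⟨q.net, d⟩) q.root := rfl
  rw [e, Nat.cast_add, ← add_assoc]
  congr 1
  split_ifs with hU
  · rw [min_eq_right (le_of_lt hU), zero_add, Nat.cast_sum]
  · rw [min_eq_left (not_lt.1 hU), add_zero]

/-- The occupancy at positive temperature is at most the expectation of `F` for any fixed point. -/
theorem IsUnimodular.lintegral_wOcc_le (hρ : IsUnimodular ρ) (hN : ∀ᵐ q ∂ρ, q.net.Regular)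
    {a : DartNetwork X Y → ℕ} (ha : Measurable a)
    (hfix : ∀ᵐ q ∂ρ, q.net.capUpdate (q.net.capUpdate fun d => a ⟨q.net, d⟩) = fun d => a ⟨q.net, d⟩)
    {lam : ℝ} (hl : 0 < lam) :
    ∫⁻ q, ENNReal.ofReal (q.net.wOcc (q.net.wLow lam) q.root) ∂ρ
      ≤ ∫⁻ q, (q.net.F (fun d => a ⟨q.net, d⟩) q.root : ℝ≥0∞) ∂ρ := by
  rw [← hρ.lintegral_transported hN ha hl, ← hρ.lintegral_transportedMark ha]
  refine lintegral_mono_ae ?_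
  filter_upwards [hN, hfix] with q h1 h2
  exact transported_le hl h1 h2

/-- The occupancies are dominated by `b`. -/
theorem tendsto_lintegral_wOcc (hb : ∫⁻ q, (q.net.b q.root : ℝ≥0∞) ∂ρ < ∞) :
    Tendsto (fun lam => ∫⁻ q, ENNReal.ofReal (q.net.wOcc (q.net.wLow lam) q.root) ∂ρ) atTop
      (𝓝 (∫⁻ q, ENNReal.ofReal (q.net.occupancy q.net.msgInf q.root) ∂ρ)) := by
  refine tendsto_lintegral_filter_of_dominated_convergence (fun q => (q.net.b q.root : ℝ≥0∞))
    ?_ ?_ hb.ne ?_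
  · filter_upwards [eventually_gt_atTop 0] with lam hl
    exact measurable_comp_root (measurable_wOcc_wLow hl).ennreal_ofReal
  · filter_upwards [eventually_gt_atTop 0] with lam hl
    exact Eventually.of_forall fun q => ofReal_wOcc_le hl _
  · exact Eventually.of_forall fun q => ENNReal.tendsto_ofReal (tendsto_wOcc_msgInf _)

/-- For the marks of the limiting messages there is no loss in the limit. -/
theorem IsUnimodular.lintegral_occupancy_msgInf (hρ : IsUnimodular ρ)
    (hb : ∫⁻ q, (q.net.b q.root : ℝ≥0∞) ∂ρ < ∞) (hN : ∀ᵐ q ∂ρ, q.net.Regular) :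
    ∫⁻ q, ENNReal.ofReal (q.net.occupancy q.net.msgInf q.root) ∂ρ
      = ∫⁻ q, (q.net.F q.net.aInf q.root : ℝ≥0∞) ∂ρ := by
  refine tendsto_nhds_unique (tendsto_lintegral_wOcc hb) ?_
  rw [← hρ.lintegral_transportedMark (measurable_aInf (X := X) (Y := Y))]
  have h2b : ∫⁻ q, 2 * (q.net.b q.root : ℝ≥0∞) ∂ρ ≠ ∞ := by
    rw [lintegral_const_mul' _ _ ENNReal.ofNat_ne_top]
    exact ENNReal.mul_ne_top ENNReal.ofNat_ne_top hb.ne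
  have lim := tendsto_lintegral_filter_of_dominated_convergence (μ := ρ) (l := atTop)
    (F := fun lam q => transported lam (fun p => p.1.aInf p.2) ⟨q.net, q.root⟩)
    (f := fun q => transportedMark (fun p => p.1.aInf p.2) ⟨q.net, q.root⟩)
    (fun q => 2 * (q.net.b q.root : ℝ≥0∞)) ?_ ?_ h2b (hN.mono fun q hq => tendsto_transported hq)
  · refine lim.congr' ?_
    filter_upwards [eventually_gt_atTop 0] with lam hl
    exact hρ.lintegral_transported hN measurable_aInf hl
  · filter_upwards [eventually_gt_atTop 0] with lam hl
    exact measurable_comp_root (measurable_transported measurable_aInf hl)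
  · filter_upwards [eventually_gt_atTop 0] with lam hl
    exact hN.mono fun q hq => transported_le_two_mul hl hq

end

noncomputable section

open PointedNetwork Network NetworkSpace

variable {X Y : Type*}

/-! ### The limiting messages -/

theorem Network.Regular.bpMessageInf_eq {N : Network X Y} (hN : N.Regular) :
    N.bpMessageInf = N.msgInf := by
  ext d x
  refine Tendsto.limUnder_eq ((tendsto_msgInf d x).congr' ?_)
  filter_upwards [eventually_gt_atTop 0] with lam hl
  rw [hN.bpMessage_eq hl]

theorem Network.Regular.alphaInf_eq {N : Network X Y} (hN : N.Regular) : N.alphaInf = N.aInf := by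
  unfold alphaInf
  rw [hN.bpMessageInf_eq]
  rfl

theorem Network.Regular.occupancy_bpMessage_eq {N : Network X Y} (hN : N.Regular) {lam : ℝ}
    (hl : 0 < lam) (v : N.V) : N.occupancy (N.bpMessage lam) v = N.wOcc (N.wLow lam) v := by
  rw [hN.bpMessage_eq hl, occupancy_normalize (isWeight_wLow hl)]

/-! ### Forgetting and adding marks -/

/-- The messages do not depend on the marks. -/
theorem wIter_forget (lam : ℝ) (N : Network X (Y × ℕ)) (k : ℕ) :
    N.forget.wIter lam k = N.wIter lam k := by
  induction k with
  | zero => rfl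
  | succ k ih => exact congrArg (N.wUpdate lam) ih

theorem wOcc_forget (lam : ℝ) (N : Network X (Y × ℕ)) (v : N.V) :
    N.forget.wOcc (N.forget.wLow lam) v = N.wOcc (N.wLow lam) v := by
  have h : N.forget.wLow lam = N.wLow lam := by
    ext d x
    exact congrArg iSup (funext fun k => congrFun (congrFun (wIter_forget lam N (2 * k)) d) x)
  exact congrArg (fun W => N.wOcc W v) h

theorem root_eq_of_isomorphic [PseudoMetricSpace X] [PseudoMetricSpace Y] {Z : Type*} [MeasurableSpace Z]
    [MeasurableSingletonClass Z] {f : VertexNetwork X Y → Z} (hf : Measurable f)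
    {P Q : PointedNetwork (Fin 1) X Y} (h : Isomorphic P Q) :
    f ⟨P.1, P.2 0⟩ = f ⟨Q.1, Q.2 0⟩ := by
  obtain ⟨φ, h1, h2⟩ := h.exists_goodAt
  exact vertex_eq_of_good hf (P := ⟨P.1, P.2 0⟩) (Q := ⟨Q.1, Q.2 0⟩) φ (h1 0) h2

theorem Network.GoodAt.capUpdate_eq [PseudoMetricSpace Y] {N N' : Network X Y} {φ : N.V → N'.V}
    {e : N.graph.Dart} {e' : N'.graph.Dart} (h : GoodAt φ e.fst) (he : DartRel φ e e')
    {a : N.graph.Dart → ℕ} {a' : N'.graph.Dart → ℕ}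
    (ha : ∀ d d', d.snd = e.fst → DartRel φ d d' → a d = a' d') :
    N.capUpdate a e = N'.capUpdate a' e' := by
  have hs := h.sum_inDarts ha
  have hb := h.b
  rw [he.1] at hs hb
  have h1 := ha e.symm e'.symm rfl he.symm
  have r : ∀ (M : Network X Y) (c : M.graph.Dart → ℕ) (d : M.graph.Dart),
      ∑ x ∈ M.inDarts d.fst, c x = ∑ x ∈ M.preDarts d, c x + c d.symm := by
    intro M c d
    classical
    unfold preDarts
    rw [add_comm, ← Finset.sum_filter_add_sum_filter_not (M.inDarts d.fst) (fun x => x = d.symm)]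
    congr 1
    have hm : d.symm ∈ M.inDarts d.fst := (mem_inDarts M).2 rfl
    rw [Finset.filter_eq', if_pos hm, Finset.sum_singleton]
  rw [r, r, h1] at hs
  rw [capUpdate, capUpdate, (h.dart e e' rfl he).1, hb, Nat.add_right_cancel hs]

/-- Being a fixed point is preserved under isomorphisms. -/
theorem capUpdate_fixed_of_isomorphic [PseudoMetricSpace X] [PseudoMetricSpace Y]
    {P Q : PointedNetwork (Fin 1) X (Y × ℕ)} (h : Isomorphic P Q)
    (hQ : Q.1.capUpdate (Q.1.capUpdate Q.1.extraMark) = Q.1.extraMark) :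
    P.1.capUpdate (P.1.capUpdate P.1.extraMark) = P.1.extraMark := by
  obtain ⟨φ, h⟩ := isomorphic_iff.1 h
  have h1 : ∀ d d', DartRel φ d d' → P.1.extraMark d = Q.1.extraMark d' := fun d d' hd =>
    extraMark_eq (h.goodAt _) hd
  have h2 : ∀ d d', DartRel φ d d' → P.1.capUpdate P.1.extraMark d = Q.1.capUpdate Q.1.extraMark d' :=
    fun d d' hd => (h.goodAt _).capUpdate_eq hd fun x x' _ => h1 x x'
  ext d
  have hd : DartRel φ d (φ.toHom.mapDart d) := ⟨rfl, rfl⟩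
  rw [(h.goodAt _).capUpdate_eq hd fun x x' _ => h2 x x', hQ, h1 _ _ hd]

variable [PseudoMetricSpace X] [PseudoMetricSpace Y] [SecondCountableTopology X]
  [SecondCountableTopology Y] {ρ : Measure (RootedSpace X Y)}

theorem IsFixedPointMarking.lintegral_forget {ρ' : Measure (RootedSpace X (Y × ℕ))}
    (h : IsFixedPointMarking ρ ρ') {f : VertexNetwork X Y → ℝ≥0∞} (hf : Measurable f) :
    ∫⁻ q, f ⟨q.net.forget, q.root⟩ ∂ρ' = ∫⁻ q, f ⟨q.net, q.root⟩ ∂ρ := by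
  rw [← h.map_forget, lintegral_map (measurable_comp_root hf) measurable_forget]
  exact lintegral_congr fun q => (root_eq_of_isomorphic hf (isomorphic_out_forget q)).symm

/-- The marks of the limiting messages are a fixed point. -/
theorem IsUnimodular.isFixedPointMarking_mark (hρ : IsUnimodular ρ)
    (hN : ∀ᵐ q ∂ρ, q.net.Regular) :
    IsFixedPointMarking ρ (ρ.map (NetworkSpace.mark fun p => p.1.aInf p.2)) where
  unimodular := hρ.map_mark measurable_aInf
  map_forget := by
    rw [Measure.map_map measurable_forget (measurable_mark measurable_aInf)]
    have : RootedSpace.forget ∘ NetworkSpace.mark (ι := Fin 1) (X := X) (Y := Y)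
        (fun p => p.1.aInf p.2) = id := funext fun q => forget_mark _ q
    rw [this, Measure.map_id]
  fixed := by
    rw [(measurableEmbedding_mark measurable_aInf).ae_map_iff]
    filter_upwards [hN] with q hq
    exact capUpdate_fixed_of_isomorphic (isomorphic_out_mark _ q) hq.capUpdate_gInf

/-- The marking by the limiting messages attains the infimum. -/
theorem lintegral_F_mark (ρ : Measure (RootedSpace X Y)) :
    ∫⁻ q, (q.net.F q.net.extraMark q.root : ℝ≥0∞) ∂(ρ.map (NetworkSpace.mark fun p => p.1.aInf p.2))
      = ∫⁻ q, (q.net.F q.net.aInf q.root : ℝ≥0∞) ∂ρ := by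
  rw [(measurableEmbedding_mark measurable_aInf).lintegral_map]
  refine lintegral_congr fun q => ?_
  exact congrArg Nat.cast (root_eq_of_isomorphic (measurable_F measurable_extraMark)
    (isomorphic_out_mark (fun p => p.1.aInf p.2) q))

/-- Weak duality for marks that need not be a function of the network: it is applied to the law of
the marked network, whose messages are those of the network. -/
theorem IsFixedPointMarking.lintegral_wOcc_le {ρ' : Measure (RootedSpace X (Y × ℕ))}
    (h : IsFixedPointMarking ρ ρ') (hb : ∫⁻ q, (q.net.b q.root : ℝ≥0∞) ∂ρ < ∞) {lam : ℝ}
    (hl : 0 < lam) :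
    ∫⁻ q, ENNReal.ofReal (q.net.wOcc (q.net.wLow lam) q.root) ∂ρ
      ≤ ∫⁻ q, (q.net.F q.net.extraMark q.root : ℝ≥0∞) ∂ρ' := by
  have hb' : ∫⁻ q, (q.net.b q.root : ℝ≥0∞) ∂ρ' < ∞ :=
    (h.lintegral_forget (f := fun P => (P.1.b P.2 : ℝ≥0∞))
      ((measurable_of_countable (fun n : ℕ => (n : ℝ≥0∞))).comp measurable_b)).trans_lt hb
  have e := h.lintegral_forget (measurable_wOcc_wLow hl).ennreal_ofReal
  simp only [wOcc_forget] at e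
  rw [← e]
  exact h.unimodular.lintegral_wOcc_le (h.unimodular.ae_regular hb') measurable_extraMark h.fixed hl

end

/-! ### The limiting occupancy of unimodular networks -/

theorem mainTheorem5 {X Y : Type*}
    [MetricSpace X] [CompleteSpace X] [TopologicalSpace.SeparableSpace X]
    [MetricSpace Y] [CompleteSpace Y] [TopologicalSpace.SeparableSpace Y]
    (ρ : Measure (RootedSpace X Y)) (hρ : IsUnimodular ρ)
    (hb : ∫⁻ q, (q.net.b q.root : ℝ≥0∞) ∂ρ < ∞) :
    -- almost surely the messages `m^{(λ)}` and their limit are well defined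
    (∀ᵐ q ∂ρ, ∀ lam : ℝ, 0 < lam → ∃! m, q.net.IsBPFixedPoint lam m) ∧
    (∀ᵐ q ∂ρ, ∀ d x, Tendsto (fun lam : ℝ => q.net.bpMessage lam d x) atTop
      (𝓝 (q.net.bpMessageInf d x))) ∧
    -- the integrands below are measurable up to null sets
    (∀ lam : ℝ, 0 < lam →
      AEMeasurable (fun q => q.net.occupancy (q.net.bpMessage lam) q.root) ρ) ∧
    AEMeasurable (fun q => q.net.occupancy q.net.bpMessageInf q.root) ρ ∧
    AEMeasurable (fun q => q.net.F q.net.alphaInf q.root) ρ ∧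
    -- the increasing limit
    MonotoneOn (fun lam : ℝ =>
      ∫⁻ q, ENNReal.ofReal (q.net.occupancy (q.net.bpMessage lam) q.root) ∂ρ) (Ioi 0) ∧
    Tendsto (fun lam : ℝ =>
      ∫⁻ q, ENNReal.ofReal (q.net.occupancy (q.net.bpMessage lam) q.root) ∂ρ) atTop
      (𝓝 (∫⁻ q, ENNReal.ofReal (q.net.occupancy q.net.bpMessageInf q.root) ∂ρ)) ∧
    -- its value
    ∫⁻ q, ENNReal.ofReal (q.net.occupancy q.net.bpMessageInf q.root) ∂ρ
      = ∫⁻ q, (q.net.F q.net.alphaInf q.root : ℝ≥0∞) ∂ρ ∧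
    -- `α^{(∞)}` is itself a fixed point, and the value is the infimum over all fixed points
    (∀ᵐ q ∂ρ, q.net.capUpdate (q.net.capUpdate q.net.alphaInf) = q.net.alphaInf) ∧
    ∫⁻ q, (q.net.F q.net.alphaInf q.root : ℝ≥0∞) ∂ρ
      = ⨅ (ρ' : Measure (RootedSpace X (Y × ℕ))) (_ : IsFixedPointMarking ρ ρ'),
          ∫⁻ q, (q.net.F q.net.extraMark q.root : ℝ≥0∞) ∂ρ' := by
  have := UniformSpace.secondCountable_of_separable X
  have := UniformSpace.secondCountable_of_separable Y
  have hN := hρ.ae_regular hb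
  have eocc : ∀ lam : ℝ, 0 < lam →
      (fun q : RootedSpace X Y => q.net.occupancy (q.net.bpMessage lam) q.root) =ᵐ[ρ]
        fun q => q.net.wOcc (q.net.wLow lam) q.root := fun lam hl =>
    hN.mono fun q hq => hq.occupancy_bpMessage_eq hl _
  have einf : (fun q : RootedSpace X Y => q.net.occupancy q.net.bpMessageInf q.root) =ᵐ[ρ]
      fun q => q.net.occupancy q.net.msgInf q.root := hN.mono fun q hq => by
    simp only [hq.bpMessageInf_eq]
  have eF : (fun q : RootedSpace X Y => q.net.F q.net.alphaInf q.root) =ᵐ[ρ]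
      fun q => q.net.F q.net.aInf q.root := hN.mono fun q hq => by
    simp only [hq.alphaInf_eq]
  have iocc : ∀ lam : ℝ, 0 < lam →
      ∫⁻ q, ENNReal.ofReal (q.net.occupancy (q.net.bpMessage lam) q.root) ∂ρ
        = ∫⁻ q, ENNReal.ofReal (q.net.wOcc (q.net.wLow lam) q.root) ∂ρ := fun lam hl =>
    lintegral_congr_ae ((eocc lam hl).mono fun q hq => congrArg ENNReal.ofReal hq)
  have iinf : ∫⁻ q, ENNReal.ofReal (q.net.occupancy q.net.bpMessageInf q.root) ∂ρ
      = ∫⁻ q, ENNReal.ofReal (q.net.occupancy q.net.msgInf q.root) ∂ρ :=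
    lintegral_congr_ae (einf.mono fun q hq => congrArg ENNReal.ofReal hq)
  have iF : ∫⁻ q, (q.net.F q.net.alphaInf q.root : ℝ≥0∞) ∂ρ
      = ∫⁻ q, (q.net.F q.net.aInf q.root : ℝ≥0∞) ∂ρ :=
    lintegral_congr_ae (eF.mono fun q hq => congrArg Nat.cast hq)
  have lim := tendsto_lintegral_wOcc hb
  have value := hρ.lintegral_occupancy_msgInf hb hN
  refine ⟨hN.mono fun q hq lam hl => hq.existsUnique hl, hN.mono fun q hq d x => ?_,
    fun lam hl => ?_, ?_, ?_, fun lam hl mu hm hlm => ?_, ?_, ?_, hN.mono fun q hq => ?_, ?_⟩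
  · rw [hq.bpMessageInf_eq]
    refine (Network.tendsto_msgInf d x).congr' ?_
    filter_upwards [eventually_gt_atTop 0] with lam hl
    rw [hq.bpMessage_eq hl]
  · exact (measurable_comp_root (measurable_wOcc_wLow hl)).aemeasurable.congr (eocc lam hl).symm
  · exact (measurable_comp_root measurable_occupancy_msgInf).aemeasurable.congr einf.symm
  · exact (measurable_comp_root (measurable_F measurable_aInf)).aemeasurable.congr eF.symm
  · beta_reduce
    rw [iocc lam hl, iocc mu hm]
    exact lintegral_mono fun q => ENNReal.ofReal_le_ofReal (Network.wOcc_mono (Network.isWeight_wLow hl)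
      (Network.isWeight_wLow hm) (Network.pf2_wLow hm) (fun d => (Network.wLow_lam_mono hl hlm d).1) q.root)
  · rw [iinf]
    refine lim.congr' ?_
    filter_upwards [eventually_gt_atTop 0] with lam hl
    exact (iocc lam hl).symm
  · rw [iinf, iF, value]
  · rw [hq.alphaInf_eq]
    exact hq.capUpdate_gInf
  · rw [iF]
    refine le_antisymm (le_iInf₂ fun ρ' h => ?_) ?_
    · rw [← value]
      refine le_of_tendsto lim ?_
      filter_upwards [eventually_gt_atTop 0] with lam hl
      exact h.lintegral_wOcc_le hb hl
    · exact (iInf₂_le _ (hρ.isFixedPointMarking_mark hN)).trans_eq (lintegral_F_mark ρ)
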